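/- Let $\mathbb T^3=(\mathbb R/2\pi\mathbb Z)^3$. For $s\in\mathbb R$ let $H^s(\mathbb T^3)$ be the space of real-valued distributions $f=\sum_{n\in\mathbb Z^3}\hat f(n)e^{in\cdot x}$ with $\|f\|_{H^s}^2=\sum_n\langle n\rangle^{2s}|\hat f(n)|^2<\infty$, $\langle n\rangle=(1+|n|^2)^{1/2}$, and let $\mathcal H^s=H^s(\mathbb T^3)\times H^{s-1}(\mathbb T^3)$, with its Borel $\sigma$-algebra. For $(v_0,v_1)\in\mathcal H^s$ let $S(t)(v_0,v_1)=\cos(t\sqrt{-\Delta})v_0+\frac{\sin(t\sqrt{-\Delta})}{\sqrt{-\Delta}}v_1$ be the free evolution (with symbol $t$ for $\frac{\sin(t\sqrt{-\Delta})}{\sqrt{-\Delta}}$ at $n=0$). Randomised data. Let $(u_0,u_1)\in\mathcal H^s$ and write $$u_j=a_j+\sum_{n\in\mathbb Z^3\setminus\{0\}}\big(b_{n,j}\cos(n\cdot x)+c_{n,j}\sin(n\cdot x)\big),\qquad j=0,1,$$ with real coefficients such that $\sum_{n\ne0}\langle n\rangle^{2(s-j)}(b_{n,j}^2+c_{n,j}^2)<\infty$.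 Let $\alpha_j,\beta_{n,j},\gamma_{n,j}$ ($n\in\mathbb Z^3\setminus\{0\}$, $j=0,1$) be independent identically distributed real random variables on a probability space $(\Omega,\mathcal F,p)$ whose law $\theta$ satisfies, for some $c>0$, $\int_{\mathbb R} e^{\gamma x}\,d\theta(x)\le e^{c\gamma^2}$ for all $\gamma\in\mathbb R$, and put $$u_j^\omega=\alpha_j(\omega)a_j+\sum_{n\ne0}\big(\beta_{n,j}(\omega)b_{n,j}\cos(n\cdot x)+\gamma_{n,j}(\omega)c_{n,j}\sin(n\cdot x)\big).$$ Almost surely $(u_0^\omega,u_1^\omega)\in\mathcal H^s$; let $\mathcal M^s$ be the set of all probability measures on $\mathcal H^s$ that arise as the law of such a random variable $(u_0^\omega,u_1^\omega)$. Theorem. Let $s\in(0,1)$ and $\mu\in\mathcal M^s$. Then there is a set $\Sigma\subset\mathcal H^s$ of full $\mu$-measure such that for every $(v_0,v_1)\in\Sigma$ there is a unique global solution $v$ (in the sense of distributions on $\mathbb R\times\mathbb T^3$, with $v\in L^3_{\rm loc}(\mathbb R\times\mathbb T^3)$) of $$(\partial_t^2-\Delta)v+v^3=0,\qquad (v(0),\partial_tv(0))=(v_0,v_1),$$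 satisfying $$(v(t),\partial_tv(t))\in\big(S(t)(v_0,v_1),\partial_tS(t)(v_0,v_1)\big)+C(\mathbb R;H^1(\mathbb T^3)\times L^2(\mathbb T^3)).$$ Moreover, if $\Phi(t)(v_0,v_1)=(v(t),\partial_tv(t))$ denotes the flow thus defined on $\Sigma$, then $\Phi(t)(\Sigma)=\Sigma$ for every $t\in\mathbb R$. -/

import Mathlib

open MeasureTheory ProbabilityTheory

universe u

noncomputable section

namespace CubicWave

/-! ## Sobolev spaces of real-valued distributions on the torus `(ℝ / 2πℤ)³` -/

/-- Frequencies `n ∈ ℤ³`. -/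
abbrev Freq : Type := Fin 3 → ℤ

/-- `|n|²`, the square of the Euclidean length of `n`. -/
def lenSq (n : Freq) : ℝ := ∑ i, (n i : ℝ) ^ 2

/-- `|n|`. -/
def len (n : Freq) : ℝ := Real.sqrt (lenSq n)

/-- `⟨n⟩ = (1 + |n|²)^{1/2}`. -/
def bracket (n : Freq) : ℝ := Real.sqrt (1 + lenSq n)

lemma lenSq_nonneg (n : Freq) : 0 ≤ lenSq n := Finset.sum_nonneg fun _ _ => sq_nonneg _

lemma lenSq_neg (n : Freq) : lenSq (-n) = lenSq n := by simp [lenSq]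

lemma len_neg (n : Freq) : len (-n) = len n := by simp [len, lenSq_neg]

lemma bracket_neg (n : Freq) : bracket (-n) = bracket n := by simp [bracket, lenSq_neg]

lemma len_nonneg (n : Freq) : 0 ≤ len n := Real.sqrt_nonneg _

lemma len_sq (n : Freq) : len n ^ 2 = lenSq n := Real.sq_sqrt (lenSq_nonneg n)

lemma bracket_sq (n : Freq) : bracket n ^ 2 = 1 + lenSq n :=
  Real.sq_sqrt (by have := lenSq_nonneg n; linarith)

lemma one_le_bracket (n : Freq) : 1 ≤ bracket n :=
  Real.one_le_sqrt.2 (by have := lenSq_nonneg n; linarith)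

lemma bracket_pos (n : Freq) : 0 < bracket n := lt_of_lt_of_le one_pos (one_le_bracket n)

lemma len_le_bracket (n : Freq) : len n ≤ bracket n :=
  Real.sqrt_le_sqrt (by linarith)

lemma one_le_len {n : Freq} (h : n ≠ 0) : 1 ≤ len n := by
  refine Real.one_le_sqrt.2 ?_
  obtain ⟨i, hi⟩ := Function.ne_iff.1 h
  have h1 : (1 : ℝ) ≤ (n i : ℝ) ^ 2 := by
    have : (1 : ℤ) ≤ (n i) ^ 2 := by
      have : 0 < (n i) ^ 2 := by
        have : n i ≠ 0 := by simpa using hi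
        positivity
      omega
    exact_mod_cast this
  exact h1.trans (Finset.single_le_sum (f := fun i => (n i : ℝ) ^ 2)
    (fun _ _ => sq_nonneg _) (Finset.mem_univ i))

/-- `f` is the family of Fourier coefficients of a real-valued distribution in `H^s`: it has the
symmetry `f(-n) = conj f(n)`, and `∑ ⟨n⟩^{2s} |f(n)|² < ∞`. -/
def InSobolev (s : ℝ) (f : Freq → ℂ) : Prop :=
  (∀ n, f (-n) = starRingEnd ℂ (f n)) ∧ Summable fun n => bracket n ^ (2 * s) * ‖f n‖ ^ 2

lemma bracket_rpow_two_mul (s : ℝ) (n : Freq) :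
    bracket n ^ (2 * s) = (bracket n ^ s) ^ 2 := by
  rw [mul_comm, Real.rpow_mul (bracket_pos n).le]; norm_num

/-- A Fourier multiplier with a real, even symbol of size `O(⟨n⟩^{a-b})` maps `H^a` to `H^b`. -/
lemma InSobolev.mul {a b C : ℝ} {f : Freq → ℂ} (hf : InSobolev a f) (m : Freq → ℝ)
    (hm : ∀ n, m (-n) = m n) (hC : ∀ n, |m n| ≤ C * bracket n ^ (a - b)) :
    InSobolev b fun n => (m n : ℂ) * f n := by
  refine ⟨fun n => by simp [hm, hf.1 n], ?_⟩
  refine Summable.of_nonneg_of_le (fun n => ?_) (fun n => ?_) (hf.2.mul_left (C ^ 2))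
  · have := Real.rpow_nonneg (bracket_pos n).le (2 * b); positivity
  · have h0 := Real.rpow_pos_of_pos (bracket_pos n) b
    have h1 : |m n| ^ 2 ≤ (C * bracket n ^ (a - b)) ^ 2 :=
      pow_le_pow_left₀ (abs_nonneg _) (hC n) 2
    have h2 : bracket n ^ b * bracket n ^ (a - b) = bracket n ^ a := by
      rw [← Real.rpow_add (bracket_pos n)]; congr 1; ring
    rw [bracket_rpow_two_mul, bracket_rpow_two_mul, norm_mul, Complex.norm_real, Real.norm_eq_abs,
      ← h2]
    calc (bracket n ^ b) ^ 2 * (|m n| * ‖f n‖) ^ 2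
        = (bracket n ^ b) ^ 2 * ‖f n‖ ^ 2 * |m n| ^ 2 := by ring
      _ ≤ (bracket n ^ b) ^ 2 * ‖f n‖ ^ 2 * (C * bracket n ^ (a - b)) ^ 2 := by gcongr
      _ = _ := by ring

lemma InSobolev.zero (s : ℝ) : InSobolev s 0 := by simp [InSobolev, summable_zero]

lemma InSobolev.add {s : ℝ} {f g : Freq → ℂ} (hf : InSobolev s f) (hg : InSobolev s g) :
    InSobolev s (f + g) := by
  refine ⟨fun n => by simp [hf.1 n, hg.1 n], ?_⟩
  refine Summable.of_nonneg_of_le (fun n => ?_) (fun n => ?_) ((hf.2.add hg.2).mul_left 2)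
  · have := Real.rpow_nonneg (bracket_pos n).le (2 * s); positivity
  · have h0 := Real.rpow_nonneg (bracket_pos n).le (2 * s)
    have h1 : ‖(f + g) n‖ ^ 2 ≤ 2 * (‖f n‖ ^ 2 + ‖g n‖ ^ 2) := by
      have := pow_le_pow_left₀ (norm_nonneg _) (norm_add_le (f n) (g n)) 2
      simp only [Pi.add_apply]
      nlinarith [sq_nonneg (‖f n‖ - ‖g n‖)]
    nlinarith [mul_le_mul_of_nonneg_left h1 h0]

/-- The Fourier coefficients of the elements of `H^s`, as a real vector space. -/
def sobolevSubmodule (s : ℝ) : Submodule ℝ (Freq → ℂ) where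
  carrier := {f | InSobolev s f}
  add_mem' := InSobolev.add
  zero_mem' := InSobolev.zero s
  smul_mem' c f hf := by
    have h := hf.mul (b := s) (C := |c|) (fun _ => c) (fun _ => rfl) (fun n => by simp)
    have e : (c • f) = fun n => ((c : ℝ) : ℂ) * f n := by ext n; simp
    exact e ▸ h

/-- The Sobolev space `H^s(𝕋³)` of real-valued distributions on `𝕋³`, each one identified with its
Fourier coefficients. In particular `H^0 = L²`. -/
def Hs (s : ℝ) : Type := sobolevSubmodule s

instance (s : ℝ) : AddCommGroup (Hs s) := inferInstanceAs (AddCommGroup (sobolevSubmodule s))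

instance (s : ℝ) : Module ℝ (Hs s) := inferInstanceAs (Module ℝ (sobolevSubmodule s))

/-- The `n`-th Fourier coefficient `f̂(n)`, so that `f(x) = ∑ f̂(n) e^{i n·x}`. -/
def Hs.coeff {s : ℝ} (f : Hs s) : Freq → ℂ := f.1

/-- The element of `H^s` with the given Fourier coefficients. -/
def Hs.mk {s : ℝ} (f : Freq → ℂ) (hf : InSobolev s f) : Hs s := ⟨f, hf⟩

lemma Hs.inSobolev {s : ℝ} (f : Hs s) : InSobolev s f.coeff := f.2

@[ext] lemma Hs.ext {s : ℝ} {f g : Hs s} (h : ∀ n, f.coeff n = g.coeff n) : f = g :=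
  Subtype.ext (funext h)

@[simp] lemma Hs.coeff_mk {s : ℝ} (f : Freq → ℂ) (hf : InSobolev s f) :
    (Hs.mk f hf).coeff = f := rfl

@[simp] lemma Hs.coeff_add {s : ℝ} (f g : Hs s) : (f + g).coeff = f.coeff + g.coeff := rfl

@[simp] lemma Hs.coeff_zero {s : ℝ} : (0 : Hs s).coeff = 0 := rfl

@[simp] lemma Hs.coeff_smul {s : ℝ} (c : ℝ) (f : Hs s) : (c • f).coeff = c • f.coeff := rfl

lemma Hs.memℓp {s : ℝ} (f : Hs s) :
    Memℓp (fun n => ((bracket n ^ s : ℝ) : ℂ) * f.coeff n) 2 := by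
  refine memℓp_gen ?_
  refine f.inSobolev.2.congr fun n => ?_
  rw [bracket_rpow_two_mul, norm_mul, Complex.norm_real, Real.norm_eq_abs]
  simp [mul_pow]

/-- The map `f ↦ (⟨n⟩^s f̂(n))_n` from `H^s` to `ℓ²(ℤ³)`, which defines the norm of `H^s`. -/
def Hs.toLp (s : ℝ) : Hs s →ₗ[ℝ] lp (fun _ : Freq => ℂ) 2 where
  toFun f := ⟨fun n => ((bracket n ^ s : ℝ) : ℂ) * f.coeff n, f.memℓp⟩
  map_add' f g := by
    ext n
    simp only [Hs.coeff_add, Pi.add_apply, mul_add, lp.coeFn_add]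
  map_smul' c f := by
    ext n
    simp only [Hs.coeff_smul, Pi.smul_apply, Complex.real_smul, RingHom.id_apply,
      lp.coeFn_smul]
    ring

lemma Hs.toLp_apply {s : ℝ} (f : Hs s) (n : Freq) :
    Hs.toLp s f n = ((bracket n ^ s : ℝ) : ℂ) * f.coeff n := rfl

lemma Hs.toLp_injective (s : ℝ) : Function.Injective (Hs.toLp s) := by
  intro f g h
  ext n
  have h1 : Hs.toLp s f n = Hs.toLp s g n := by rw [h]
  rw [Hs.toLp_apply, Hs.toLp_apply] at h1
  have h2 : ((bracket n ^ s : ℝ) : ℂ) ≠ 0 :=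
    Complex.ofReal_ne_zero.2 (Real.rpow_pos_of_pos (bracket_pos n) s).ne'
  exact mul_left_cancel₀ h2 h1

instance (s : ℝ) : NormedAddCommGroup (Hs s) :=
  NormedAddCommGroup.induced (Hs s) (lp (fun _ : Freq => ℂ) 2) (Hs.toLp s) (Hs.toLp_injective s)

instance (s : ℝ) : NormedSpace ℝ (Hs s) :=
  NormedSpace.induced ℝ (Hs s) (lp (fun _ : Freq => ℂ) 2) (Hs.toLp s)

/-- `‖f‖_{H^s}² = ∑ ⟨n⟩^{2s} |f̂(n)|²`. -/
lemma Hs.norm_sq {s : ℝ} (f : Hs s) :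
    ‖f‖ ^ 2 = ∑' n, bracket n ^ (2 * s) * ‖f.coeff n‖ ^ 2 := by
  have h : ‖f‖ = ‖Hs.toLp s f‖ := rfl
  have h2 := lp.norm_rpow_eq_tsum (p := 2) (by simp) (Hs.toLp s f)
  rw [h]
  simp only [ENNReal.toReal_ofNat, Real.rpow_ofNat] at h2
  rw [h2]
  refine tsum_congr fun n => ?_
  rw [Hs.toLp_apply, bracket_rpow_two_mul, norm_mul, Complex.norm_real, Real.norm_eq_abs, mul_pow,
    sq_abs]

instance (s : ℝ) : MeasurableSpace (Hs s) := borel (Hs s)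

instance (s : ℝ) : BorelSpace (Hs s) := ⟨rfl⟩

/-- The space `𝓗^s = H^s × H^{s-1}`. As both factors are separable, its product σ-algebra is its
Borel σ-algebra. -/
abbrev PhaseSpace (s : ℝ) : Type := Hs s × Hs (s - 1)

/-- The inclusion `H^a ⊂ H^b` for `b ≤ a`. -/
def Hs.incl {a b : ℝ} (h : b ≤ a) (f : Hs a) : Hs b :=
  Hs.mk f.coeff (by
    have := f.inSobolev.mul (b := b) (C := 1) (fun _ => 1) (fun _ => rfl) (fun n => by
      simpa using Real.one_le_rpow (one_le_bracket n) (by linarith))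
    simpa using this)

/-- The inclusion `H¹ × L² ⊂ H^s × H^{s-1}` for `s ≤ 1`. -/
def inclEnergy {s : ℝ} (hs : s ≤ 1) (w : Hs 1 × Hs 0) : PhaseSpace s :=
  (w.1.incl hs, w.2.incl (by linarith))

/-! ## The free evolution -/

/-- The symbol of `sin(t√-Δ)/√-Δ`: it is `sin(t|n|)/|n|` for `n ≠ 0`, and `t` for `n = 0`. -/
def sinSymbol (t : ℝ) (n : Freq) : ℝ := if n = 0 then t else Real.sin (t * len n) / len n

lemma sinSymbol_neg (t : ℝ) (n : Freq) : sinSymbol t (-n) = sinSymbol t n := by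
  simp [sinSymbol, len_neg]

lemma abs_sinSymbol_le (t : ℝ) (n : Freq) : |sinSymbol t n| ≤ (|t| + 2) * (bracket n)⁻¹ := by
  rw [← div_eq_mul_inv, le_div_iff₀ (bracket_pos n)]
  by_cases h : n = 0
  · subst h
    simp [sinSymbol, bracket, lenSq]
  · have h1 := one_le_len h
    have h2 : bracket n ≤ 2 * len n := by
      refine abs_le_of_sq_le_sq' ?_ (by linarith) |>.2
      have := len_sq n
      rw [bracket_sq]
      nlinarith
    rw [sinSymbol, if_neg h, abs_div, abs_of_nonneg (len_nonneg n), div_mul_eq_mul_div,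
      div_le_iff₀ (by linarith)]
    have h3 := Real.abs_sin_le_one (t * len n)
    have h4 := bracket_pos n
    have h5 := abs_nonneg t
    calc |Real.sin (t * len n)| * bracket n ≤ 1 * (2 * len n) := by gcongr
      _ ≤ (|t| + 2) * len n := by nlinarith

/-- The free evolution `S̄(t) = (S(t), ∂ₜS(t))` on `H^s × H^{s-1}`, with
`S(t)(u₀, u₁) = cos(t√-Δ) u₀ + (sin(t√-Δ)/√-Δ) u₁` and
`∂ₜS(t)(u₀, u₁) = -√-Δ sin(t√-Δ) u₀ + cos(t√-Δ) u₁`. -/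
def freeEvolution {s : ℝ} (t : ℝ) (v : PhaseSpace s) : PhaseSpace s :=
  (Hs.mk (fun n => ((Real.cos (t * len n) : ℝ) : ℂ) * v.1.coeff n) (v.1.inSobolev.mul (C := 1) _
      (fun n => by rw [len_neg]) (fun n => by simpa using Real.abs_cos_le_one _)) +
    Hs.mk (fun n => ((sinSymbol t n : ℝ) : ℂ) * v.2.coeff n) (v.2.inSobolev.mul (C := |t| + 2) _
      (sinSymbol_neg t) (fun n => by
        have h : s - 1 - s = -1 := by ring
        rw [h, Real.rpow_neg_one]
        exact abs_sinSymbol_le t n)),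
   Hs.mk (fun n => ((-(len n * Real.sin (t * len n)) : ℝ) : ℂ) * v.1.coeff n)
      (v.1.inSobolev.mul (C := 1) _ (fun n => by rw [len_neg]) (fun n => by
        have h : s - (s - 1) = 1 := by ring
        rw [h, Real.rpow_one, one_mul, abs_neg, abs_mul, abs_of_nonneg (len_nonneg n)]
        calc len n * |Real.sin (t * len n)| ≤ bracket n * 1 := by
              gcongr
              · exact (bracket_pos n).le
              · exact len_le_bracket n
              · exact Real.abs_sin_le_one _
          _ = bracket n := mul_one _)) +
    Hs.mk (fun n => ((Real.cos (t * len n) : ℝ) : ℂ) * v.2.coeff n) (v.2.inSobolev.mul (C := 1) _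
      (fun n => by rw [len_neg]) (fun n => by simpa using Real.abs_cos_le_one _)))

/-! ## Solutions of the cubic wave equation -/

/-- The fundamental cube `[0, 2π)³` of the torus. -/
def cube : Set (Fin 3 → ℝ) := Set.univ.pi fun _ => Set.Ico 0 (2 * Real.pi)

/-- The integrable function `g` on the torus has the Fourier coefficients `f`, that is
`(2π)⁻³ ∫ g(x) e^{-i n·x} dx = f(n)` for all `n`. -/
def HasFourierCoeffs (g : (Fin 3 → ℝ) → ℝ) (f : Freq → ℂ) : Prop :=
  IntegrableOn g cube ∧
    ∀ n : Freq, ((2 * Real.pi : ℂ) ^ 3)⁻¹ *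
      ∫ x in cube, (g x : ℂ) * Complex.exp (-Complex.I * ∑ i, (n i : ℂ) * (x i : ℂ)) = f n

open scoped ContDiff in
/-- Test functions on `ℝ × 𝕋³`: smooth functions of `(t, x)` that are `2π`-periodic in each
coordinate of `x` and have compact support in `t`. -/
structure IsTestFunction (φ : ℝ × (Fin 3 → ℝ) → ℝ) : Prop where
  smooth : ContDiff ℝ ∞ φ
  periodic : ∀ (t : ℝ) (x : Fin 3 → ℝ) (n : Freq),
    φ (t, fun i => x i + 2 * Real.pi * n i) = φ (t, x)
  compactSupport : ∃ T : ℝ, ∀ (t : ℝ) (x : Fin 3 → ℝ), T < |t| → φ (t, x) = 0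

/-- `(∂ₜ² - Δ)φ`. -/
def waveOp (φ : ℝ × (Fin 3 → ℝ) → ℝ) (p : ℝ × (Fin 3 → ℝ)) : ℝ :=
  iteratedDeriv 2 (fun τ => φ (τ, p.2)) p.1 -
    ∑ i, iteratedDeriv 2 (fun r => φ (p.1, Function.update p.2 i r)) (p.2 i)

/-- `v` solves `(∂ₜ² - Δ)v + v³ = 0` on `ℝ × 𝕋³` in the sense of distributions: `v` is given by a
function `V ∈ L³_loc(ℝ × 𝕋³)`, so that `V³` is a distribution, and the equation holds against all
test functions. (`V` is determined by `v` up to a null set.) -/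
def SolvesCubicWave {s : ℝ} (v : ℝ → Hs s) : Prop :=
  ∃ V : ℝ × (Fin 3 → ℝ) → ℝ,
    (∀ T : ℝ, MemLp V 3 (volume.restrict (Set.Icc (-T) T ×ˢ cube))) ∧
    (∀ᵐ t : ℝ, HasFourierCoeffs (fun x => V (t, x)) (v t).coeff) ∧
    ∀ φ : ℝ × (Fin 3 → ℝ) → ℝ, IsTestFunction φ →
      ∫ p in Set.univ ×ˢ cube, (V p * waveOp φ p + V p ^ 3 * φ p) = 0

/-- `z(t) = (v(t), ∂ₜv(t))`, where `v` is a global solution of the cubic wave equation with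
`(v(0), ∂ₜv(0)) = (v₀, v₁)` and
`(v, ∂ₜv) ∈ (S(t)(v₀, v₁), ∂ₜS(t)(v₀, v₁)) + C(ℝ; H¹ × L²)`. The time derivative is taken in
`H^{s-1}`. -/
structure IsGlobalSolution {s : ℝ} (hs : s ≤ 1) (v₀ : PhaseSpace s) (z : ℝ → PhaseSpace s) :
    Prop where
  initial : z 0 = v₀
  deriv : ∀ t, HasDerivAt (fun τ => ((z τ).1.incl (by linarith) : Hs (s - 1))) (z t).2 t
  equation : SolvesCubicWave fun t => (z t).1
  remainder : ∃ w : ℝ → Hs 1 × Hs 0, Continuous w ∧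
    ∀ t, z t = freeEvolution t v₀ + inclEnergy hs (w t)

/-! ## Randomised data -/

/-- The modes `1`, `cos(n·x)`, `sin(n·x)`, `n ∈ ℤ³ \ {0}`, of a real Fourier series. -/
inductive Mode : Type
  | const : Mode
  | cos (n : Freq) (hn : n ≠ 0) : Mode
  | sin (n : Freq) (hn : n ≠ 0) : Mode

/-- The frequency of a mode. -/
def Mode.freq : Mode → Freq
  | .const => 0
  | .cos n _ => n
  | .sin n _ => n

/-- The Fourier coefficients (with respect to the `e^{i n·x}`) of the real Fourier series
`a + ∑_{n ≠ 0} (bₙ cos(n·x) + cₙ sin(n·x))`, where `d` is the family of the `a`, `bₙ`, `cₙ`.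
The sum runs over all `n ≠ 0`, hence `n` and `-n` both contribute to the coefficient at `n`. -/
def trigCoeff (d : Mode → ℝ) (n : Freq) : ℂ :=
  if hn : n = 0 then (d .const : ℂ) else
    ((d (.cos n hn) + d (.cos (-n) (neg_ne_zero.2 hn)) : ℝ) : ℂ) / 2 +
      ((d (.sin n hn) - d (.sin (-n) (neg_ne_zero.2 hn)) : ℝ) : ℂ) / (2 * Complex.I)

/-- `∑ ⟨n⟩^{2s} (bₙ² + cₙ²) < ∞`. -/
def WeightedSummable (s : ℝ) (d : Mode → ℝ) : Prop :=
  Summable fun k : Mode => bracket k.freq ^ (2 * s) * d k ^ 2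

/-- `f = a + ∑_{n ≠ 0} (bₙ cos(n·x) + cₙ sin(n·x))` in `H^s`, with coefficients `d` that satisfy
`∑ ⟨n⟩^{2s} (bₙ² + cₙ²) < ∞`. (As the functions `cos(n·x)`, `sin(n·x)` for `n` and `-n` coincide up
to a sign, the coefficients are not unique; all choices are allowed.) -/
def IsRealFourierSeries {s : ℝ} (f : Hs s) (d : Mode → ℝ) : Prop :=
  WeightedSummable s d ∧ ∀ n, f.coeff n = trigCoeff d n

/-- `θ` satisfies `∫ e^{γx} dθ(x) ≤ e^{cγ²}` for some `c > 0` and all real `γ`. -/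
def IsSubgaussian (θ : Measure ℝ) : Prop :=
  ∃ c > 0, ∀ γ : ℝ, Integrable (fun x => Real.exp (γ * x)) θ ∧
    ∫ x, Real.exp (γ * x) ∂θ ≤ Real.exp (c * γ ^ 2)

/-- The random variables `X (j, k)`, for `j = 0, 1` and all modes `k`, are independent with the
same subgaussian law. -/
structure IsRandomisation {Ω : Type u} [MeasurableSpace Ω] (P : Measure Ω)
    (X : Fin 2 × Mode → Ω → ℝ) : Prop where
  measurable : ∀ k, Measurable (X k)
  indep : iIndepFun X P
  law : ∃ θ : Measure ℝ, IsSubgaussian θ ∧ ∀ k, P.map (X k) = θ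

open Classical in
/-- The element of `H^s` with the given real Fourier series; `0` if there is no such element. -/
def ofTrig (s : ℝ) (d : Mode → ℝ) : Hs s :=
  if h : InSobolev s (trigCoeff d) then Hs.mk (trigCoeff d) h else 0

/-- The randomised datum `(u₀^ω, u₁^ω)`: the coefficients `d₀`, `d₁` of the real Fourier series of
`u₀`, `u₁` are multiplied by the random variables. -/
def randomData (s : ℝ) {Ω : Type u} (d₀ d₁ : Mode → ℝ) (X : Fin 2 × Mode → Ω → ℝ) (ω : Ω) :
    PhaseSpace s :=
  (ofTrig s fun k => X (0, k) ω * d₀ k, ofTrig (s - 1) fun k => X (1, k) ω * d₁ k)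

instance : Countable Mode := by
  refine Function.Injective.countable
    (f := fun k : Mode => (k.freq, match k with | .const => 0 | .cos _ _ => 1 | .sin _ _ => (2 : ℕ)))
    ?_
  rintro (_ | ⟨n, hn⟩ | ⟨n, hn⟩) (_ | ⟨m, hm⟩ | ⟨m, hm⟩) h <;> simp_all [Mode.freq]

/-- A real Fourier series with `∑ ⟨n⟩^{2s} (bₙ² + cₙ²) < ∞` defines an element of `H^s`. -/
lemma WeightedSummable.inSobolev {s : ℝ} {d : Mode → ℝ} (hd : WeightedSummable s d) :
    InSobolev s (trigCoeff d) := by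
  constructor
  · intro n
    by_cases hn : n = 0
    · subst hn; simp [trigCoeff]
    · have hn' : -n ≠ 0 := neg_ne_zero.2 hn
      simp only [trigCoeff, hn, hn', dite_false, neg_neg, map_add, map_div₀, Complex.conj_ofReal,
        map_mul, Complex.conj_I, map_ofNat]
      push_cast
      have : (Complex.I : ℂ) ≠ 0 := Complex.I_ne_zero
      field_simp
      ring
  · let ι : Freq → Mode := fun n => if h : n = 0 then .const else .cos n h
    let κ : Freq → Mode := fun n => if h : n = 0 then .const else .sin n h
    have hι : Function.Injective ι := by
      intro n m h
      by_cases h1 : n = 0 <;> by_cases h2 : m = 0 <;> simp_all [ι]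
    have hκ : Function.Injective κ := by
      intro n m h
      by_cases h1 : n = 0 <;> by_cases h2 : m = 0 <;> simp_all [κ]
    have a1 := hd.comp_injective hι
    have a2 := hd.comp_injective (hι.comp neg_injective)
    have a3 := hd.comp_injective hκ
    have a4 := hd.comp_injective (hκ.comp neg_injective)
    refine Summable.of_nonneg_of_le (fun n => ?_) (fun n => ?_) ((a1.add a2).add (a3.add a4))
    · have := Real.rpow_nonneg (bracket_pos n).le (2 * s); positivity
    · have h0 := Real.rpow_nonneg (bracket_pos n).le (2 * s)
      by_cases hn : n = 0
      · subst hn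
        simp only [Function.comp_apply, ι, κ, trigCoeff, dite_true, neg_zero, Mode.freq,
          Complex.norm_real, Real.norm_eq_abs, sq_abs]
        have := mul_nonneg h0 (sq_nonneg (d .const))
        linarith
      · have hn' : -n ≠ 0 := neg_ne_zero.2 hn
        simp only [Function.comp_apply, ι, κ, trigCoeff, hn, hn', dite_false, Mode.freq,
          bracket_neg]
        rw [← mul_add, ← mul_add, ← mul_add]
        refine mul_le_mul_of_nonneg_left ?_ h0
        generalize d (.cos n hn) = b
        generalize d (.cos (-n) hn') = b'
        generalize d (.sin n hn) = c
        generalize d (.sin (-n) hn') = c'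
        have e : ((b + b' : ℝ) : ℂ) / 2 + ((c - c' : ℝ) : ℂ) / (2 * Complex.I) =
            ⟨(b + b') / 2, -(c - c') / 2⟩ := by
          have : ((c - c' : ℝ) : ℂ) / (2 * Complex.I) = -((c - c' : ℝ) : ℂ) / 2 * Complex.I := by
            field_simp
            simp
          rw [this]
          apply Complex.ext <;> simp
        rw [e, Complex.sq_norm, Complex.normSq_mk]
        nlinarith [sq_nonneg (b - b'), sq_nonneg (c + c'), sq_nonneg b, sq_nonneg b',
          sq_nonneg c, sq_nonneg c']

lemma IsSubgaussian.lintegral_sq_lt_top {θ : Measure ℝ} (hθ : IsSubgaussian θ) :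
    ∫⁻ x, ENNReal.ofReal (x ^ 2) ∂θ < ⊤ := by
  obtain ⟨c, -, hc⟩ := hθ
  have h : Integrable (fun x : ℝ => 2 * (Real.exp (1 * x) + Real.exp (-1 * x))) θ :=
    ((hc 1).1.add (hc (-1)).1).const_mul 2
  refine lt_of_le_of_lt (lintegral_mono fun x => ?_) h.lintegral_lt_top
  refine ENNReal.ofReal_le_ofReal ?_
  have h1 := Real.quadratic_le_exp_of_nonneg (abs_nonneg x)
  have h2 : Real.exp |x| ≤ Real.exp (1 * x) + Real.exp (-1 * x) := by
    rcases abs_cases x with ⟨h, -⟩ | ⟨h, -⟩ <;> rw [h]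
    · simp [Real.exp_nonneg]
    · simp [Real.exp_nonneg]
  nlinarith [sq_abs x, abs_nonneg x]

/-- Almost surely, the randomised coefficients satisfy `∑ ⟨n⟩^{2s} (bₙ² + cₙ²) < ∞` again. -/
lemma IsRandomisation.ae_weightedSummable {Ω : Type u} [MeasurableSpace Ω] {P : Measure Ω}
    {X : Fin 2 × Mode → Ω → ℝ} (hX : IsRandomisation P X) (j : Fin 2) {s : ℝ} {d : Mode → ℝ}
    (hd : WeightedSummable s d) :
    ∀ᵐ ω ∂P, WeightedSummable s fun k => X (j, k) ω * d k := by
  obtain ⟨θ, hθ, hlaw⟩ := hX.law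
  have hw : ∀ k : Mode, 0 ≤ bracket k.freq ^ (2 * s) * d k ^ 2 := fun k => by
    have := Real.rpow_nonneg (bracket_pos k.freq).le (2 * s); positivity
  have hmeas : ∀ k, Measurable fun ω =>
      ENNReal.ofReal (bracket k.freq ^ (2 * s) * d k ^ 2) * ENNReal.ofReal (X (j, k) ω ^ 2) :=
    fun k => ((hX.measurable (j, k)).pow_const 2).ennreal_ofReal.const_mul _
  have hint : ∫⁻ ω, ∑' k : Mode, ENNReal.ofReal (bracket k.freq ^ (2 * s) * d k ^ 2) *
      ENNReal.ofReal (X (j, k) ω ^ 2) ∂P ≠ ⊤ := by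
    rw [lintegral_tsum fun k => (hmeas k).aemeasurable]
    have hk : ∀ k, ∫⁻ ω, ENNReal.ofReal (bracket k.freq ^ (2 * s) * d k ^ 2) *
        ENNReal.ofReal (X (j, k) ω ^ 2) ∂P =
        ENNReal.ofReal (bracket k.freq ^ (2 * s) * d k ^ 2) *
          ∫⁻ x, ENNReal.ofReal (x ^ 2) ∂θ := fun k => by
      rw [lintegral_const_mul _ ((hX.measurable (j, k)).pow_const 2).ennreal_ofReal,
        ← hlaw (j, k), lintegral_map (by fun_prop)
          (hX.measurable (j, k))]
    simp_rw [hk]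
    rw [ENNReal.tsum_mul_right]
    exact ENNReal.mul_ne_top hd.tsum_ofReal_ne_top hθ.lintegral_sq_lt_top.ne
  filter_upwards [ae_lt_top' (AEMeasurable.tsum fun k => (hmeas k).aemeasurable) hint]
    with ω hω
  have h1 := ENNReal.summable_toReal hω.ne
  refine h1.congr fun k => ?_
  rw [← ENNReal.ofReal_mul (hw k), ENNReal.toReal_ofReal (mul_nonneg (hw k) (sq_nonneg _))]
  ring

lemma aemeasurable_ofTrig {Ω : Type u} [MeasurableSpace Ω] {P : Measure Ω} {s : ℝ}
    {D : Ω → Mode → ℝ} (hD : ∀ k, Measurable fun ω => D ω k)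
    (hs : ∀ᵐ ω ∂P, WeightedSummable s (D ω)) : AEMeasurable (fun ω => ofTrig s (D ω)) P := by
  have hcoeff : ∀ n, AEMeasurable (fun ω => Hs.toLp s (ofTrig s (D ω)) n) P := fun n => by
    have h : Measurable fun ω => ((bracket n ^ s : ℝ) : ℂ) * trigCoeff (D ω) n := by
      refine Measurable.const_mul ?_ _
      unfold trigCoeff
      by_cases hn : n = 0
      · simp only [hn, dite_true]
        exact Complex.measurable_ofReal.comp (hD _)
      · simp only [hn, dite_false]
        exact ((Complex.measurable_ofReal.comp ((hD _).add (hD _))).div_const _).add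
          ((Complex.measurable_ofReal.comp ((hD _).sub (hD _))).div_const _)
    refine ⟨_, h, ?_⟩
    filter_upwards [hs] with ω hω
    rw [Hs.toLp_apply, ofTrig, dif_pos hω.inSobolev, Hs.coeff_mk]
  let G : Finset Freq → (Freq → ℂ) → lp (fun _ : Freq => ℂ) 2 :=
    fun F c => ∑ n ∈ F, lp.single 2 n (c n)
  have hG : ∀ F, Continuous (G F) := fun F => continuous_finsetSum _ fun n _ =>
    (lp.isometry_single (E := fun _ : Freq => ℂ) (p := 2) n).continuous.comp (continuous_apply n)
  let _ : MeasurableSpace (lp (fun _ : Freq => ℂ) 2) := borel _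
  have : BorelSpace (lp (fun _ : Freq => ℂ) 2) := ⟨rfl⟩
  have hLp : AEMeasurable (fun ω => Hs.toLp s (ofTrig s (D ω))) P := by
    refine aemeasurable_of_tendsto_metrizable_ae (Filter.atTop : Filter (Finset Freq))
      (f := fun F ω => G F fun n => Hs.toLp s (ofTrig s (D ω)) n)
      (fun F => (hG F).measurable.comp_aemeasurable (aemeasurable_pi_lambda _ hcoeff)) ?_
    exact Filter.Eventually.of_forall fun ω => lp.hasSum_single (by simp) _
  obtain ⟨A, hA, hAe⟩ := hLp
  classical
  set B := toMeasurable P {ω | ¬ Hs.toLp s (ofTrig s (D ω)) = A ω} with hB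
  have hBm : MeasurableSet B := measurableSet_toMeasurable _ _
  have hB0 : P B = 0 := by rw [hB, measure_toMeasurable]; exact hAe
  have hBA : ∀ ω ∉ B, Hs.toLp s (ofTrig s (D ω)) = A ω := fun ω hω => by
    by_contra h
    exact hω (subset_toMeasurable _ _ h)
  refine ⟨fun ω => if ω ∈ B then 0 else ofTrig s (D ω), ?_, ?_⟩
  · have hcomap : borel (Hs s) =
        MeasurableSpace.comap (Hs.toLp s) (borel (lp (fun _ : Freq => ℂ) 2)) := borel_comap
    change @Measurable _ _ _ (borel (Hs s)) _
    rw [hcomap]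
    refine measurable_comap_iff.2 ?_
    have : (Hs.toLp s ∘ fun ω => if ω ∈ B then 0 else ofTrig s (D ω)) =
        fun ω => if ω ∈ B then 0 else A ω := by
      ext1 ω
      by_cases h : ω ∈ B
      · simp [h]
      · simp [h, hBA ω h]
    rw [this]
    exact Measurable.ite hBm measurable_const hA
  · filter_upwards [measure_eq_zero_iff_ae_notMem.1 hB0] with ω hω
    simp [hω]

/-- The map `ω ↦ (u₀^ω, u₁^ω)` is almost everywhere measurable, and almost surely it is given by
the randomised Fourier series. -/
lemma randomData_spec {Ω : Type u} [MeasurableSpace Ω] {P : Measure Ω}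
    {X : Fin 2 × Mode → Ω → ℝ} (hX : IsRandomisation P X) {s : ℝ} {d₀ d₁ : Mode → ℝ}
    (h₀ : WeightedSummable s d₀) (h₁ : WeightedSummable (s - 1) d₁) :
    AEMeasurable (randomData s d₀ d₁ X) P ∧
      ∀ᵐ ω ∂P, ∀ n,
        (randomData s d₀ d₁ X ω).1.coeff n = trigCoeff (fun k => X (0, k) ω * d₀ k) n ∧
        (randomData s d₀ d₁ X ω).2.coeff n = trigCoeff (fun k => X (1, k) ω * d₁ k) n := by
  have a0 := hX.ae_weightedSummable 0 h₀
  have a1 := hX.ae_weightedSummable 1 h₁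
  refine ⟨(aemeasurable_ofTrig (fun k => (hX.measurable _).mul_const _) a0).prodMk
    (aemeasurable_ofTrig (fun k => (hX.measurable _).mul_const _) a1), ?_⟩
  filter_upwards [a0, a1] with ω b0 b1 n
  simp [randomData, ofTrig, b0.inSobolev, b1.inSobolev]

/-- The set `𝓜^s` of the laws of the randomised data `(u₀^ω, u₁^ω)`, for `(u₀, u₁) ∈ 𝓗^s`. -/
def randomisedMeasures (s : ℝ) : Set (Measure (PhaseSpace s)) :=
  {μ | ∃ (u : PhaseSpace s) (d₀ d₁ : Mode → ℝ),
    IsRealFourierSeries u.1 d₀ ∧ IsRealFourierSeries u.2 d₁ ∧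
    ∃ (Ω : Type u) (_ : MeasurableSpace Ω) (P : Measure Ω) (X : Fin 2 × Mode → Ω → ℝ),
      IsProbabilityMeasure P ∧ IsRandomisation P X ∧ μ = P.map (randomData s d₀ d₁ X)}

end CubicWave

end

open CubicWave

noncomputable section

namespace CubicWave

/-! ## Fourier series on the torus -/

section Fourier

/-! The solution is sought as `v = f + w`, where `f` is the free evolution of the random datum and
`w` is a remainder in the energy space `H¹ × L²`. Randomness enters only through `f`: almost surely
`f` is a continuous function of `(t, x)`, although the datum has only regularity `s > 0`. Everything
else is deterministic, for the equation `(∂ₜ² - Δ)w + (f + w)³ = 0` with a fixed continuous `f`.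

Solving for `w`. Put `z = ⟨D⟩w + i∂ₜw`, an arbitrary element of `ℓ²(ℤ³)` on the Fourier side
(`encode`, `decode`). The equation becomes `z' = -i⟨D⟩z + i(w - (f + w)³)`, and `U = e^{it⟨D⟩}z`
removes the unbounded operator. By the embedding `H¹ ⊂ L⁶` (`exists_eLpNorm_trigPoly_le`,
`sobolevL6`) the cube maps `H¹` to `L²`, so `U` solves an ordinary differential equation in `ℓ²`
with a locally Lipschitz field (`isLocallyLipschitzField_interactionField`). Local existence and
uniqueness are those of Picard and Lindelöf. Global existence follows from an a priori bound
(`IsLocallyLipschitzField.exists_global`): the energy `1 + ‖U‖²/2 + ∫w⁴/4` has derivative `⟨∂ₜw, w -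
(f + w)³ + w³⟩`, in which `w³` cancels. With `|f| ≤ M` the worst remaining term is `3fw²`, whose
`L²` norm is bounded by `3M` times the square root of `∫w⁴`. Hence the derivative is at most a
constant times the energy (`abs_deriv_energy_le`), and Grönwall applies.

Distributional and Fourier formulations. Parseval's formula turns the equations for the Fourier
coefficients into the weak formulation (`integral_weakIntegrand_eq_zero`). Conversely, testing with
`ψ(t)` times the real or imaginary part of `e^{-i n·x}` recovers the equations for the coefficients
(`SolvesCubicWave.hasDerivAt_snd`). So every solution in the prescribed class comes from the
ordinary differential equation, and is unique.

The invariant set. `solvableData` consists of all `v + h` with `h` in the energy space and `v` a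
datum whose free evolution is a continuous function. The flow maps `v + h` to the free evolution of
`v` plus an energy-space term, and a translate in time of a continuous free evolution is again one.
Thus the set is invariant; uniqueness makes the flow reversible, so the image is the whole set.

Full measure. Split the free evolution into dyadic blocks `2^k < ⟨n⟩ ≤ 2^{k+1}`. At a fixed point a
block is a sum of independent subgaussian variables with variance proxy `O(2^{-2sk})`, so the
probability that it exceeds `2^{-sk/2}` is at most `2 exp(-a 2^{sk})`. This beats the `O(2^{20k})`
points of a grid of mesh `2^{-5k}`, and Borel–Cantelli controls the block on the grid
(`IsRandomisation.ae_eventually_block_le`). Blocks have Lipschitz constant `O(2^{4k})`, so between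
grid points they change by `O(2^{-k})`. The sum of the blocks converges locally uniformly to a
continuous function (`representsFree_freeLimit`). -/

/-- The normalised Lebesgue measure of the fundamental cube. -/
def torusMeasure : Measure (Fin 3 → ℝ) :=
  ENNReal.ofReal ((2 * Real.pi) ^ 3)⁻¹ • volume.restrict cube

/-- The character `x ↦ e^{i n·x}`. -/
def character (n : Freq) (x : Fin 3 → ℝ) : ℂ :=
  Complex.exp (Complex.I * ∑ i, (n i : ℂ) * (x i : ℂ))

lemma integral_torusMeasure {E : Type*} [NormedAddCommGroup E] [NormedSpace ℝ E]
    (g : (Fin 3 → ℝ) → E) :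
    ∫ x, g x ∂torusMeasure = ((2 * Real.pi) ^ 3)⁻¹ • ∫ x in cube, g x := by
  rw [torusMeasure, integral_smul_measure, ENNReal.toReal_ofReal (by positivity)]

lemma ofReal_two_pi_ne_zero : ENNReal.ofReal ((2 * Real.pi) ^ 3)⁻¹ ≠ 0 := by
  have := Real.pi_pos
  simp only [ne_eq, ENNReal.ofReal_eq_zero, not_le]
  positivity

lemma measurableSet_cube : MeasurableSet cube :=
  MeasurableSet.univ_pi fun _ => measurableSet_Ico

lemma ae_torusMeasure_iff {p : (Fin 3 → ℝ) → Prop} :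
    (∀ᵐ x ∂torusMeasure, p x) ↔ ∀ᵐ x ∂volume.restrict cube, p x := by
  rw [torusMeasure, Measure.ae_ennreal_smul_measure_iff ofReal_two_pi_ne_zero]

lemma integrable_torusMeasure_iff {E : Type*} [NormedAddCommGroup E] {g : (Fin 3 → ℝ) → E} :
    Integrable g torusMeasure ↔ IntegrableOn g cube :=
  integrable_smul_measure ofReal_two_pi_ne_zero ENNReal.ofReal_ne_top

lemma volume_cube : volume cube = ENNReal.ofReal ((2 * Real.pi) ^ 3) := by
  rw [cube, volume_pi_pi]
  simp only [Real.volume_Ico, sub_zero, Finset.prod_const, Finset.card_univ, Fintype.card_fin]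
  rw [ENNReal.ofReal_pow (by positivity)]

instance : IsProbabilityMeasure torusMeasure := by
  refine ⟨?_⟩
  rw [torusMeasure, Measure.smul_apply, Measure.restrict_apply_univ, volume_cube, smul_eq_mul,
    ← ENNReal.ofReal_mul (by positivity), inv_mul_cancel₀ (by positivity), ENNReal.ofReal_one]

lemma continuous_character (n : Freq) : Continuous (character n) := by
  unfold character; fun_prop

lemma norm_character (n : Freq) (x : Fin 3 → ℝ) : ‖character n x‖ = 1 := by
  have : Complex.I * ∑ i, (n i : ℂ) * (x i : ℂ) = ((∑ i, (n i : ℝ) * x i : ℝ) : ℂ) * Complex.I := by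
    push_cast; ring
  rw [character, this, Complex.norm_exp_ofReal_mul_I]

lemma conj_character (n : Freq) (x : Fin 3 → ℝ) :
    starRingEnd ℂ (character n x) = Complex.exp (-Complex.I * ∑ i, (n i : ℂ) * (x i : ℂ)) := by
  rw [character, ← Complex.exp_conj]
  simp [map_sum]

lemma character_neg (n : Freq) (x : Fin 3 → ℝ) :
    character (-n) x = starRingEnd ℂ (character n x) := by
  rw [conj_character, character]
  simp

lemma memLp_character (n : Freq) (p : ENNReal) : MemLp (character n) p torusMeasure :=
  (memLp_top_of_bound (continuous_character n).aestronglyMeasurable 1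
    (Filter.Eventually.of_forall fun x => (norm_character n x).le)).mono_exponent le_top

local instance instMeasureSpaceUnitAddCircle : MeasureSpace UnitAddCircle :=
  ⟨AddCircle.haarAddCircle⟩

/-- The point of the fundamental cube above a point of the unit torus. -/
def torusSection (y : UnitAddTorus (Fin 3)) (i : Fin 3) : ℝ :=
  2 * Real.pi * (AddCircle.equivIoc 1 0 (y i)).1

lemma torusSection_eq : torusSection = (fun x => (2 * Real.pi) • x) ∘ Subtype.val ∘
    UnitAddTorus.measurableEquivPiIoc (fun _ : Fin 3 => (0 : ℝ)) := rfl

/-- The dilation divides Lebesgue measure by `(2π)³`, which is the normalisation of `torusMeasure`.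
The endpoints differ, `(0, 2π]` against `[0, 2π)`, but only by a null set. -/
lemma map_smul_restrict :
    (volume.restrict {x : Fin 3 → ℝ | ∀ i, x i ∈ Set.Ioc (0 : ℝ) (0 + 1)}).map
      (fun x => (2 * Real.pi) • x) = torusMeasure := by
  have hpi := Real.pi_pos
  have h2 : (2 * Real.pi) ≠ 0 := by positivity
  have hemb : MeasurableEmbedding (fun x : Fin 3 → ℝ => (2 * Real.pi) • x) :=
    (Homeomorph.smulOfNeZero _ h2).measurableEmbedding
  have hset : {x : Fin 3 → ℝ | ∀ i, x i ∈ Set.Ioc (0 : ℝ) (0 + 1)} =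
      (fun x : Fin 3 → ℝ => (2 * Real.pi) • x) ⁻¹'
        (Set.univ.pi fun _ => Set.Ioc 0 (2 * Real.pi)) := by
    ext x
    simp only [Set.mem_ofPred_eq, Set.mem_Ioc, Set.mem_preimage, Set.mem_pi, Set.mem_univ,
      forall_const, Pi.smul_apply, smul_eq_mul]
    refine forall_congr' fun i => and_congr ?_ ?_
    · constructor
      · intro h; positivity
      · intro h; exact pos_of_mul_pos_right h (by positivity)
    · constructor
      · intro h; nlinarith
      · intro h; nlinarith
  rw [hset, ← hemb.restrict_map, Measure.map_addHaar_smul volume h2, Measure.restrict_smul,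
    torusMeasure]
  congr 1
  · rw [abs_of_nonneg (by positivity)]; simp
  · refine Measure.restrict_congr_set ?_
    exact (Measure.univ_pi_Ioc_ae_eq_Icc (f := fun _ : Fin 3 => (0 : ℝ))
      (g := fun _ => 2 * Real.pi)).trans
      (Measure.univ_pi_Ico_ae_eq_Icc (f := fun _ : Fin 3 => (0 : ℝ))
      (g := fun _ => 2 * Real.pi)).symm

/-- This carries orthonormality and completeness of the characters over from `UnitAddTorus`. -/
lemma measurePreserving_torusSection :
    MeasurePreserving torusSection volume torusMeasure := by
  have h1 := UnitAddTorus.measurePreserving_equivPiIoc (fun _ : Fin 3 => (0 : ℝ))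
  have hm : MeasurableSet {x : Fin 3 → ℝ | ∀ i, x i ∈ Set.Ioc (0 : ℝ) (0 + 1)} :=
    MeasurableSet.univ_pi' fun i => measurableSet_Ioc
  have h2 : MeasurePreserving
      (Subtype.val : {x : Fin 3 → ℝ // ∀ i, x i ∈ Set.Ioc (0 : ℝ) (0 + 1)} → _)
      (Measure.comap Subtype.val volume)
      (volume.restrict {x : Fin 3 → ℝ | ∀ i, x i ∈ Set.Ioc (0 : ℝ) (0 + 1)}) :=
    ⟨measurable_subtype_coe, map_comap_subtype_coe hm volume⟩
  have h3 : MeasurePreserving (fun x : Fin 3 → ℝ => (2 * Real.pi) • x)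
      (volume.restrict {x : Fin 3 → ℝ | ∀ i, x i ∈ Set.Ioc (0 : ℝ) (0 + 1)}) torusMeasure :=
    ⟨by fun_prop, map_smul_restrict⟩
  rw [torusSection_eq]
  exact (h3.comp h2).comp h1

lemma character_torusSection (n : Freq) (y : UnitAddTorus (Fin 3)) :
    character n (torusSection y) = UnitAddTorus.mFourier n y := by
  simp only [character, torusSection, UnitAddTorus.mFourier, ContinuousMap.coe_mk]
  rw [Finset.mul_sum, Complex.exp_sum]
  refine Finset.prod_congr rfl fun i _ => ?_
  have h : y i = (((AddCircle.equivIoc 1 0 (y i)).1 : ℝ) : UnitAddCircle) :=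
    ((AddCircle.equivIoc (1 : ℝ) 0).symm_apply_apply (y i)).symm
  conv_rhs => rw [h, fourier_coe_apply]
  congr 1
  push_cast
  ring

/-- The characters as elements of `L²`. -/
def characterLp (n : Freq) : Lp ℂ 2 torusMeasure := (memLp_character n 2).toLp _

lemma inner_characterLp (n : Freq) (g : Lp ℂ 2 torusMeasure) :
    inner ℂ (characterLp n) g = ∫ x, g x * starRingEnd ℂ (character n x) ∂torusMeasure := by
  rw [L2.inner_def]
  refine integral_congr_ae ?_
  filter_upwards [(memLp_character n 2).coeFn_toLp] with x hx
  rw [characterLp, hx, RCLike.inner_apply]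

lemma orthonormal_characterLp : Orthonormal ℂ characterLp := by
  rw [orthonormal_iff_ite]
  intro m n
  have h := (orthonormal_iff_ite.1 (UnitAddTorus.orthonormal_mFourier (d := Fin 3))) m n
  rw [ContinuousMap.inner_toLp] at h
  rw [inner_characterLp, ← h]
  have h1 : ∫ x, characterLp n x * starRingEnd ℂ (character m x) ∂torusMeasure =
      ∫ x, character n x * starRingEnd ℂ (character m x) ∂torusMeasure := by
    refine integral_congr_ae ?_
    filter_upwards [(memLp_character n 2).coeFn_toLp] with x hx
    rw [characterLp, hx]
  rw [h1, ← measurePreserving_torusSection.map_eq, integral_map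
    measurePreserving_torusSection.measurable.aemeasurable]
  · simp only [character_torusSection]
  · exact ((continuous_character n).mul
      (Complex.continuous_conj.comp (continuous_character m))).aestronglyMeasurable

/-- Completeness: pulled back along `torusSection`, the characters become the Hilbert basis
`mFourierBasis`, and the pullback is isometric, hence injective. -/
lemma eq_zero_of_inner_characterLp (g : Lp ℂ 2 torusMeasure)
    (hg : ∀ n, inner ℂ (characterLp n) g = 0) : g = 0 := by
  have hmp := measurePreserving_torusSection
  let G : Lp ℂ 2 (volume : Measure (UnitAddTorus (Fin 3))) := Lp.compMeasurePreserving _ hmp g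
  have hG : ∀ᵐ y, G y = g (torusSection y) := Lp.coeFn_compMeasurePreserving g hmp
  have hG0 : G = 0 := by
    refine UnitAddTorus.mFourierBasis.repr.injective ?_
    ext n
    rw [UnitAddTorus.mFourierBasis_repr, map_zero]
    have := hg n
    have hInt : ∀ h : (Fin 3 → ℝ) → ℂ, AEStronglyMeasurable h torusMeasure →
        ∫ x, h x ∂torusMeasure = ∫ y, h (torusSection y) := fun h hh => by
      conv_lhs => rw [← hmp.map_eq]
      exact integral_map hmp.measurable.aemeasurable (by rwa [hmp.map_eq])
    rw [inner_characterLp, hInt] at this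
    · rw [UnitAddTorus.mFourierCoeff]
      refine Eq.trans (integral_congr_ae ?_) this
      filter_upwards [hG] with y hy
      rw [hy, UnitAddTorus.mFourier_neg, character_torusSection, smul_eq_mul, mul_comm]
    · exact (Lp.aestronglyMeasurable g).mul
        (Complex.continuous_conj.comp (continuous_character n)).aestronglyMeasurable
  have : Isometry (Lp.compMeasurePreserving (E := ℂ) (p := 2) _ hmp) :=
    Lp.isometry_compMeasurePreserving hmp
  exact this.injective (hG0.trans (map_zero _).symm)

/-- The Fourier basis of `L²`. -/
def fourierBasis : HilbertBasis Freq ℂ (Lp ℂ 2 torusMeasure) :=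
  HilbertBasis.mkOfOrthogonalEqBot orthonormal_characterLp <| by
    rw [Submodule.eq_bot_iff]
    intro g hg
    exact eq_zero_of_inner_characterLp g fun n =>
      (Submodule.mem_orthogonal _ _).1 hg _ (Submodule.subset_span ⟨n, rfl⟩)

lemma fourierBasis_apply (n : Freq) : fourierBasis n = characterLp n := by
  simp [fourierBasis]

lemma fourierBasis_repr (g : Lp ℂ 2 torusMeasure) (n : Freq) :
    fourierBasis.repr g n = ∫ x, g x * starRingEnd ℂ (character n x) ∂torusMeasure := by
  rw [HilbertBasis.repr_apply_apply, fourierBasis_apply, inner_characterLp]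

lemma hasFourierCoeffs_iff {g : (Fin 3 → ℝ) → ℝ} {f : Freq → ℂ} :
    HasFourierCoeffs g f ↔ Integrable g torusMeasure ∧
      ∀ n, ∫ x, (g x : ℂ) * starRingEnd ℂ (character n x) ∂torusMeasure = f n := by
  rw [HasFourierCoeffs, integrable_torusMeasure_iff]
  refine and_congr_right fun _ => forall_congr' fun n => ?_
  rw [integral_torusMeasure]
  simp only [conj_character, Complex.real_smul]
  push_cast
  rfl

end Fourier

/-! ## Square summable sequences of Fourier coefficients -/

section Sequences

open Filter Topology

/-- The Hilbert space `ℓ²(ℤ³)`. -/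
abbrev FreqL2 : Type := lp (fun _ : Freq => ℂ) 2

lemma FreqL2.norm_sq (c : FreqL2) : ‖c‖ ^ 2 = ∑' n, ‖c n‖ ^ 2 := by
  have h := lp.norm_rpow_eq_tsum (p := 2) (by simp) c
  simpa using h

lemma FreqL2.summable_sq (c : FreqL2) : Summable fun n => ‖c n‖ ^ 2 := by
  have h := (lp.memℓp c).summable (by simp)
  simpa using h

/-- The element of `ℓ²` with the given coefficients. -/
def FreqL2.of (c : Freq → ℂ) (h : Summable fun n => ‖c n‖ ^ 2) : FreqL2 :=
  ⟨c, memℓp_gen (by simpa using h)⟩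

@[simp] lemma FreqL2.of_apply (c : Freq → ℂ) (h : Summable fun n => ‖c n‖ ^ 2) (n : Freq) :
    FreqL2.of c h n = c n := rfl

lemma FreqL2.norm_le_of_forall_le {c d : FreqL2} {C : ℝ} (hC : 0 ≤ C)
    (h : ∀ n, ‖c n‖ ≤ C * ‖d n‖) : ‖c‖ ≤ C * ‖d‖ := by
  refine abs_le_of_sq_le_sq' ?_ (by positivity) |>.2
  rw [mul_pow, FreqL2.norm_sq, FreqL2.norm_sq, ← tsum_mul_left]
  refine c.summable_sq.tsum_le_tsum (fun n => ?_) (d.summable_sq.mul_left _)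
  rw [← mul_pow]
  exact pow_le_pow_left₀ (norm_nonneg _) (h n) 2

/-- The evaluation of a sequence at `n`. -/
def coordCLM (n : Freq) : FreqL2 →L[ℝ] ℂ :=
  LinearMap.mkContinuous
    { toFun := fun c => c n
      map_add' := fun _ _ => rfl
      map_smul' := fun _ _ => rfl } 1
    fun c => by rw [one_mul]; exact lp.norm_apply_le_norm (p := 2) (by simp) c n

@[simp] lemma coordCLM_apply (n : Freq) (c : FreqL2) : coordCLM n c = c n := rfl

/-- Dominated convergence for the series `∑ ‖y i n‖²`. -/
lemma FreqL2.tendsto_zero_of_dominated {ι : Type*} {l : Filter ι} {y : ι → FreqL2} {b : Freq → ℝ}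
    (hb : Summable fun n => b n ^ 2) (hy : ∀ n, Tendsto (fun i => y i n) l (𝓝 0))
    (hle : ∀ᶠ i in l, ∀ n, ‖y i n‖ ≤ b n) : Tendsto y l (𝓝 0) := by
  have h1 : Tendsto (fun i => ∑' n, ‖y i n‖ ^ 2) l (𝓝 (∑' _ : Freq, (0 : ℝ))) := by
    refine tendsto_tsum_of_dominated_convergence hb (fun n => ?_) ?_
    · simpa using ((hy n).norm.pow 2)
    · filter_upwards [hle] with i hi n
      rw [Real.norm_of_nonneg (by positivity)]
      exact pow_le_pow_left₀ (norm_nonneg _) (hi n) 2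
  rw [tsum_zero] at h1
  rw [tendsto_zero_iff_norm_tendsto_zero]
  have h2 : Tendsto (fun i => Real.sqrt (‖y i‖ ^ 2)) l (𝓝 (Real.sqrt 0)) := by
    refine (Real.continuous_sqrt.tendsto 0).comp ?_
    simpa only [FreqL2.norm_sq] using h1
  simpa using h2

/-- The Fourier multiplier with a bounded symbol. -/
def multiplier (m : Freq → ℂ) (C : ℝ) (hm : ∀ n, ‖m n‖ ≤ C) : FreqL2 →L[ℂ] FreqL2 :=
  have hC : 0 ≤ C := (norm_nonneg _).trans (hm 0)
  have hle : ∀ c : FreqL2, ∀ n, ‖m n * c n‖ ≤ C * ‖c n‖ := fun c n => by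
    rw [norm_mul]; gcongr; exact hm n
  LinearMap.mkContinuous
    { toFun := fun c => FreqL2.of (fun n => m n * c n)
        (Summable.of_nonneg_of_le (fun _ => by positivity)
          (fun n => by rw [← mul_pow]; exact pow_le_pow_left₀ (norm_nonneg _) (hle c n) 2)
          (c.summable_sq.mul_left (C ^ 2)))
      map_add' := fun c d => by ext n; simp [mul_add]
      map_smul' := fun a c => by ext n; simp; ring } C
    fun c => FreqL2.norm_le_of_forall_le hC (hle c)

@[simp] lemma multiplier_apply (m : Freq → ℂ) (C : ℝ) (hm : ∀ n, ‖m n‖ ≤ C) (c : FreqL2)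
    (n : Freq) : multiplier m C hm c n = m n * c n := rfl

/-- Bounded symbols that tend to zero pointwise give strong convergence of the multipliers;
convergence in operator norm may fail. -/
lemma FreqL2.tendsto_zero_of_symbol {ι : Type*} {l : Filter ι} {m : ι → Freq → ℂ} {c : FreqL2}
    {r : ι → FreqL2} {C : ℝ} (hm : ∀ n, Tendsto (fun i => m i n) l (𝓝 0))
    (hC : ∀ᶠ i in l, ∀ n, ‖m i n‖ ≤ C) (hr : ∀ᶠ i in l, ∀ n, r i n = m i n * c n) :
    Tendsto r l (𝓝 0) := by
  refine FreqL2.tendsto_zero_of_dominated (b := fun n => C * ‖c n‖) ?_ (fun n => ?_) ?_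
  · simpa only [mul_pow] using c.summable_sq.mul_left (C ^ 2)
  · have h1 := (hm n).mul_const (c n)
    rw [zero_mul] at h1
    refine h1.congr' ?_
    filter_upwards [hr] with i hi
    rw [hi]
  · filter_upwards [hr, hC] with i hi hi' n
    rw [hi, norm_mul]
    exact mul_le_mul_of_nonneg_right (hi' n) (norm_nonneg _)

open Classical in
/-- A Fourier multiplier with a symbol that is continuous in time and locally bounded maps
continuous curves to continuous curves. -/
lemma FreqL2.continuous_of_multiplier {m : ℝ → Freq → ℂ} {c y : ℝ → FreqL2}
    (hm : ∀ n, Continuous fun t => m t n)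
    (hC : ∀ T : ℝ, ∃ C : ℝ, ∀ t, |t| ≤ T → ∀ n, ‖m t n‖ ≤ C)
    (hc : Continuous c) (hy : ∀ t n, y t n = m t n * c t n) : Continuous y := by
  rw [continuous_iff_continuousAt]
  intro t₀
  obtain ⟨C, hC⟩ := hC (|t₀| + 1)
  have hC0 : 0 ≤ C := (norm_nonneg _).trans (hC t₀ (by linarith) 0)
  have hev : ∀ᶠ t in 𝓝 t₀, |t| ≤ |t₀| + 1 := by
    filter_upwards [Metric.ball_mem_nhds t₀ one_pos] with t ht
    rw [Metric.mem_ball, Real.dist_eq] at ht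
    have := abs_sub_abs_le_abs_sub t t₀
    linarith
  have hdiff : ∀ᶠ t in 𝓝 t₀, ∀ n, ‖m t n - m t₀ n‖ ≤ 2 * C := by
    filter_upwards [hev] with t ht n
    exact (norm_sub_le _ _).trans (by linarith [hC t ht n, hC t₀ (by linarith) n])
  -- The increment `y t - y t₀` is `m t (c t - c t₀)` plus `r t`. The first term is small by the
  -- bound on the symbol, the second because `c t₀` is fixed. The value `0` of `r` away from `t₀` is
  -- irrelevant.
  obtain ⟨r, hr⟩ : ∃ r : ℝ → FreqL2, ∀ᶠ t in 𝓝 t₀, ∀ n, r t n = (m t n - m t₀ n) * c t₀ n := by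
    refine ⟨fun t => if h : ∀ n, ‖m t n - m t₀ n‖ ≤ 2 * C then
      multiplier (fun n => m t n - m t₀ n) (2 * C) h (c t₀) else 0, ?_⟩
    filter_upwards [hdiff] with t ht n
    rw [dif_pos ht, multiplier_apply]
  have hr0 : Tendsto r (𝓝 t₀) (𝓝 0) := by
    refine FreqL2.tendsto_zero_of_symbol (m := fun t n => m t n - m t₀ n) (fun n => ?_) hdiff hr
    simpa using ((hm n).tendsto t₀).sub_const (m t₀ n)
  have hd : Tendsto (fun t => C * ‖c t - c t₀‖ + ‖r t‖) (𝓝 t₀) (𝓝 0) := by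
    have h1 := ((hc.tendsto t₀).sub_const (c t₀)).norm.const_mul C
    have h2 := h1.add hr0.norm
    simpa using h2
  rw [ContinuousAt, tendsto_iff_norm_sub_tendsto_zero]
  refine squeeze_zero' (Eventually.of_forall fun _ => norm_nonneg _) ?_ hd
  filter_upwards [hev, hr] with t ht hrt
  have h3 : ‖y t - y t₀ - r t‖ ≤ C * ‖c t - c t₀‖ := by
    refine FreqL2.norm_le_of_forall_le hC0 fun n => ?_
    have : (y t - y t₀ - r t) n = m t n * (c t - c t₀) n := by
      rw [lp.coeFn_sub, lp.coeFn_sub, lp.coeFn_sub, Pi.sub_apply, Pi.sub_apply, Pi.sub_apply,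
        hy, hy, hrt]
      ring
    rw [this, norm_mul]
    exact mul_le_mul_of_nonneg_right (hC t ht n) (norm_nonneg _)
  calc ‖y t - y t₀‖ = ‖(y t - y t₀ - r t) + r t‖ := by congr 1; abel
    _ ≤ _ := (norm_add_le _ _).trans (by linarith)

/-- A curve in `ℓ²` that is differentiable coordinatewise, with a derivative that is continuous in
`ℓ²`, is differentiable in `ℓ²`. -/
lemma FreqL2.hasDerivAt_of_coord {y d : ℝ → FreqL2} (hd : Continuous d)
    (h : ∀ n t, HasDerivAt (fun τ => y τ n) (d t n) t) (t : ℝ) : HasDerivAt y (d t) t := by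
  have hY : ∀ t, HasDerivAt (fun t => y 0 + ∫ τ in (0 : ℝ)..t, d τ) (d t) t := fun t =>
    (intervalIntegral.integral_hasDerivAt_right (hd.intervalIntegrable _ _)
      hd.aestronglyMeasurable.stronglyMeasurableAtFilter hd.continuousAt).const_add _
  -- The integral of `d` is a primitive in `ℓ²`, and it has the same coordinate derivatives and the
  -- same initial value as `y`.
  have e : y = fun t => y 0 + ∫ τ in (0 : ℝ)..t, d τ := by
    funext t
    ext n
    have h1 : ∀ t, HasDerivAt (fun t => (y 0 + ∫ τ in (0 : ℝ)..t, d τ : FreqL2) n) (d t n) t :=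
      fun t => ((coordCLM n).hasFDerivAt.comp_hasDerivAt t (hY t))
    have h2 : ∀ t, HasDerivAt
        (fun t => y t n - (y 0 + ∫ τ in (0 : ℝ)..t, d τ : FreqL2) n) 0 t := fun t => by
      rw [← sub_self (d t n)]
      exact (h n t).sub (h1 t)
    have h3 := is_const_of_deriv_eq_zero (fun t => (h2 t).differentiableAt)
      (fun t => (h2 t).deriv) t 0
    simp only [intervalIntegral.integral_same, add_zero, sub_self] at h3
    exact sub_eq_zero.1 h3
  rw [e]
  exact hY t

/-- The multiplier `⟨n⟩⁻¹`. -/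
def smoothing : FreqL2 →L[ℂ] FreqL2 :=
  multiplier (fun n => ((bracket n)⁻¹ : ℝ)) 1 fun n => by
    rw [Complex.norm_real, Real.norm_of_nonneg (inv_nonneg.2 (bracket_pos n).le)]
    exact inv_le_one_of_one_le₀ (one_le_bracket n)

@[simp] lemma smoothing_apply (c : FreqL2) (n : Freq) :
    smoothing c n = ((bracket n)⁻¹ : ℝ) * c n := rfl

lemma norm_smoothing_le (c : FreqL2) : ‖smoothing c‖ ≤ ‖c‖ := by
  refine (FreqL2.norm_le_of_forall_le (d := c) (C := 1) zero_le_one fun n => ?_).trans (by simp)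
  rw [smoothing_apply, norm_mul]
  gcongr
  rw [Complex.norm_real, Real.norm_of_nonneg (inv_nonneg.2 (bracket_pos n).le)]
  exact inv_le_one_of_one_le₀ (one_le_bracket n)

/-- The unitary group with symbol `e^{-it⟨n⟩}`. -/
def propagator (t : ℝ) : FreqL2 →L[ℂ] FreqL2 :=
  multiplier (fun n => Complex.exp (((-(t * bracket n) : ℝ) : ℂ) * Complex.I)) 1 fun n => by
    rw [Complex.norm_exp_ofReal_mul_I]

@[simp] lemma propagator_apply (t : ℝ) (c : FreqL2) (n : Freq) :
    propagator t c n = Complex.exp (((-(t * bracket n) : ℝ) : ℂ) * Complex.I) * c n := rfl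

lemma norm_propagator (t : ℝ) (c : FreqL2) : ‖propagator t c‖ = ‖c‖ := by
  have h : ‖propagator t c‖ ^ 2 = ‖c‖ ^ 2 := by
    rw [FreqL2.norm_sq, FreqL2.norm_sq]
    refine tsum_congr fun n => ?_
    rw [propagator_apply, norm_mul, Complex.norm_exp_ofReal_mul_I, one_mul]
  exact (sq_eq_sq₀ (norm_nonneg _) (norm_nonneg _)).1 h

lemma propagator_propagator_neg (t : ℝ) (c : FreqL2) : propagator t (propagator (-t) c) = c := by
  ext n
  rw [propagator_apply, propagator_apply, ← mul_assoc, ← Complex.exp_add]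
  simp

lemma propagator_zero (c : FreqL2) : propagator 0 c = c := by ext n; simp

/-- The symbols `e^{-it⟨n⟩}` oscillate without a uniform modulus of continuity, so only strong
continuity is available. -/
lemma continuous_propagator {c : ℝ → FreqL2} (hc : Continuous c) :
    Continuous fun t => propagator t (c t) := by
  refine FreqL2.continuous_of_multiplier (c := c)
    (m := fun t n => Complex.exp (((-(t * bracket n) : ℝ) : ℂ) * Complex.I))
    (fun n => by fun_prop) (fun T => ⟨1, fun t _ n => ?_⟩) hc (fun t n => rfl)
  rw [Complex.norm_exp_ofReal_mul_I]

lemma continuous_propagator_neg {c : ℝ → FreqL2} (hc : Continuous c) :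
    Continuous fun t => propagator (-t) (c t) := by
  have h := (continuous_propagator (hc.comp continuous_neg)).comp continuous_neg
  simpa [Function.comp_def] using h

lemma inner_propagator (t : ℝ) (c d : FreqL2) :
    inner ℂ c (propagator (-t) d) = inner ℂ (propagator t c) d := by
  rw [lp.inner_eq_tsum, lp.inner_eq_tsum]
  refine tsum_congr fun n => ?_
  simp only [propagator_apply, RCLike.inner_apply, map_mul, ← Complex.exp_conj, Complex.conj_ofReal,
    Complex.conj_I]
  push_cast
  ring_nf

end Sequences

/-! ## Real functions and their Fourier coefficients -/

section RealFunctions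

/-- The function with given Fourier coefficients. -/
def synthesis : FreqL2 ≃ₗᵢ[ℂ] Lp ℂ 2 torusMeasure := fourierBasis.repr.symm

lemma synthesis_symm_apply (g : Lp ℂ 2 torusMeasure) (n : Freq) :
    synthesis.symm g n = ∫ x, g x * starRingEnd ℂ (character n x) ∂torusMeasure :=
  fourierBasis_repr g n

/-- The real part of a function in `L²`. -/
def reL2 : Lp ℂ 2 torusMeasure →L[ℝ] Lp ℝ 2 torusMeasure := Complex.reCLM.compLpL 2 torusMeasure

/-- The imaginary part of a function in `L²`. -/
def imL2 : Lp ℂ 2 torusMeasure →L[ℝ] Lp ℝ 2 torusMeasure := Complex.imCLM.compLpL 2 torusMeasure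

/-- The inclusion of the real functions in `L²`. -/
def ofRealL2 : Lp ℝ 2 torusMeasure →L[ℝ] Lp ℂ 2 torusMeasure :=
  Complex.ofRealCLM.compLpL 2 torusMeasure

lemma coeFn_reL2 (g : Lp ℂ 2 torusMeasure) : ∀ᵐ x ∂torusMeasure, reL2 g x = (g x).re :=
  Complex.reCLM.coeFn_compLpL g

lemma coeFn_imL2 (g : Lp ℂ 2 torusMeasure) : ∀ᵐ x ∂torusMeasure, imL2 g x = (g x).im :=
  Complex.imCLM.coeFn_compLpL g

lemma coeFn_ofRealL2 (g : Lp ℝ 2 torusMeasure) : ∀ᵐ x ∂torusMeasure, ofRealL2 g x = (g x : ℂ) :=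
  Complex.ofRealCLM.coeFn_compLpL g

lemma norm_reL2_le (g : Lp ℂ 2 torusMeasure) : ‖reL2 g‖ ≤ ‖g‖ := by
  refine Lp.norm_le_norm_of_ae_le ?_
  filter_upwards [coeFn_reL2 g] with x hx
  rw [hx]
  exact Complex.abs_re_le_norm _

lemma norm_imL2_le (g : Lp ℂ 2 torusMeasure) : ‖imL2 g‖ ≤ ‖g‖ := by
  refine Lp.norm_le_norm_of_ae_le ?_
  filter_upwards [coeFn_imL2 g] with x hx
  rw [hx]
  exact Complex.abs_im_le_norm _

/-- The Fourier coefficients of a real function in `L²`. -/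
def realCoeff : Lp ℝ 2 torusMeasure →L[ℝ] FreqL2 :=
  (synthesis.symm.toContinuousLinearEquiv : Lp ℂ 2 torusMeasure →L[ℂ] FreqL2).restrictScalars ℝ
    ∘L ofRealL2

lemma realCoeff_def (g : Lp ℝ 2 torusMeasure) : realCoeff g = synthesis.symm (ofRealL2 g) := rfl

lemma realCoeff_apply (g : Lp ℝ 2 torusMeasure) (n : Freq) :
    realCoeff g n = ∫ x, (g x : ℂ) * starRingEnd ℂ (character n x) ∂torusMeasure := by
  rw [realCoeff_def, synthesis_symm_apply]
  refine integral_congr_ae ?_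
  filter_upwards [coeFn_ofRealL2 g] with x hx
  rw [hx]

lemma norm_realCoeff (g : Lp ℝ 2 torusMeasure) : ‖realCoeff g‖ = ‖g‖ := by
  rw [realCoeff_def, LinearIsometryEquiv.norm_map]
  refine le_antisymm (Lp.norm_le_norm_of_ae_le ?_) (Lp.norm_le_norm_of_ae_le ?_) <;>
  · filter_upwards [coeFn_ofRealL2 g] with x hx
    rw [hx, Complex.norm_real]

lemma realCoeff_injective : Function.Injective realCoeff := by
  refine (injective_iff_map_eq_zero _).2 fun g hg => ?_
  rw [← norm_eq_zero, ← norm_realCoeff, hg, norm_zero]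

lemma realCoeff_neg (g : Lp ℝ 2 torusMeasure) (n : Freq) :
    realCoeff g (-n) = starRingEnd ℂ (realCoeff g n) := by
  rw [realCoeff_apply, realCoeff_apply, ← integral_conj]
  refine integral_congr_ae (Filter.Eventually.of_forall fun x => ?_)
  simp [character_neg]

/-- The real part of the function with given Fourier coefficients. -/
def realSynthesis : FreqL2 →L[ℝ] Lp ℝ 2 torusMeasure :=
  reL2 ∘L (synthesis.toContinuousLinearEquiv : FreqL2 →L[ℂ] Lp ℂ 2 torusMeasure).restrictScalars ℝ

lemma realSynthesis_def (c : FreqL2) : realSynthesis c = reL2 (synthesis c) := rfl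

lemma norm_realSynthesis_le (c : FreqL2) : ‖realSynthesis c‖ ≤ ‖c‖ := by
  rw [realSynthesis_def]
  exact (norm_reL2_le _).trans (synthesis.norm_map c).le

lemma integrable_mul_conj_character {g : (Fin 3 → ℝ) → ℂ} (hg : Integrable g torusMeasure)
    (n : Freq) : Integrable (fun x => g x * starRingEnd ℂ (character n x)) torusMeasure := by
  refine hg.mul_bdd (c := 1)
    (Complex.continuous_conj.comp (continuous_character n)).aestronglyMeasurable ?_
  exact Filter.Eventually.of_forall fun x => by simp [norm_character]

/-- The real part is the mean of the function and its complex conjugate, and conjugation turns the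
coefficients `c n` into `conj (c (-n))`. -/
lemma realCoeff_realSynthesis (c : FreqL2) (n : Freq) :
    realCoeff (realSynthesis c) n = (c n + starRingEnd ℂ (c (-n))) / 2 := by
  have hc : ∀ n, c n = ∫ x, synthesis c x * starRingEnd ℂ (character n x) ∂torusMeasure :=
    fun n => by rw [← synthesis_symm_apply, LinearIsometryEquiv.symm_apply_apply]
  have hInt : Integrable (synthesis c) torusMeasure :=
    (Lp.memLp (synthesis c)).integrable (by norm_num)
  have hconj : Integrable (fun x => starRingEnd ℂ (synthesis c x)) torusMeasure :=
    hInt.congr' (by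
      exact Complex.continuous_conj.comp_aestronglyMeasurable hInt.aestronglyMeasurable)
      (Filter.Eventually.of_forall fun x => by simp)
  rw [hc n, hc (-n), ← integral_conj, ← integral_add (integrable_mul_conj_character hInt n),
    ← integral_div, realCoeff_apply]
  · refine integral_congr_ae ?_
    filter_upwards [coeFn_reL2 (synthesis c)] with x hx
    rw [realSynthesis_def, hx, character_neg, Complex.re_eq_add_conj]
    simp only [map_mul, Complex.conj_conj]
    ring
  · refine (integrable_mul_conj_character hconj n).congr (Filter.Eventually.of_forall fun x => ?_)
    simp [character_neg]

lemma realCoeff_realSynthesis_of_symm {c : FreqL2} (hc : ∀ n, c (-n) = starRingEnd ℂ (c n)) :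
    realCoeff (realSynthesis c) = c := by
  ext n
  rw [realCoeff_realSynthesis, hc n]
  simp

lemma realSynthesis_realCoeff (g : Lp ℝ 2 torusMeasure) : realSynthesis (realCoeff g) = g :=
  realCoeff_injective (realCoeff_realSynthesis_of_symm (realCoeff_neg g))

/-- This extracts `∂ₜw` from `z = ⟨D⟩w + i∂ₜw`. -/
lemma realSynthesis_I_smul (c : FreqL2) :
    realSynthesis (-(Complex.I • c)) = imL2 (synthesis c) := by
  rw [realSynthesis_def, map_neg, map_smul]
  refine Lp.ext ?_
  filter_upwards [coeFn_reL2 (-(Complex.I • synthesis c)), coeFn_imL2 (synthesis c),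
    Lp.coeFn_neg (Complex.I • synthesis c), Lp.coeFn_smul Complex.I (synthesis c)]
    with x h1 h2 h3 h4
  rw [h1, h2, h3, Pi.neg_apply, h4]
  simp

/-- An even real multiple of `i` times the coefficients of a real function is purely imaginary. -/
lemma realSynthesis_I_smul_smoothing_realCoeff (g : Lp ℝ 2 torusMeasure) :
    realSynthesis (Complex.I • smoothing (realCoeff g)) = 0 := by
  refine realCoeff_injective ?_
  ext n
  rw [realCoeff_realSynthesis, map_zero]
  simp [realCoeff_neg, bracket_neg]

/-- Against `i` times a real function only the imaginary part survives. In the energy identity this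
pairs the nonlinearity with `∂ₜw`. -/
lemma re_inner_I_smul_realCoeff (c : FreqL2) (g : Lp ℝ 2 torusMeasure) :
    (inner ℂ c (Complex.I • realCoeff g)).re = inner ℝ (imL2 (synthesis c)) g := by
  rw [← synthesis.inner_map_map, map_smul, realCoeff_def, LinearIsometryEquiv.apply_symm_apply,
    inner_smul_right, L2.inner_def, L2.inner_def]
  have h1 : Integrable (fun x => inner ℂ (synthesis c x) (ofRealL2 g x)) torusMeasure :=
    L2.integrable_inner _ _
  rw [show (Complex.I * ∫ x, inner ℂ (synthesis c x) (ofRealL2 g x) ∂torusMeasure).re =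
    ∫ x, (Complex.I * inner ℂ (synthesis c x) (ofRealL2 g x)).re ∂torusMeasure by
      rw [← integral_const_mul]
      exact (integral_re (h1.const_mul Complex.I)).symm]
  refine integral_congr_ae ?_
  filter_upwards [coeFn_ofRealL2 g, coeFn_imL2 (synthesis c)] with x h2 h3
  simp [h2, h3]

end RealFunctions

/-! ## Trigonometric polynomials -/

section TrigPoly

open Filter Topology

/-- The trigonometric polynomial `∑_{n ∈ F} a(n) e^{i n·x}`. -/
def trigPoly (F : Finset Freq) (a : Freq → ℂ) (x : Fin 3 → ℝ) : ℂ :=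
  ∑ n ∈ F, a n * character n x

lemma continuous_trigPoly (F : Finset Freq) (a : Freq → ℂ) : Continuous (trigPoly F a) :=
  continuous_finsetSum _ fun n _ => continuous_const.mul (continuous_character n)

lemma memLp_trigPoly (F : Finset Freq) (a : Freq → ℂ) (p : ENNReal) :
    MemLp (trigPoly F a) p torusMeasure := by
  have := memLp_finsetSum (μ := torusMeasure) (p := p) F (f := fun n x => a n * character n x)
    fun n _ => (memLp_character n p).const_mul (a n)
  exact this

/-- The restriction of a sequence to a finite set of frequencies. -/
def truncate (F : Finset Freq) (a : Freq → ℂ) : FreqL2 := ∑ n ∈ F, lp.single 2 n (a n)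

lemma truncate_apply (F : Finset Freq) (a : Freq → ℂ) (n : Freq) :
    truncate F a n = if n ∈ F then a n else 0 := by
  rw [truncate, lp.coeFn_sum, Finset.sum_apply]
  simp only [lp.coeFn_single]
  rw [Finset.sum_pi_single]

lemma synthesis_truncate (F : Finset Freq) (a : Freq → ℂ) :
    ∀ᵐ x ∂torusMeasure, synthesis (truncate F a) x = trigPoly F a x := by
  have h1 : synthesis (truncate F a) = ∑ n ∈ F, a n • characterLp n := by
    rw [truncate, map_sum]
    refine Finset.sum_congr rfl fun n _ => ?_
    have : lp.single (E := fun _ : Freq => ℂ) 2 n (a n) = a n • lp.single 2 n (1 : ℂ) := by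
      rw [← lp.single_smul]; simp
    rw [this, map_smul, ← fourierBasis_apply]
    congr 1
    exact HilbertBasis.repr_symm_single fourierBasis n
  rw [h1]
  have h2 : (∑ n ∈ F, a n • characterLp n) = (memLp_trigPoly F a 2).toLp _ := by
    have h3 : ∀ n, a n • characterLp n = ((memLp_character n 2).const_mul (a n)).toLp
        (fun x => a n * character n x) := fun n => rfl
    refine Lp.ext ?_
    refine (Lp.coeFn_finsetSum _ _).trans ?_
    have h4 : ∀ᵐ x ∂torusMeasure, ∀ n ∈ F, (a n • characterLp n) x = a n * character n x := by
      rw [Finset.eventually_all]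
      intro n _
      rw [h3]
      exact MemLp.coeFn_toLp _
    filter_upwards [h4, (memLp_trigPoly F a 2).coeFn_toLp] with x h5 h6
    rw [h6, Finset.sum_apply, trigPoly]
    exact Finset.sum_congr rfl h5
  rw [h2]
  exact MemLp.coeFn_toLp _

lemma norm_truncate_sq (F : Finset Freq) (a : Freq → ℂ) :
    ‖truncate F a‖ ^ 2 = ∑ n ∈ F, ‖a n‖ ^ 2 := by
  have := lp.norm_sum_single (p := 2) (by simp) a F
  simpa [truncate] using this

lemma eLpNorm_trigPoly (F : Finset Freq) (a : Freq → ℂ) :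
    eLpNorm (trigPoly F a) 2 torusMeasure = ENNReal.ofReal ‖truncate F a‖ := by
  rw [← synthesis.norm_map, Lp.norm_def, ENNReal.ofReal_toReal (Lp.eLpNorm_ne_top _)]
  refine eLpNorm_congr_ae ?_
  filter_upwards [synthesis_truncate F a] with x hx using hx.symm

open Classical in
/-- The frequencies with `⟨n⟩ ≤ 2^k`. -/
def freqBall (k : ℕ) : Finset Freq :=
  (Fintype.piFinset fun _ => Finset.Icc (-(2 ^ k : ℤ)) (2 ^ k)).filter fun n => bracket n ≤ 2 ^ k

lemma abs_apply_le_len (n : Freq) (i : Fin 3) : |(n i : ℝ)| ≤ len n :=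
  Real.abs_le_sqrt (Finset.single_le_sum (f := fun i => (n i : ℝ) ^ 2)
    (fun _ _ => sq_nonneg _) (Finset.mem_univ i))

lemma mem_freqBall {k : ℕ} {n : Freq} : n ∈ freqBall k ↔ bracket n ≤ 2 ^ k := by
  classical
  rw [freqBall, Finset.mem_filter, Fintype.mem_piFinset]
  refine ⟨fun h => h.2, fun h => ⟨fun i => ?_, h⟩⟩
  have h1 := ((abs_apply_le_len n i).trans (len_le_bracket n)).trans h
  rw [Finset.mem_Icc, ← abs_le]
  exact_mod_cast h1

lemma freqBall_mono : Monotone freqBall := fun k l h n hn => by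
  rw [mem_freqBall] at *
  exact hn.trans (pow_le_pow_right₀ one_le_two h)

lemma card_freqBall_le (k : ℕ) : (freqBall k).card ≤ (2 * 2 ^ k + 1) ^ 3 := by
  classical
  refine (Finset.card_filter_le _ _).trans ?_
  rw [Fintype.card_piFinset]
  simp only [Int.card_Icc, Finset.prod_const, Finset.card_univ, Fintype.card_fin]
  refine Nat.pow_le_pow_left ?_ 3
  have : (2 ^ k + 1 - -2 ^ k : ℤ) = ((2 * 2 ^ k + 1 : ℕ) : ℤ) := by push_cast; ring
  rw [this, Int.toNat_natCast]

lemma tendsto_freqBall : Tendsto freqBall atTop atTop := by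
  refine tendsto_atTop_finset_of_monotone freqBall_mono fun n => ?_
  obtain ⟨k, hk⟩ := pow_unbounded_of_one_lt (bracket n) one_lt_two
  exact ⟨k, mem_freqBall.2 hk.le⟩

lemma tendsto_truncate (c : FreqL2) :
    Tendsto (fun k => truncate (freqBall k) c) atTop (𝓝 c) :=
  (lp.hasSum_single (p := 2) (by simp) c).comp tendsto_freqBall

end TrigPoly

/-! ## The Sobolev embedding `H¹ ⊂ L⁶` -/

section Sobolev

open Filter Topology
open scoped ENNReal NNReal

/-- The coefficients of the `i`-th partial derivative. -/
def partialCoeff (i : Fin 3) (a : Freq → ℂ) (n : Freq) : ℂ := Complex.I * n i * a n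

lemma hasFDerivAt_character (n : Freq) (x : Fin 3 → ℝ) :
    HasFDerivAt (character n) (∑ i, (Complex.I * n i * character n x) •
      (Complex.ofRealCLM ∘L (ContinuousLinearMap.proj i : (Fin 3 → ℝ) →L[ℝ] ℝ))) x := by
  have h1 : ∀ i : Fin 3, HasFDerivAt (fun x : Fin 3 → ℝ => (x i : ℂ))
      (Complex.ofRealCLM ∘L (ContinuousLinearMap.proj i : (Fin 3 → ℝ) →L[ℝ] ℝ)) x := fun i =>
    (Complex.ofRealCLM ∘L (ContinuousLinearMap.proj i : (Fin 3 → ℝ) →L[ℝ] ℝ)).hasFDerivAt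
  have h2 := ((HasFDerivAt.fun_sum (u := Finset.univ)
    fun i _ => (h1 i).const_mul (n i : ℂ)).const_mul Complex.I).cexp
  refine h2.congr_fderiv ?_
  ext v
  simp only [character, smul_apply, sum_apply,
    ContinuousLinearMap.comp_apply, smul_eq_mul, Finset.mul_sum]
  refine Finset.sum_congr rfl fun i _ => ?_
  ring

lemma hasFDerivAt_trigPoly (F : Finset Freq) (a : Freq → ℂ) (x : Fin 3 → ℝ) :
    HasFDerivAt (trigPoly F a) (∑ i, trigPoly F (partialCoeff i a) x •
      (Complex.ofRealCLM ∘L (ContinuousLinearMap.proj i : (Fin 3 → ℝ) →L[ℝ] ℝ))) x := by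
  have h := HasFDerivAt.fun_sum (u := F) fun n _ => (hasFDerivAt_character n x).const_mul (a n)
  refine h.congr_fderiv ?_
  ext v
  simp only [smul_apply, sum_apply, trigPoly,
    smul_eq_mul, Finset.mul_sum, partialCoeff]
  rw [Finset.sum_comm]
  refine Finset.sum_congr rfl fun i _ => ?_
  rw [Finset.sum_mul]
  refine Finset.sum_congr rfl fun n _ => ?_
  ring

lemma contDiff_character (n : Freq) {m : WithTop ℕ∞} : ContDiff ℝ m (character n) := by
  unfold character
  refine ContDiff.cexp (contDiff_const.mul (ContDiff.sum fun i _ => contDiff_const.mul ?_))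
  exact Complex.ofRealCLM.contDiff.comp (contDiff_apply ℝ ℝ i)

lemma contDiff_trigPoly (F : Finset Freq) (a : Freq → ℂ) {m : WithTop ℕ∞} :
    ContDiff ℝ m (trigPoly F a) :=
  ContDiff.sum fun n _ => contDiff_const.mul (contDiff_character n)

lemma norm_fderiv_trigPoly_le (F : Finset Freq) (a : Freq → ℂ) (x : Fin 3 → ℝ) :
    ‖fderiv ℝ (trigPoly F a) x‖ ≤ ∑ i, ‖trigPoly F (partialCoeff i a) x‖ := by
  rw [(hasFDerivAt_trigPoly F a x).fderiv]
  refine ContinuousLinearMap.opNorm_le_bound _ (Finset.sum_nonneg fun _ _ => norm_nonneg _) ?_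
  intro v
  rw [sum_apply, Finset.sum_mul]
  refine (norm_sum_le _ _).trans (Finset.sum_le_sum fun i _ => ?_)
  simp only [smul_apply, ContinuousLinearMap.comp_apply, smul_eq_mul, norm_mul]
  gcongr
  simpa using norm_le_pi_norm v i

lemma character_add_period (n m : Freq) (x : Fin 3 → ℝ) :
    character n (fun i => x i + 2 * Real.pi * m i) = character n x := by
  have h : Complex.I * ∑ i, (n i : ℂ) * ((x i + 2 * Real.pi * m i : ℝ) : ℂ) =
      Complex.I * ∑ i, (n i : ℂ) * (x i : ℂ) +
        ((∑ i, n i * m i : ℤ) : ℂ) * (2 * Real.pi * Complex.I) := by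
    push_cast
    rw [Finset.mul_sum, Finset.mul_sum, Finset.sum_mul, ← Finset.sum_add_distrib]
    refine Finset.sum_congr rfl fun i _ => ?_
    ring
  rw [character, character, h, Complex.exp_add, Complex.exp_int_mul_two_pi_mul_I, mul_one]

lemma trigPoly_add_period (F : Finset Freq) (a : Freq → ℂ) (m : Freq) (x : Fin 3 → ℝ) :
    trigPoly F a (fun i => x i + 2 * Real.pi * m i) = trigPoly F a x := by
  simp only [trigPoly, character_add_period]

/-- The centre of the fundamental cube. -/
def cubeCentre : Fin 3 → ℝ := fun _ => Real.pi

lemma cube_subset_closedBall : cube ⊆ Metric.closedBall cubeCentre Real.pi := by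
  intro x hx
  rw [Metric.mem_closedBall, dist_pi_le_iff Real.pi_pos.le]
  intro i
  have := hx i (Set.mem_univ i)
  rw [Real.dist_eq, abs_le, cubeCentre]
  constructor <;> linarith [this.1, this.2]

/-- The integral of a periodic function over the doubled cube is bounded by its integral over the
fundamental cube. -/
lemma setLIntegral_closedBall_le (h : (Fin 3 → ℝ) → ℝ≥0∞)
    (hper : ∀ (m : Freq) (x : Fin 3 → ℝ), h (fun i => x i + 2 * Real.pi * m i) = h x) :
    ∫⁻ x in Metric.closedBall cubeCentre (2 * Real.pi), h x ≤ 27 * ∫⁻ x in cube, h x := by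
  have hpi := Real.pi_pos
  -- In the sup norm the ball is `[-π, 3π]³`, which the 27 translates of the cube by shifts with
  -- entries `-1`, `0`, `1` cover.
  let S : Finset Freq := Fintype.piFinset fun _ => Finset.Icc (-1) 1
  let tr : Freq → (Fin 3 → ℝ) → (Fin 3 → ℝ) := fun m x i => x i + 2 * Real.pi * m i
  have htr : ∀ m, MeasurePreserving (tr m) volume volume := fun m => by
    have := measurePreserving_add_right (volume : Measure (Fin 3 → ℝ))
      (fun i => 2 * Real.pi * (m i : ℝ))
    exact this
  have htre : ∀ m, MeasurableEmbedding (tr m) := fun m =>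
    (MeasurableEquiv.addRight (fun i => 2 * Real.pi * (m i : ℝ))).measurableEmbedding
  have hcov : Metric.closedBall cubeCentre (2 * Real.pi) ⊆ ⋃ m : S, tr m ⁻¹' cube := by
    intro x hx
    rw [Metric.mem_closedBall, dist_pi_le_iff (by positivity)] at hx
    have hx' : ∀ i, -Real.pi ≤ x i ∧ x i ≤ 3 * Real.pi := fun i => by
      have := hx i
      rw [Real.dist_eq, abs_le, cubeCentre] at this
      constructor <;> linarith [this.1, this.2]
    have : ∀ i, ∃ k : ℤ, k ∈ Finset.Icc (-1 : ℤ) 1 ∧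
        x i + 2 * Real.pi * k ∈ Set.Ico 0 (2 * Real.pi) := fun i => by
      obtain ⟨h1, h2⟩ := hx' i
      by_cases h3 : x i < 0
      · exact ⟨1, by simp, by push_cast; linarith, by push_cast; linarith⟩
      by_cases h4 : x i < 2 * Real.pi
      · exact ⟨0, by simp, by push_cast; linarith, by push_cast; linarith⟩
      · exact ⟨-1, by simp, by push_cast; linarith, by push_cast; linarith⟩
    choose m hm hm' using this
    simp only [Set.mem_iUnion]
    exact ⟨⟨m, Fintype.mem_piFinset.2 hm⟩, fun i _ => hm' i⟩
  calc ∫⁻ x in Metric.closedBall cubeCentre (2 * Real.pi), h x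
      ≤ ∫⁻ x in ⋃ m : S, tr m ⁻¹' cube, h x := lintegral_mono_set hcov
    _ ≤ ∑' m : S, ∫⁻ x in tr m ⁻¹' cube, h x := lintegral_iUnion_le _ _
    _ = ∑' m : S, ∫⁻ x in cube, h x := by
        refine tsum_congr fun m => ?_
        rw [← (htr m).setLIntegral_comp_preimage_emb (htre m) h cube]
        exact lintegral_congr fun x => (hper m x).symm
    _ = 27 * ∫⁻ x in cube, h x := by
        rw [tsum_fintype, Finset.sum_const]
        simp [S, nsmul_eq_mul]

end Sobolev

/-! ### The Sobolev inequality on the torus, by localisation from `ℝ³` -/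

section Sobolev

open Filter Topology
open scoped ENNReal NNReal

lemma restrict_cube_eq :
    volume.restrict cube = ENNReal.ofReal ((2 * Real.pi) ^ 3) • torusMeasure := by
  rw [torusMeasure, smul_smul, ← ENNReal.ofReal_mul (by positivity),
    mul_inv_cancel₀ (by have := Real.pi_pos; positivity), ENNReal.ofReal_one, one_smul]

lemma norm_truncate_le (F : Finset Freq) {a b : Freq → ℂ} (h : ∀ n, ‖a n‖ ≤ ‖b n‖) :
    ‖truncate F a‖ ≤ ‖truncate F b‖ := by
  refine abs_le_of_sq_le_sq' ?_ (norm_nonneg _) |>.2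
  rw [norm_truncate_sq, norm_truncate_sq]
  exact Finset.sum_le_sum fun n _ => pow_le_pow_left₀ (norm_nonneg _) (h n) 2

lemma eLpNorm_le_of_support_subset {E : Type*} [NormedAddCommGroup E] {f : (Fin 3 → ℝ) → E}
    {q : (Fin 3 → ℝ) → ℝ} {D : ℝ} {S : Set (Fin 3 → ℝ)} (hS : Function.support f ⊆ S)
    (h : ∀ x, ‖f x‖ ≤ D * ‖q x‖) :
    eLpNorm f 2 volume ≤ D.toNNReal * eLpNorm q 2 (volume.restrict S) := by
  rw [← eLpNorm_restrict_eq_of_support_subset hS]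
  exact eLpNorm_le_mul_eLpNorm_of_ae_le_mul (Eventually.of_forall h) 2

/-- The Gagliardo–Nirenberg–Sobolev inequality in dimension three: `1/6 = 1/2 - 1/3`. -/
lemma exists_eLpNorm_six_le : ∃ K : ℝ≥0, ∀ u : (Fin 3 → ℝ) → ℂ, ContDiff ℝ 1 u →
    HasCompactSupport u → eLpNorm u 6 volume ≤ K * eLpNorm (fderiv ℝ u) 2 volume := by
  refine ⟨SNormLESNormFDerivOfEqConst ℂ (volume : Measure (Fin 3 → ℝ)) (2 : ℝ≥0),
    fun u hu huc => ?_⟩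
  have h := eLpNorm_le_eLpNorm_fderiv_of_eq (volume : Measure (Fin 3 → ℝ)) hu huc
    (p := 2) (p' := 6) (by norm_num) (by simp) (by norm_num)
  rwa [ENNReal.coe_ofNat, ENNReal.coe_ofNat] at h

/-- The Sobolev inequality for trigonometric polynomials. -/
lemma exists_eLpNorm_trigPoly_le : ∃ C : ℝ≥0, ∀ (F : Finset Freq) (a : Freq → ℂ),
    eLpNorm (trigPoly F a) 6 torusMeasure ≤
      C * ENNReal.ofReal ‖truncate F fun n => (bracket n : ℂ) * a n‖ := by
  have hpi := Real.pi_pos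
  -- The bump is `1` on `[0, 2π]³` and is supported in the doubled cube. So `χ g` is admissible on
  -- `ℝ³` and agrees with `g` on the fundamental cube.
  let χ : ContDiffBump cubeCentre := ⟨Real.pi, 2 * Real.pi, hpi, by linarith⟩
  have hχ1 : ContDiff ℝ 1 (χ : (Fin 3 → ℝ) → ℝ) := χ.contDiff
  have hχc : HasCompactSupport (χ : (Fin 3 → ℝ) → ℝ) := χ.hasCompactSupport
  obtain ⟨D, hD⟩ := (hχ1.continuous_fderiv one_ne_zero).bounded_above_of_compact_support
    (hχc.fderiv (𝕜 := ℝ))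
  have hD0 : 0 ≤ D := (norm_nonneg _).trans (hD 0)
  obtain ⟨K, hK⟩ := exists_eLpNorm_six_le
  let v₃ : ℝ≥0 := Real.toNNReal ((2 * Real.pi) ^ 3)
  have hv₃ : v₃ ≠ 0 := by
    simp only [v₃, ne_eq, Real.toNNReal_eq_zero, not_le]; positivity
  -- From right to left: `4` for the `L²` norms of `g` and its three partial derivatives, the
  -- passage from `torusMeasure` to Lebesgue measure, `27` translates, the product rule with the
  -- cutoff, the inequality on `ℝ³`, and the passage back in `L⁶`.
  refine ⟨(v₃ ^ (1 / 6 : ℝ))⁻¹ * (K * ((1 + D).toNNReal * (27 ^ (1 / 2 : ℝ) *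
    (v₃ ^ (1 / 2 : ℝ) * 4)))), fun F a => ?_⟩
  set B := ENNReal.ofReal ‖truncate F fun n => (bracket n : ℂ) * a n‖ with hB
  let g := trigPoly F a
  let u : (Fin 3 → ℝ) → ℂ := fun x => χ x • g x
  let q : (Fin 3 → ℝ) → ℝ := fun x => ‖g x‖ + ∑ i, ‖trigPoly F (partialCoeff i a) x‖
  have hu : ContDiff ℝ 1 u := hχ1.smul (contDiff_trigPoly F a)
  have huc : HasCompactSupport u := hχc.smul_right
  have hq0 : ∀ x, 0 ≤ q x := fun x =>
    add_nonneg (norm_nonneg _) (Finset.sum_nonneg fun _ _ => norm_nonneg _)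
  have hqc : Continuous q := (continuous_trigPoly F a).norm.add
    (continuous_finsetSum _ fun i _ => (continuous_trigPoly F _).norm)
  have hfd : ∀ x, ‖fderiv ℝ u x‖ ≤ (1 + D) * ‖q x‖ := fun x => by
    have h1 : HasFDerivAt u (χ x • fderiv ℝ g x + (fderiv ℝ χ x).smulRight (g x)) x :=
      (hχ1.differentiable one_ne_zero x).hasFDerivAt.smul
        ((contDiff_trigPoly F a (m := 1)).differentiable one_ne_zero x).hasFDerivAt
    rw [h1.fderiv, Real.norm_of_nonneg (hq0 x)]
    have h2 := norm_fderiv_trigPoly_le F a x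
    have h3 : ‖χ x • fderiv ℝ g x‖ ≤ ‖fderiv ℝ g x‖ := by
      rw [norm_smul, Real.norm_of_nonneg χ.nonneg]
      exact mul_le_of_le_one_left (norm_nonneg _) χ.le_one
    have h4 : ‖(fderiv ℝ χ x).smulRight (g x)‖ ≤ D * ‖g x‖ := by
      rw [ContinuousLinearMap.norm_smulRight_apply]
      exact mul_le_mul_of_nonneg_right (hD x) (norm_nonneg _)
    have h5 : 0 ≤ ∑ i, ‖trigPoly F (partialCoeff i a) x‖ :=
      Finset.sum_nonneg fun _ _ => norm_nonneg _
    calc _ ≤ ‖fderiv ℝ g x‖ + D * ‖g x‖ := (norm_add_le _ _).trans (add_le_add h3 h4)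
      _ ≤ (∑ i, ‖trigPoly F (partialCoeff i a) x‖) + D * ‖g x‖ := by gcongr
      _ ≤ (1 + D) * (‖g x‖ + ∑ i, ‖trigPoly F (partialCoeff i a) x‖) := by
          nlinarith [norm_nonneg (g x), mul_nonneg hD0 h5]
  have step1 : eLpNorm g 6 (volume.restrict cube) ≤ eLpNorm u 6 volume := by
    have : eLpNorm g 6 (volume.restrict cube) = eLpNorm u 6 (volume.restrict cube) := by
      refine eLpNorm_congr_ae ?_
      filter_upwards [ae_restrict_mem measurableSet_cube] with x hx
      have : χ x = 1 := χ.one_of_mem_closedBall (cube_subset_closedBall hx)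
      simp [u, this]
    rw [this]
    exact eLpNorm_mono_measure _ Measure.restrict_le_self
  have step2 : eLpNorm u 6 volume ≤ K * eLpNorm (fderiv ℝ u) 2 volume := hK u hu huc
  have hsupp : Function.support (fderiv ℝ u) ⊆ Metric.closedBall cubeCentre (2 * Real.pi) := by
    have h1 : Function.support (fderiv ℝ u) ⊆ tsupport u := support_fderiv_subset ℝ
    have h2 : tsupport u ⊆ tsupport χ := tsupport_smul_subset_left _ _
    refine (h1.trans h2).trans ?_
    rw [χ.tsupport_eq]
  have step3 := eLpNorm_le_of_support_subset hsupp hfd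
  have step4 : eLpNorm q 2 (volume.restrict (Metric.closedBall cubeCentre (2 * Real.pi))) ≤
      (27 : ℝ≥0∞) ^ (1 / 2 : ℝ) * eLpNorm q 2 (volume.restrict cube) := by
    rw [eLpNorm_eq_lintegral_rpow_enorm_toReal (by simp) (by simp),
      eLpNorm_eq_lintegral_rpow_enorm_toReal (by simp) (by simp),
      ENNReal.toReal_ofNat, ← ENNReal.mul_rpow_of_nonneg _ _ (by norm_num)]
    refine ENNReal.rpow_le_rpow ?_ (by norm_num)
    refine setLIntegral_closedBall_le (fun x => ‖q x‖ₑ ^ (2 : ℝ)) fun m x => ?_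
    simp only [q, g, trigPoly_add_period]
  have hcube : ∀ (f : (Fin 3 → ℝ) → ℝ), eLpNorm f 2 (volume.restrict cube) =
      (v₃ : ℝ≥0∞) ^ (1 / 2 : ℝ) * eLpNorm f 2 torusMeasure := fun f => by
    rw [restrict_cube_eq, eLpNorm_smul_measure_of_ne_top (by simp)]
    simp [v₃, ENNReal.ofReal]
  have step5 : eLpNorm q 2 torusMeasure ≤ 4 * B := by
    have hterm : ∀ b : Freq → ℂ, (∀ n, ‖b n‖ ≤ bracket n * ‖a n‖) →
        eLpNorm (fun x => ‖trigPoly F b x‖) 2 torusMeasure ≤ B := fun b hb => by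
      rw [eLpNorm_norm, eLpNorm_trigPoly]
      refine ENNReal.ofReal_le_ofReal (norm_truncate_le F fun n => ?_)
      rw [norm_mul, Complex.norm_real, Real.norm_of_nonneg (bracket_pos n).le]
      exact hb n
    have hm : ∀ b : Freq → ℂ, AEStronglyMeasurable (fun x => ‖trigPoly F b x‖) torusMeasure :=
      fun b => (continuous_trigPoly F b).norm.aestronglyMeasurable
    have h0 := hterm a fun n => le_mul_of_one_le_left (norm_nonneg _) (one_le_bracket n)
    have hi : ∀ i, eLpNorm (fun x => ‖trigPoly F (partialCoeff i a) x‖) 2 torusMeasure ≤ B :=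
      fun i => hterm _ fun n => by
        rw [partialCoeff, norm_mul, norm_mul, Complex.norm_I, one_mul]
        gcongr
        rw [Complex.norm_intCast]
        exact (abs_apply_le_len n i).trans (len_le_bracket n)
    calc eLpNorm q 2 torusMeasure
        ≤ eLpNorm (fun x => ‖g x‖) 2 torusMeasure +
          eLpNorm (∑ i, fun x => ‖trigPoly F (partialCoeff i a) x‖) 2 torusMeasure := by
          have : q = (fun x => ‖g x‖) + ∑ i, fun x => ‖trigPoly F (partialCoeff i a) x‖ := by
            funext x; simp [q]
          rw [this]
          exact eLpNorm_add_le (hm a) (Finset.aestronglyMeasurable_sum _ fun i _ => hm _)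
            (by norm_num)
      _ ≤ B + ∑ i : Fin 3, B := by
          refine add_le_add h0 ((eLpNorm_sum_le (fun i _ => hm _) (by norm_num)).trans
            (Finset.sum_le_sum fun i _ => hi i))
      _ = 4 * B := by
          simp only [Finset.sum_const, Finset.card_univ, Fintype.card_fin, nsmul_eq_mul]
          push_cast
          ring
  have h6 : eLpNorm g 6 (volume.restrict cube) =
      (v₃ : ℝ≥0∞) ^ (1 / 6 : ℝ) * eLpNorm g 6 torusMeasure := by
    rw [restrict_cube_eq, eLpNorm_smul_measure_of_ne_top (by simp)]
    simp [v₃, ENNReal.ofReal]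
  have hpos : (v₃ : ℝ≥0∞) ^ (1 / 6 : ℝ) ≠ 0 := by
    rw [← ENNReal.coe_rpow_of_ne_zero hv₃]
    exact_mod_cast (NNReal.rpow_pos (pos_iff_ne_zero.2 hv₃)).ne'
  have htop : (v₃ : ℝ≥0∞) ^ (1 / 6 : ℝ) ≠ ⊤ := by
    rw [← ENNReal.coe_rpow_of_ne_zero hv₃]
    exact ENNReal.coe_ne_top
  have hfin : (v₃ : ℝ≥0∞) ^ (1 / 6 : ℝ) * eLpNorm g 6 torusMeasure ≤
      K * ((1 + D).toNNReal * ((27 : ℝ≥0∞) ^ (1 / 2 : ℝ) * ((v₃ : ℝ≥0∞) ^ (1 / 2 : ℝ) * (4 * B)))) := by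
    rw [← h6]
    refine step1.trans (step2.trans ?_)
    gcongr
    refine step3.trans ?_
    gcongr
    refine step4.trans ?_
    gcongr
    rw [hcube]
    gcongr
  calc eLpNorm g 6 torusMeasure
      = ((v₃ : ℝ≥0∞) ^ (1 / 6 : ℝ))⁻¹ * ((v₃ : ℝ≥0∞) ^ (1 / 6 : ℝ) * eLpNorm g 6 torusMeasure) := by
        rw [← mul_assoc, ENNReal.inv_mul_cancel hpos htop, one_mul]
    _ ≤ ((v₃ : ℝ≥0∞) ^ (1 / 6 : ℝ))⁻¹ * (K * ((1 + D).toNNReal * ((27 : ℝ≥0∞) ^ (1 / 2 : ℝ) *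
          ((v₃ : ℝ≥0∞) ^ (1 / 2 : ℝ) * (4 * B))))) := by gcongr
    _ = _ := by
        rw [ENNReal.coe_mul, ENNReal.coe_mul, ENNReal.coe_mul, ENNReal.coe_mul, ENNReal.coe_mul,
          ENNReal.coe_inv (NNReal.rpow_pos (pos_iff_ne_zero.2 hv₃)).ne',
          ENNReal.coe_rpow_of_ne_zero hv₃, ENNReal.coe_rpow_of_ne_zero hv₃,
          ENNReal.coe_rpow_of_ne_zero (by norm_num)]
        push_cast
        ring

/-- The Sobolev constant of the embedding `H¹ ⊂ L⁶`. -/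
def sobolevConst : ℝ≥0 := exists_eLpNorm_trigPoly_le.choose

/-- Truncations converge in `L²`, hence almost everywhere along a subsequence, and Fatou's lemma
carries the inequality to the limit. -/
lemma eLpNorm_synthesis_smoothing_le (c : FreqL2) :
    eLpNorm (synthesis (smoothing c)) 6 torusMeasure ≤ sobolevConst * ENNReal.ofReal ‖c‖ := by
  have hC := exists_eLpNorm_trigPoly_le.choose_spec
  have ht := (synthesis.continuous.tendsto _).comp (tendsto_truncate (smoothing c))
  obtain ⟨φ, hφ, hae⟩ := (tendstoInMeasure_of_tendsto_Lp ht).exists_seq_tendsto_ae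
  refine (Lp.eLpNorm_lim_le_liminf_eLpNorm (fun k => Lp.aestronglyMeasurable _) _ hae).trans ?_
  refine Filter.liminf_le_of_le (by isBoundedDefault) fun b hb => ?_
  obtain ⟨k, hk⟩ := hb.exists
  refine hk.trans ?_
  have h1 : eLpNorm (synthesis (truncate (freqBall (φ k)) (smoothing c))) 6 torusMeasure =
      eLpNorm (trigPoly (freqBall (φ k)) (smoothing c)) 6 torusMeasure :=
    eLpNorm_congr_ae (synthesis_truncate _ _)
  refine (h1.le.trans (hC _ _)).trans ?_
  rw [sobolevConst]
  gcongr
  have h2 : (fun n => (bracket n : ℂ) * smoothing c n) = c := by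
    funext n
    have : (bracket n : ℂ) ≠ 0 := by exact_mod_cast (bracket_pos n).ne'
    rw [smoothing_apply]
    push_cast
    field_simp
  rw [h2]
  refine abs_le_of_sq_le_sq' ?_ (norm_nonneg _) |>.2
  rw [norm_truncate_sq, FreqL2.norm_sq]
  exact c.summable_sq.sum_le_tsum _ fun _ _ => by positivity

lemma eLpNorm_realSynthesis_smoothing_le (c : FreqL2) :
    eLpNorm (realSynthesis (smoothing c)) 6 torusMeasure ≤ sobolevConst * ENNReal.ofReal ‖c‖ := by
  refine (eLpNorm_mono_ae ?_).trans (eLpNorm_synthesis_smoothing_le c)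
  filter_upwards [coeFn_reL2 (synthesis (smoothing c))] with x hx
  rw [realSynthesis_def, hx]
  exact Complex.abs_re_le_norm _

instance : Fact ((1 : ℝ≥0∞) ≤ 6) := ⟨by norm_num⟩

instance : Fact ((1 : ℝ≥0∞) ≤ 3) := ⟨by norm_num⟩

lemma memLp_realSynthesis_smoothing (c : FreqL2) :
    MemLp (realSynthesis (smoothing c)) 6 torusMeasure :=
  ⟨Lp.aestronglyMeasurable _, (eLpNorm_realSynthesis_smoothing_le c).trans_lt (by finiteness)⟩

/-- The map that sends `c` to the real part of the function with coefficients `⟨n⟩⁻¹ c(n)`, as a map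
from `ℓ²` to `L⁶`. -/
def sobolevL6 : FreqL2 →L[ℝ] Lp ℝ 6 torusMeasure :=
  LinearMap.mkContinuous
    { toFun := fun c => (memLp_realSynthesis_smoothing c).toLp _
      map_add' := fun c d => by
        refine Lp.ext ?_
        filter_upwards [(memLp_realSynthesis_smoothing (c + d)).coeFn_toLp,
          (memLp_realSynthesis_smoothing c).coeFn_toLp,
          (memLp_realSynthesis_smoothing d).coeFn_toLp,
          Lp.coeFn_add ((memLp_realSynthesis_smoothing c).toLp _)
            ((memLp_realSynthesis_smoothing d).toLp _),
          Lp.coeFn_add (realSynthesis (smoothing c)) (realSynthesis (smoothing d))]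
          with x h1 h2 h3 h4 h5
        rw [h1, h4, Pi.add_apply, h2, h3, map_add, map_add, h5, Pi.add_apply]
      map_smul' := fun r c => by
        refine Lp.ext ?_
        have hr : smoothing (r • c) = r • smoothing c := by
          ext n; simp
        filter_upwards [(memLp_realSynthesis_smoothing (r • c)).coeFn_toLp,
          (memLp_realSynthesis_smoothing c).coeFn_toLp,
          Lp.coeFn_smul r ((memLp_realSynthesis_smoothing c).toLp _),
          Lp.coeFn_smul r (realSynthesis (smoothing c))]
          with x h1 h2 h3 h4
        rw [RingHom.id_apply, h1, h3, Pi.smul_apply, h2, hr, map_smul, h4, Pi.smul_apply] }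
    sobolevConst fun c => by
      simp only [LinearMap.coe_mk, AddHom.coe_mk]
      rw [Lp.norm_toLp]
      refine ENNReal.toReal_le_of_le_ofReal (by positivity) ?_
      rw [ENNReal.ofReal_mul (by positivity), ENNReal.ofReal_coe_nnreal]
      exact eLpNorm_realSynthesis_smoothing_le c

lemma coeFn_sobolevL6 (c : FreqL2) :
    ∀ᵐ x ∂torusMeasure, sobolevL6 c x = realSynthesis (smoothing c) x :=
  (memLp_realSynthesis_smoothing c).coeFn_toLp

end Sobolev

/-! ## Ordinary differential equations with an a priori bound -/

section ODE

open Set Metric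
open scoped NNReal

variable {E : Type*} [NormedAddCommGroup E]

/-- A cutoff function that is `1` on the ball of radius `R` and `0` off the ball of radius
`R + 1`. -/
def radialCutoff (R : ℝ) (x : E) : ℝ := max 0 (min 1 (R + 1 - ‖x‖))

lemma radialCutoff_nonneg (R : ℝ) (x : E) : 0 ≤ radialCutoff R x := le_max_left _ _

lemma radialCutoff_le_one (R : ℝ) (x : E) : radialCutoff R x ≤ 1 :=
  max_le zero_le_one (min_le_left _ _)

lemma radialCutoff_eq_one {R : ℝ} {x : E} (h : ‖x‖ ≤ R) : radialCutoff R x = 1 := by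
  rw [radialCutoff, min_eq_left (by linarith), max_eq_right zero_le_one]

lemma radialCutoff_eq_zero {R : ℝ} {x : E} (h : R + 1 ≤ ‖x‖) : radialCutoff R x = 0 := by
  rw [radialCutoff, max_eq_left]
  exact (min_le_right _ _).trans (by linarith)

lemma abs_radialCutoff_sub_le (R : ℝ) (x y : E) :
    |radialCutoff R x - radialCutoff R y| ≤ ‖x - y‖ := by
  refine (abs_max_sub_max_le_max _ _ _ _).trans ?_
  refine max_le (by simp) ((abs_min_sub_min_le_max _ _ _ _).trans (max_le (by simp) ?_))
  rw [show R + 1 - ‖x‖ - (R + 1 - ‖y‖) = ‖y‖ - ‖x‖ by ring, norm_sub_rev]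
  exact abs_norm_sub_norm_le y x

variable [NormedSpace ℝ E]

/-- A vector field that is continuous in time and Lipschitz on bounded sets, locally uniformly in
time. -/
structure IsLocallyLipschitzField (F : ℝ → E → E) : Prop where
  continuous : ∀ x, Continuous fun t => F t x
  lipschitz : ∀ T R : ℝ, ∃ K : ℝ≥0, ∀ t, |t| ≤ T → LipschitzOnWith K (F t) (closedBall 0 R)

/-- On a smaller compact interval both solutions are bounded, so they lie in one ball on which the
field is Lipschitz. -/
lemma IsLocallyLipschitzField.eqOn {F : ℝ → E → E} (hF : IsLocallyLipschitzField F) {τ : ℝ}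
    {f g : ℝ → E} (hf : ∀ t ∈ Ioo (-τ) τ, HasDerivAt f (F t (f t)) t)
    (hg : ∀ t ∈ Ioo (-τ) τ, HasDerivAt g (F t (g t)) t) (h0 : f 0 = g 0) :
    EqOn f g (Ioo (-τ) τ) := by
  intro t ht
  have htτ : |t| < τ := abs_lt.2 ht
  obtain ⟨σ, hσ1, hσ2⟩ := exists_between htτ
  have hσ0 : 0 < σ := (abs_nonneg t).trans_lt hσ1
  have hsub : Icc (-σ) σ ⊆ Ioo (-τ) τ := fun r hr => ⟨by linarith [hr.1], by linarith [hr.2]⟩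
  have hcf : ContinuousOn f (Icc (-σ) σ) := fun r hr =>
    (hf r (hsub hr)).continuousAt.continuousWithinAt
  have hcg : ContinuousOn g (Icc (-σ) σ) := fun r hr =>
    (hg r (hsub hr)).continuousAt.continuousWithinAt
  obtain ⟨A, hA⟩ := isCompact_Icc.exists_bound_of_continuousOn hcf
  obtain ⟨B, hB⟩ := isCompact_Icc.exists_bound_of_continuousOn hcg
  obtain ⟨K, hK⟩ := hF.lipschitz σ (max A B)
  refine ODE_solution_unique_of_mem_Ioo (v := F) (s := fun _ => closedBall 0 (max A B)) (K := K)
    (a := -σ) (b := σ) (t₀ := 0) (fun r hr => hK r (abs_le.2 ⟨hr.1.le, hr.2.le⟩))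
    ⟨by linarith, hσ0⟩ (fun r hr => ⟨hf r (hsub (Ioo_subset_Icc_self hr)), ?_⟩)
    (fun r hr => ⟨hg r (hsub (Ioo_subset_Icc_self hr)), ?_⟩) h0 (abs_lt.1 hσ1)
  · rw [mem_closedBall_zero_iff]
    exact (hA r (Ioo_subset_Icc_self hr)).trans (le_max_left _ _)
  · rw [mem_closedBall_zero_iff]
    exact (hB r (Ioo_subset_Icc_self hr)).trans (le_max_right _ _)

lemma lipschitzWith_radialCutoff_smul {G : E → E} {R M : ℝ} {K : ℝ≥0} (hM : 0 ≤ M)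
    (hG : LipschitzOnWith K G (closedBall 0 (R + 1)))
    (hb : ∀ x ∈ closedBall (0 : E) (R + 1), ‖G x‖ ≤ M) :
    LipschitzWith (K + M.toNNReal) fun x => radialCutoff R x • G x := by
  -- One point in the larger ball is enough. If the other lies outside, its cutoff vanishes and the
  -- difference of the cutoffs alone is at most `‖x - y‖`.
  have key : ∀ x y : E, ‖y‖ ≤ R + 1 →
      ‖radialCutoff R x • G x - radialCutoff R y • G y‖ ≤ (K + M) * ‖x - y‖ := fun x y hy => by
    have hy' : y ∈ closedBall (0 : E) (R + 1) := mem_closedBall_zero_iff.2 hy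
    by_cases hx : ‖x‖ ≤ R + 1
    · have hx' : x ∈ closedBall (0 : E) (R + 1) := mem_closedBall_zero_iff.2 hx
      have h1 : radialCutoff R x • G x - radialCutoff R y • G y =
          radialCutoff R x • (G x - G y) + (radialCutoff R x - radialCutoff R y) • G y := by
        rw [smul_sub, sub_smul]; abel
      rw [h1, add_mul]
      refine (norm_add_le _ _).trans (add_le_add ?_ ?_)
      · rw [norm_smul, Real.norm_of_nonneg (radialCutoff_nonneg R x)]
        exact (mul_le_of_le_one_left (norm_nonneg _) (radialCutoff_le_one R x)).trans
          (hG.norm_sub_le hx' hy')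
      · rw [norm_smul, Real.norm_eq_abs, mul_comm]
        exact mul_le_mul (hb y hy') (abs_radialCutoff_sub_le R x y) (abs_nonneg _) hM
    · have h0 : radialCutoff R x = 0 := radialCutoff_eq_zero (not_le.1 hx).le
      have h2 := abs_radialCutoff_sub_le R x y
      rw [h0, zero_sub, abs_neg] at h2
      rw [h0, zero_smul, zero_sub, norm_neg, norm_smul, Real.norm_eq_abs, add_mul]
      have h3 := mul_le_mul h2 (hb y hy') (norm_nonneg _) (norm_nonneg _)
      have h4 : 0 ≤ (K : ℝ) * ‖x - y‖ := by positivity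
      linarith
  refine LipschitzWith.of_dist_le_mul fun x y => ?_
  rw [dist_eq_norm, dist_eq_norm, NNReal.coe_add, Real.coe_toNNReal _ hM]
  by_cases hy : ‖y‖ ≤ R + 1
  · exact key x y hy
  by_cases hx : ‖x‖ ≤ R + 1
  · rw [norm_sub_rev, norm_sub_rev x y]
    exact key y x hx
  · rw [radialCutoff_eq_zero (not_le.1 hx).le, radialCutoff_eq_zero (not_le.1 hy).le]
    simp only [zero_smul, sub_self, norm_zero]
    positivity

variable [CompleteSpace E]

/-- The truncated equation has a solution on `[-T, T]`. -/
lemma IsLocallyLipschitzField.exists_truncated {F : ℝ → E → E} (hF : IsLocallyLipschitzField F)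
    (x₀ : E) {T : ℝ} (hT : 0 < T) (R : ℝ) :
    ∃ U : ℝ → E, U 0 = x₀ ∧ ∀ t ∈ Icc (-T) T,
      HasDerivWithinAt U (radialCutoff R (U t) • F t (U t)) (Icc (-T) T) t := by
  obtain ⟨K, hK⟩ := hF.lipschitz T (|R| + 1)
  obtain ⟨A, hA⟩ := (isCompact_Icc (a := -T) (b := T)).exists_bound_of_continuousOn
    (hF.continuous 0).continuousOn
  have hA0 : 0 ≤ A := (norm_nonneg _).trans (hA 0 ⟨by linarith, hT.le⟩)
  set M : ℝ := A + K * (|R| + 1) with hMdef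
  have hM : 0 ≤ M := by positivity
  have hRR : R + 1 ≤ |R| + 1 := by linarith [le_abs_self R]
  have hbd : ∀ t ∈ Icc (-T) T, ∀ x ∈ closedBall (0 : E) (R + 1), ‖F t x‖ ≤ M := by
    intro t ht x hx
    have hx' := closedBall_subset_closedBall hRR hx
    have h0 : (0 : E) ∈ closedBall (0 : E) (|R| + 1) := mem_closedBall_self (by positivity)
    have h1 := (hK t (abs_le.2 ht)).norm_sub_le hx' h0
    rw [sub_zero] at h1
    rw [mem_closedBall_zero_iff] at hx'
    have h2 : (K : ℝ) * ‖x‖ ≤ K * (|R| + 1) := by gcongr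
    calc ‖F t x‖ = ‖(F t x - F t 0) + F t 0‖ := by rw [sub_add_cancel]
      _ ≤ _ := (norm_add_le _ _).trans (by linarith [hA t ht])
  have hlip : ∀ t ∈ Icc (-T) T, LipschitzWith (K + M.toNNReal)
      fun x => radialCutoff R x • F t x := fun t ht =>
    lipschitzWith_radialCutoff_smul hM
      ((hK t (abs_le.2 ht)).mono (closedBall_subset_closedBall hRR)) (hbd t ht)
  -- The truncated field is globally Lipschitz and bounded by `M`, so a ball of radius `M * T`
  -- confines the solution on all of `[-T, T]`; no restriction to short times is needed.
  have hPL : IsPicardLindelof (fun t x => radialCutoff R x • F t x) (tmin := -T) (tmax := T)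
      ⟨0, by linarith, hT.le⟩ x₀ (M * T).toNNReal 0 M.toNNReal (K + M.toNNReal) :=
    { lipschitzOnWith := fun t ht => (hlip t ht).lipschitzOnWith
      continuousOn := fun x _ => ((hF.continuous x).const_smul _).continuousOn
      norm_le := fun t ht x _ => by
        rw [norm_smul, Real.norm_of_nonneg (radialCutoff_nonneg R x), Real.coe_toNNReal _ hM]
        by_cases hx : ‖x‖ ≤ R + 1
        · exact (mul_le_of_le_one_left (norm_nonneg _) (radialCutoff_le_one R x)).trans
            (hbd t ht x (mem_closedBall_zero_iff.2 hx))
        · rw [radialCutoff_eq_zero (not_le.1 hx).le, zero_mul]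
          exact hM
      mul_max_le := by
        rw [Real.coe_toNNReal _ hM, Real.coe_toNNReal _ (by positivity)]
        simp }
  exact hPL.exists_eq_forall_mem_Icc_hasDerivWithinAt₀

/-- Global solutions exist if the solutions on bounded intervals satisfy an a priori bound. -/
theorem IsLocallyLipschitzField.exists_global {F : ℝ → E → E} (hF : IsLocallyLipschitzField F)
    (x₀ : E) (hap : ∀ T > 0, ∃ B : ℝ, ∀ τ ∈ Ioc 0 T, ∀ U : ℝ → E, U 0 = x₀ →
      (∀ t ∈ Ioo (-τ) τ, HasDerivAt U (F t (U t)) t) → ∀ t ∈ Ioo (-τ) τ, ‖U t‖ ≤ B) :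
    ∃ U : ℝ → E, U 0 = x₀ ∧ ∀ t, HasDerivAt U (F t (U t)) t := by
  have hloc : ∀ T > 0, ∃ U : ℝ → E, U 0 = x₀ ∧ ∀ t ∈ Ioo (-T) T, HasDerivAt U (F t (U t)) t := by
    intro T hT
    obtain ⟨B, hB⟩ := hap T hT
    -- The cutoff is inactive up to norm `R`. The summand `1` leaves a gap above the a priori bound
    -- and above the initial value.
    set R : ℝ := max B ‖x₀‖ + 1 with hR
    obtain ⟨U, hU0, hU⟩ := hF.exists_truncated x₀ hT R
    have hUc : ContinuousOn U (Icc (-T) T) := fun t ht => (hU t ht).continuousWithinAt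
    have hderiv : ∀ t ∈ Ioo (-T) T, ‖U t‖ ≤ R → HasDerivAt U (F t (U t)) t := fun t ht h => by
      have h1 := (hU t (Ioo_subset_Icc_self ht)).hasDerivAt (Icc_mem_nhds ht.1 ht.2)
      rwa [radialCutoff_eq_one h, one_smul] at h1
    -- Otherwise take a time of least modulus at which the norm reaches `R`. Before it the
    -- untruncated equation holds, so the norm is at most `B`, and by continuity this persists at
    -- that time: a contradiction with `B < R`.
    have hbd : ∀ t ∈ Icc (-T) T, ‖U t‖ < R := by
      by_contra! hcon
      set A := Icc (-T) T ∩ U ⁻¹' {x | R ≤ ‖x‖} with hAdef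
      have hAclosed : IsClosed A := hUc.preimage_isClosed_of_isClosed isClosed_Icc
        (isClosed_le continuous_const continuous_norm)
      have hAc : IsCompact A := isCompact_Icc.of_isClosed_subset hAclosed inter_subset_left
      have hAne : A.Nonempty := by
        obtain ⟨t, ht, h⟩ := hcon
        exact ⟨t, ht, h⟩
      obtain ⟨t, ⟨htT, htR⟩, hmin⟩ := hAc.exists_isMinOn hAne continuous_abs.continuousOn
      have htR' : R ≤ ‖U t‖ := htR
      have ht0 : t ≠ 0 := by
        rintro rfl
        rw [hU0] at htR'
        linarith [le_max_right B ‖x₀‖]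
      have hτ : 0 < |t| := abs_pos.2 ht0
      have hτT : |t| ≤ T := abs_le.2 htT
      have hlt : ∀ r, |r| < |t| → ‖U r‖ < R := by
        intro r hr
        by_contra! h
        have : r ∈ A := ⟨abs_le.1 (hr.le.trans hτT), h⟩
        exact absurd (hmin this) (not_le.2 hr)
      have hbound : ∀ r ∈ Ioo (-|t|) |t|, ‖U r‖ ≤ B := hB |t| ⟨hτ, hτT⟩ U hU0 fun r hr =>
        hderiv r ⟨by linarith [hr.1], by linarith [hr.2]⟩ (hlt r (abs_lt.2 hr)).le
      -- These times approach `t` from the side of `0`, whatever the sign of `t`.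
      have hseq : Filter.Tendsto (fun k : ℕ => t * (1 - 1 / ((k : ℝ) + 1))) Filter.atTop
          (nhds t) := by
        have := (tendsto_one_div_add_atTop_nhds_zero_nat (𝕜 := ℝ)).const_sub 1 |>.const_mul t
        simpa using this
      have hmem : ∀ k : ℕ, |t * (1 - 1 / ((k : ℝ) + 1))| < |t| := fun k => by
        have h1 : 0 < 1 / ((k : ℝ) + 1) := by positivity
        have h2 : 1 / ((k : ℝ) + 1) ≤ 1 := by
          rw [div_le_one (by positivity)]; linarith [Nat.cast_nonneg (α := ℝ) k]
        rw [abs_mul, abs_of_nonneg (by linarith : (0 : ℝ) ≤ 1 - 1 / ((k : ℝ) + 1))]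
        nlinarith
      have hlim : Filter.Tendsto (fun k : ℕ => ‖U (t * (1 - 1 / ((k : ℝ) + 1)))‖) Filter.atTop
          (nhds ‖U t‖) := by
        refine ((hUc t htT).tendsto.comp (tendsto_nhdsWithin_iff.2 ⟨hseq, ?_⟩)).norm
        exact Filter.Eventually.of_forall fun k => abs_le.1 ((hmem k).le.trans hτT)
      have : ‖U t‖ ≤ B := le_of_tendsto hlim
        (Filter.Eventually.of_forall fun k => hbound _ (abs_lt.1 (hmem k)))
      linarith [le_max_left B ‖x₀‖]
    exact ⟨U, hU0, fun t ht => hderiv t ht (hbd t (Ioo_subset_Icc_self ht)).le⟩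
  have hpos : ∀ k : ℕ, (0 : ℝ) < k + 1 := fun k => by positivity
  choose U hU0 hU using fun k : ℕ => hloc (k + 1) (hpos k)
  have hagree : ∀ k l : ℕ, k ≤ l → EqOn (U k) (U l) (Ioo (-((k : ℝ) + 1)) (k + 1)) := fun k l h => by
    have hkl : (k : ℝ) ≤ l := by exact_mod_cast h
    refine hF.eqOn (hU k) (fun t ht => hU l t ⟨by linarith [ht.1], by linarith [ht.2]⟩) ?_
    rw [hU0, hU0]
  -- `U k` solves the equation on `(-(k + 1), k + 1)`, so the index `⌈|t|⌉₊` leaves room around `t`.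
  -- On the overlaps the solutions agree by uniqueness.
  refine ⟨fun t => U ⌈|t|⌉₊ t, hU0 _, fun t => ?_⟩
  have hev : ∀ t : ℝ, ∀ k : ℕ, |t| < k + 1 → U ⌈|t|⌉₊ t = U k t := fun t k hk => by
    have h1 : |t| < (⌈|t|⌉₊ : ℝ) + 1 := by linarith [Nat.le_ceil |t|]
    rcases le_total ⌈|t|⌉₊ k with h | h
    · exact hagree _ _ h (abs_lt.1 h1)
    · exact (hagree _ _ h (abs_lt.1 hk)).symm
  have h1 : |t| < (⌈|t|⌉₊ : ℝ) + 1 := by linarith [Nat.le_ceil |t|]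
  refine (hU ⌈|t|⌉₊ t (abs_lt.1 h1)).congr_of_eventuallyEq ?_
  filter_upwards [(continuous_abs.isOpen_preimage _ isOpen_Iio).mem_nhds h1] with r hr
  exact hev r _ hr

end ODE

/-! ## The cubic nonlinearity -/

section Nonlinearity

open Filter Topology
open scoped ENNReal NNReal

instance : ENNReal.HolderTriple 6 6 3 where
  inv_add_inv_eq_inv := by
    rw [show (6 : ℝ≥0∞) = 2 * 3 by norm_num, ENNReal.mul_inv (by simp) (by simp), ← two_mul,
      ← mul_assoc, ENNReal.mul_inv_cancel (by simp) (by simp), one_mul]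

instance : ENNReal.HolderTriple 6 3 2 where
  inv_add_inv_eq_inv := by
    have h : (6 : ℝ≥0∞)⁻¹ + 3⁻¹ = ENNReal.ofReal (6⁻¹ + 3⁻¹) := by
      rw [ENNReal.ofReal_add (by norm_num) (by norm_num), ENNReal.ofReal_inv_of_pos (by norm_num),
        ENNReal.ofReal_inv_of_pos (by norm_num)]
      simp
    rw [h, show (6⁻¹ + 3⁻¹ : ℝ) = 2⁻¹ by norm_num, ENNReal.ofReal_inv_of_pos (by norm_num)]
    simp

/-- The product of three functions in `L⁶`, as a function in `L²`. -/
def tripleMul (a b c : Lp ℝ 6 torusMeasure) : Lp ℝ 2 torusMeasure :=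
  (ContinuousLinearMap.mul ℝ ℝ).holderL torusMeasure 6 3 2 a
    ((ContinuousLinearMap.mul ℝ ℝ).holderL torusMeasure 6 6 3 b c)

lemma coeFn_tripleMul (a b c : Lp ℝ 6 torusMeasure) :
    ∀ᵐ x ∂torusMeasure, tripleMul a b c x = a x * (b x * c x) := by
  filter_upwards [(ContinuousLinearMap.mul ℝ ℝ).coeFn_holder (r := 2) a
    ((ContinuousLinearMap.mul ℝ ℝ).holderL torusMeasure 6 6 3 b c),
    (ContinuousLinearMap.mul ℝ ℝ).coeFn_holder (r := 3) b c] with x h1 h2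
  refine h1.trans ?_
  simp only [ContinuousLinearMap.mul_apply']
  congr 1

lemma norm_tripleMul_le (a b c : Lp ℝ 6 torusMeasure) :
    ‖tripleMul a b c‖ ≤ ‖a‖ * (‖b‖ * ‖c‖) := by
  have h1 := (ContinuousLinearMap.mul ℝ ℝ).norm_holder_apply_apply_le (r := 2) a
    ((ContinuousLinearMap.mul ℝ ℝ).holder 3 b c)
  have h2 := (ContinuousLinearMap.mul ℝ ℝ).norm_holder_apply_apply_le (r := 3) b c
  have h3 : ‖ContinuousLinearMap.mul ℝ ℝ‖ = 1 := ContinuousLinearMap.opNorm_mul ℝ ℝ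
  rw [h3, one_mul] at h1 h2
  exact h1.trans (by gcongr)

lemma continuous_tripleMul {X : Type*} [TopologicalSpace X] {a b c : X → Lp ℝ 6 torusMeasure}
    (ha : Continuous a) (hb : Continuous b) (hc : Continuous c) :
    Continuous fun x => tripleMul (a x) (b x) (c x) := by
  unfold tripleMul
  fun_prop

/-- The telescoping of `g³ - h³`, one factor at a time, which gives the Lipschitz bound. -/
lemma tripleMul_sub_tripleMul (g h : Lp ℝ 6 torusMeasure) :
    tripleMul g g g - tripleMul h h h =
      tripleMul (g - h) g g + (tripleMul h (g - h) g + tripleMul h h (g - h)) := by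
  simp only [tripleMul, map_sub, sub_apply]
  abel

/-- The vector field has values in `ℓ²`; here `f` is the given function in `L⁶`. -/
def nonlinearity (f : Lp ℝ 6 torusMeasure) (z : FreqL2) : Lp ℝ 2 torusMeasure :=
  realSynthesis (smoothing z) - tripleMul (f + sobolevL6 z) (f + sobolevL6 z) (f + sobolevL6 z)

lemma norm_nonlinearity_sub_le (f : Lp ℝ 6 torusMeasure) {z z' : FreqL2} {ρ : ℝ}
    (hz : ‖f + sobolevL6 z‖ ≤ ρ) (hz' : ‖f + sobolevL6 z'‖ ≤ ρ) :
    ‖nonlinearity f z - nonlinearity f z'‖ ≤ (1 + 3 * ρ ^ 2 * ‖sobolevL6‖) * ‖z - z'‖ := by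
  have hρ : 0 ≤ ρ := (norm_nonneg _).trans hz
  set g := f + sobolevL6 z with hg
  set h := f + sobolevL6 z' with hh
  have hgh : ‖g - h‖ ≤ ‖sobolevL6‖ * ‖z - z'‖ := by
    have : g - h = sobolevL6 (z - z') := by rw [map_sub]; simp [hg, hh]
    rw [this]
    exact sobolevL6.le_opNorm _
  have e : nonlinearity f z - nonlinearity f z' =
      realSynthesis (smoothing (z - z')) - (tripleMul g g g - tripleMul h h h) := by
    rw [nonlinearity, nonlinearity, map_sub, map_sub]; abel
  rw [e, tripleMul_sub_tripleMul]
  have h1 : ‖realSynthesis (smoothing (z - z'))‖ ≤ ‖z - z'‖ :=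
    (norm_realSynthesis_le _).trans (norm_smoothing_le _)
  have h2 : ‖tripleMul (g - h) g g‖ ≤ ‖sobolevL6‖ * ‖z - z'‖ * (ρ * ρ) :=
    (norm_tripleMul_le _ _ _).trans (by gcongr)
  have h3 : ‖tripleMul h (g - h) g‖ ≤ ρ * (‖sobolevL6‖ * ‖z - z'‖ * ρ) :=
    (norm_tripleMul_le _ _ _).trans (by gcongr)
  have h4 : ‖tripleMul h h (g - h)‖ ≤ ρ * (ρ * (‖sobolevL6‖ * ‖z - z'‖)) :=
    (norm_tripleMul_le _ _ _).trans (by gcongr)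
  calc _ ≤ ‖realSynthesis (smoothing (z - z'))‖ + (‖tripleMul (g - h) g g‖ +
        (‖tripleMul h (g - h) g‖ + ‖tripleMul h h (g - h)‖)) := by
        refine (norm_sub_le _ _).trans (add_le_add le_rfl ?_)
        exact (norm_add_le _ _).trans (add_le_add le_rfl (norm_add_le _ _))
    _ ≤ _ := by nlinarith

/-- The vector field of the cubic wave equation in the interaction picture. -/
def interactionField (f : ℝ → Lp ℝ 6 torusMeasure) (t : ℝ) (U : FreqL2) : FreqL2 :=
  propagator (-t) (Complex.I • realCoeff (nonlinearity (f t) (propagator t U)))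

lemma continuous_nonlinearity {f : ℝ → Lp ℝ 6 torusMeasure} (hf : Continuous f)
    {z : ℝ → FreqL2} (hz : Continuous z) : Continuous fun t => nonlinearity (f t) (z t) := by
  unfold nonlinearity
  have h1 : Continuous fun t => f t + sobolevL6 (z t) := by fun_prop
  exact ((realSynthesis.continuous.comp (smoothing.continuous.comp hz))).sub
    (continuous_tripleMul h1 h1 h1)

lemma continuous_interactionField {f : ℝ → Lp ℝ 6 torusMeasure} (hf : Continuous f)
    {U : ℝ → FreqL2} (hU : Continuous U) : Continuous fun t => interactionField f t (U t) := by
  have h : Continuous fun t => Complex.I • realCoeff (nonlinearity (f t) (propagator t (U t))) :=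
    (realCoeff.continuous.comp
      (continuous_nonlinearity hf (continuous_propagator hU))).const_smul Complex.I
  exact continuous_propagator_neg h

/-- The propagators are isometries, so the bound for the cube in `L⁶` carries over, with a constant
that depends on the size of `f` on `[-T, T]` and on the radius. -/
lemma isLocallyLipschitzField_interactionField {f : ℝ → Lp ℝ 6 torusMeasure}
    (hf : Continuous f) : IsLocallyLipschitzField (interactionField f) where
  continuous x := continuous_interactionField hf continuous_const
  lipschitz T R := by
    obtain ⟨A, hA⟩ := (isCompact_Icc (a := -T) (b := T)).exists_bound_of_continuousOn
      hf.continuousOn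
    set ρ : ℝ := A + ‖sobolevL6‖ * R with hρ
    refine ⟨(1 + 3 * ρ ^ 2 * ‖sobolevL6‖).toNNReal, fun t ht => ?_⟩
    have hbd : ∀ x ∈ Metric.closedBall (0 : FreqL2) R, ‖f t + sobolevL6 (propagator t x)‖ ≤ ρ := by
      intro x hx
      rw [mem_closedBall_zero_iff] at hx
      refine (norm_add_le _ _).trans (add_le_add (hA t (abs_le.1 ht)) ?_)
      refine (sobolevL6.le_opNorm _).trans ?_
      rw [norm_propagator]
      gcongr
    refine LipschitzOnWith.of_dist_le_mul fun x hx y hy => ?_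
    rw [dist_eq_norm, dist_eq_norm, Real.coe_toNNReal _ (by positivity), interactionField,
      interactionField, ← map_sub, norm_propagator, ← smul_sub, norm_smul, Complex.norm_I, one_mul,
      ← map_sub, norm_realCoeff]
    refine (norm_nonlinearity_sub_le _ (hbd x hx) (hbd y hy)).trans ?_
    rw [← map_sub, norm_propagator]

end Nonlinearity

/-! ## The energy estimate -/

section Energy

open Filter Topology Set
open scoped ENNReal NNReal

/-- The orbit of `c` need not be differentiable in `ℓ²`, as the generator `-i⟨D⟩` is unbounded. The
factor `⟨D⟩⁻¹` cancels it. -/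
lemma hasDerivAt_smoothing_propagator_const (c : FreqL2) (t : ℝ) :
    HasDerivAt (fun τ => smoothing (propagator τ c)) (-(Complex.I • propagator t c)) t := by
  refine FreqL2.hasDerivAt_of_coord (d := fun t => -(Complex.I • propagator t c))
    ((continuous_propagator continuous_const).const_smul Complex.I).neg (fun n t => ?_) t
  have h1 : HasDerivAt (fun τ : ℝ => ((-(τ * bracket n) : ℝ) : ℂ) * Complex.I)
      (((-(1 * bracket n) : ℝ) : ℂ) * Complex.I) t :=
    (((hasDerivAt_id t).mul_const (bracket n)).neg.ofReal_comp).mul_const Complex.I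
  have h2 := (h1.cexp.mul_const (c n)).const_mul (((bracket n)⁻¹ : ℝ) : ℂ)
  refine h2.congr_deriv ?_
  have hb : (bracket n : ℂ) ≠ 0 := by exact_mod_cast (bracket_pos n).ne'
  simp only [lp.coeFn_neg, lp.coeFn_smul, Pi.neg_apply, Pi.smul_apply, propagator_apply,
    smul_eq_mul]
  push_cast
  field_simp

/-- Strong continuity in time and the isometry property give joint continuity. -/
lemma tendsto_propagator {ι : Type*} {l : Filter ι} {τ : ι → ℝ} {c : ι → FreqL2} {t : ℝ}
    {d : FreqL2} (hτ : Tendsto τ l (𝓝 t)) (hc : Tendsto c l (𝓝 d)) :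
    Tendsto (fun i => propagator (τ i) (c i)) l (𝓝 (propagator t d)) := by
  have h1 : Tendsto (fun i => propagator (τ i) d) l (𝓝 (propagator t d)) :=
    ((continuous_propagator (c := fun _ => d) continuous_const).tendsto t).comp hτ
  have h2 : Tendsto (fun i => propagator (τ i) (c i - d)) l (𝓝 0) := by
    rw [tendsto_zero_iff_norm_tendsto_zero]
    simp only [norm_propagator]
    simpa using (hc.sub_const d).norm
  have h3 := h1.add h2
  simpa [map_sub] using h3

/-- A product rule for a strongly continuous family: the difference quotient splits into the one of
the group at the fixed vector `U t` and the propagator at `t + h` applied to the difference quotient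
of `U`. -/
lemma hasDerivAt_smoothing_propagator {U : ℝ → FreqL2} {U' : FreqL2} {t : ℝ}
    (hU : HasDerivAt U U' t) :
    HasDerivAt (fun τ => smoothing (propagator τ (U τ)))
      (-(Complex.I • propagator t (U t)) + smoothing (propagator t U')) t := by
  rw [hasDerivAt_iff_tendsto_slope_zero] at hU ⊢
  have h1 := hasDerivAt_iff_tendsto_slope_zero.1 (hasDerivAt_smoothing_propagator_const (U t) t)
  have hτ : Tendsto (fun h : ℝ => t + h) (𝓝[≠] 0) (𝓝 t) := by
    have : Tendsto (fun h : ℝ => t + h) (𝓝 0) (𝓝 (t + 0)) := by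
      exact (continuous_const.add continuous_id).tendsto 0
    rw [add_zero] at this
    exact this.mono_left nhdsWithin_le_nhds
  have h2 := (smoothing.continuous.tendsto _).comp (tendsto_propagator hτ hU)
  refine (h1.add h2).congr fun h => ?_
  have hs : ∀ (r : ℝ) (c : FreqL2), smoothing (propagator (t + h) (r • c)) =
      r • smoothing (propagator (t + h) c) := fun r c => by
    ext n; simp
  simp only [Function.comp_apply]
  rw [hs, map_sub, map_sub, ← smul_add]
  congr 1
  abel

/-- The energy of `U` at time `t`. -/
def energy (t : ℝ) (U : FreqL2) : ℝ :=
  1 + 2⁻¹ * ‖U‖ ^ 2 + 4⁻¹ * inner ℝ (realSynthesis (smoothing (propagator t U)))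
    (tripleMul (sobolevL6 (propagator t U)) (sobolevL6 (propagator t U))
      (sobolevL6 (propagator t U)))

lemma inner_realSynthesis_tripleMul (z : FreqL2) :
    inner ℝ (realSynthesis (smoothing z))
      (tripleMul (sobolevL6 z) (sobolevL6 z) (sobolevL6 z)) =
      ∫ x, (realSynthesis (smoothing z) x) ^ 4 ∂torusMeasure := by
  rw [L2.inner_def]
  refine integral_congr_ae ?_
  filter_upwards [coeFn_tripleMul (sobolevL6 z) (sobolevL6 z) (sobolevL6 z), coeFn_sobolevL6 z]
    with x h1 h2
  rw [h1, h2]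
  simp only [RCLike.inner_apply, conj_trivial]
  ring

lemma integrable_realSynthesis_pow_four (z : FreqL2) :
    Integrable (fun x => (realSynthesis (smoothing z) x) ^ 4) torusMeasure := by
  refine (L2.integrable_inner (𝕜 := ℝ) (realSynthesis (smoothing z))
    (tripleMul (sobolevL6 z) (sobolevL6 z) (sobolevL6 z))).congr ?_
  filter_upwards [coeFn_tripleMul (sobolevL6 z) (sobolevL6 z) (sobolevL6 z), coeFn_sobolevL6 z]
    with x h1 h2
  rw [h1, h2]
  simp only [RCLike.inner_apply, conj_trivial]
  ring

lemma inner_tripleMul_nonneg (z : FreqL2) :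
    0 ≤ inner ℝ (realSynthesis (smoothing z))
      (tripleMul (sobolevL6 z) (sobolevL6 z) (sobolevL6 z)) := by
  rw [inner_realSynthesis_tripleMul]
  exact integral_nonneg fun x => by positivity

/-- Pointwise this is `a⁴ - b⁴ = (a - b)(a³ + a²b + ab² + b³)`. -/
lemma quartic_sub (z z' : FreqL2) :
    inner ℝ (realSynthesis (smoothing z)) (tripleMul (sobolevL6 z) (sobolevL6 z) (sobolevL6 z)) -
      inner ℝ (realSynthesis (smoothing z'))
        (tripleMul (sobolevL6 z') (sobolevL6 z') (sobolevL6 z')) =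
    inner ℝ (realSynthesis (smoothing z) - realSynthesis (smoothing z'))
      (tripleMul (sobolevL6 z) (sobolevL6 z) (sobolevL6 z) +
        tripleMul (sobolevL6 z) (sobolevL6 z) (sobolevL6 z') +
        tripleMul (sobolevL6 z) (sobolevL6 z') (sobolevL6 z') +
        tripleMul (sobolevL6 z') (sobolevL6 z') (sobolevL6 z')) := by
  rw [inner_realSynthesis_tripleMul, inner_realSynthesis_tripleMul, ← integral_sub
    (integrable_realSynthesis_pow_four z) (integrable_realSynthesis_pow_four z'), L2.inner_def]
  refine integral_congr_ae ?_
  set a := sobolevL6 z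
  set b := sobolevL6 z'
  filter_upwards [coeFn_tripleMul a a a, coeFn_tripleMul a a b, coeFn_tripleMul a b b,
    coeFn_tripleMul b b b, coeFn_sobolevL6 z, coeFn_sobolevL6 z',
    Lp.coeFn_sub (realSynthesis (smoothing z)) (realSynthesis (smoothing z')),
    Lp.coeFn_add (tripleMul a a a + tripleMul a a b + tripleMul a b b) (tripleMul b b b),
    Lp.coeFn_add (tripleMul a a a + tripleMul a a b) (tripleMul a b b),
    Lp.coeFn_add (tripleMul a a a) (tripleMul a a b)] with x h1 h2 h3 h4 h5 h6 h7 h8 h9 h10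
  rw [h7, h8, Pi.add_apply, h9, Pi.add_apply, h10, Pi.add_apply, h1, h2, h3, h4, Pi.sub_apply,
    h5, h6]
  simp only [RCLike.inner_apply, conj_trivial]
  ring

/-- The function `w` is differentiable in time only with values in `L²`, and merely continuous in
`L⁶`. After factorisation the difference quotient in `L²` is paired with cubic terms that converge
in `L²`, so no more is required. -/
lemma hasDerivAt_quartic {z : ℝ → FreqL2} {t : ℝ} {y' : Lp ℝ 2 torusMeasure}
    (hz : ContinuousAt z t)
    (hy : HasDerivAt (fun τ => realSynthesis (smoothing (z τ))) y' t) :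
    HasDerivAt (fun τ => inner ℝ (realSynthesis (smoothing (z τ)))
      (tripleMul (sobolevL6 (z τ)) (sobolevL6 (z τ)) (sobolevL6 (z τ))))
      (4 * inner ℝ y' (tripleMul (sobolevL6 (z t)) (sobolevL6 (z t)) (sobolevL6 (z t)))) t := by
  rw [hasDerivAt_iff_tendsto_slope_zero] at hy ⊢
  have hτ : Tendsto (fun h : ℝ => t + h) (𝓝[≠] 0) (𝓝 t) := by
    have : Tendsto (fun h : ℝ => t + h) (𝓝 0) (𝓝 (t + 0)) := by
      exact (continuous_const.add continuous_id).tendsto 0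
    rw [add_zero] at this
    exact this.mono_left nhdsWithin_le_nhds
  have hs : Tendsto (fun h : ℝ => sobolevL6 (z (t + h))) (𝓝[≠] 0) (𝓝 (sobolevL6 (z t))) :=
    (sobolevL6.continuous.tendsto _).comp (Tendsto.comp hz hτ)
  set b := sobolevL6 (z t) with hb
  have hq : Continuous fun a : Lp ℝ 6 torusMeasure =>
      tripleMul a a a + tripleMul a a b + tripleMul a b b + tripleMul b b b :=
    (((continuous_tripleMul continuous_id continuous_id continuous_id).add
      (continuous_tripleMul continuous_id continuous_id continuous_const)).add
      (continuous_tripleMul continuous_id continuous_const continuous_const)).add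
      continuous_const
  have h1 := hy.inner (𝕜 := ℝ) ((hq.tendsto _).comp hs)
  have e : inner ℝ y' (tripleMul b b b + tripleMul b b b + tripleMul b b b + tripleMul b b b) =
      4 * inner ℝ y' (tripleMul b b b) := by
    simp only [inner_add_right]; ring
  rw [e] at h1
  refine h1.congr fun h => ?_
  simp only [Function.comp_apply]
  rw [quartic_sub, real_inner_smul_left, smul_eq_mul]

/-- This is the identity `∂ₜw = Im z`: the nonlinear term `i⟨D⟩⁻¹N` is purely imaginary and drops
out of the real part. -/
lemma realSynthesis_deriv (f : Lp ℝ 6 torusMeasure) (t : ℝ) (U : FreqL2) :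
    realSynthesis (-(Complex.I • propagator t U) + smoothing (propagator t (propagator (-t)
      (Complex.I • realCoeff (nonlinearity f (propagator t U)))))) =
      imL2 (synthesis (propagator t U)) := by
  rw [propagator_propagator_neg, map_add, map_smul, realSynthesis_I_smul_smoothing_realCoeff,
    add_zero, realSynthesis_I_smul]

/-- Half the derivative of `‖U‖²` is `⟨∂ₜw, N⟩` with `N = w - (f + w)³`, since the group is unitary,
and the quartic part contributes `⟨∂ₜw, w³⟩`. For `f = 0` only the lower-order term `⟨∂ₜw, w⟩` would
remain. -/
lemma hasDerivAt_energy {f : ℝ → Lp ℝ 6 torusMeasure} {U : ℝ → FreqL2} {t : ℝ}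
    (hU : HasDerivAt U (interactionField f t (U t)) t) :
    HasDerivAt (fun τ => energy τ (U τ)) (inner ℝ (imL2 (synthesis (propagator t (U t))))
      (nonlinearity (f t) (propagator t (U t)) + tripleMul (sobolevL6 (propagator t (U t)))
        (sobolevL6 (propagator t (U t))) (sobolevL6 (propagator t (U t))))) t := by
  have h1 : HasDerivAt (fun τ => ‖U τ‖ ^ 2)
      (2 * inner ℝ (imL2 (synthesis (propagator t (U t))))
        (nonlinearity (f t) (propagator t (U t)))) t := by
    have h2 := hU.inner ℂ hU
    have h3 := Complex.reCLM.hasFDerivAt.comp_hasDerivAt t h2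
    have e1 : (Complex.reCLM ∘ fun τ => inner ℂ (U τ) (U τ)) = fun τ => ‖U τ‖ ^ 2 := by
      funext τ
      simp [Function.comp_apply, inner_self_eq_norm_sq_to_K, ← Complex.ofReal_pow]
    rw [e1] at h3
    refine h3.congr_deriv ?_
    rw [← re_inner_I_smul_realCoeff, interactionField, inner_propagator, map_add,
      ← inner_conj_symm (propagator (-t) _) (U t), inner_propagator]
    simp only [Complex.reCLM_apply, Complex.conj_re]
    ring
  have h4 : HasDerivAt (fun τ => realSynthesis (smoothing (propagator τ (U τ))))
      (imL2 (synthesis (propagator t (U t)))) t := by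
    have := realSynthesis.hasFDerivAt.comp_hasDerivAt t (hasDerivAt_smoothing_propagator hU)
    rw [interactionField, realSynthesis_deriv] at this
    exact this
  have h5 : ContinuousAt (fun τ => propagator τ (U τ)) t :=
    tendsto_propagator tendsto_id hU.continuousAt
  have h6 := hasDerivAt_quartic h5 h4
  have h7 := ((h1.const_mul 2⁻¹).const_add 1).add (h6.const_mul 4⁻¹)
  refine h7.congr_deriv ?_
  rw [inner_add_right]
  ring

lemma norm_sq_eq_integral (g : Lp ℝ 2 torusMeasure) : ‖g‖ ^ 2 = ∫ x, g x ^ 2 ∂torusMeasure := by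
  rw [← real_inner_self_eq_norm_sq, L2.inner_def]
  refine integral_congr_ae (Eventually.of_forall fun x => ?_)
  simp only [RCLike.inner_apply, conj_trivial]
  ring

/-- The part of the nonlinearity that is not conservative grows at most quadratically. -/
lemma norm_nonlinearity_add_tripleMul_sq_le {f : Lp ℝ 6 torusMeasure} {M : ℝ}
    (hM : ∀ᵐ x ∂torusMeasure, |f x| ≤ M) (z : FreqL2) :
    ‖nonlinearity f z + tripleMul (sobolevL6 z) (sobolevL6 z) (sobolevL6 z)‖ ^ 2 ≤
      4 * ((1 + 9 * M ^ 4) * ‖realSynthesis (smoothing z)‖ ^ 2 + 9 * M ^ 2 *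
        inner ℝ (realSynthesis (smoothing z))
          (tripleMul (sobolevL6 z) (sobolevL6 z) (sobolevL6 z)) + M ^ 6) := by
  set y := realSynthesis (smoothing z) with hy
  set w := sobolevL6 z with hw
  have hy2 : Integrable (fun x => y x ^ 2) torusMeasure := (Lp.memLp y).integrable_sq
  have hy4 := integrable_realSynthesis_pow_four z
  rw [inner_realSynthesis_tripleMul, norm_sq_eq_integral, norm_sq_eq_integral,
    ← integral_const_mul, ← integral_const_mul]
  have hc : M ^ 6 = ∫ _, M ^ 6 ∂torusMeasure := by simp
  have hI : Integrable (fun x => (1 + 9 * M ^ 4) * y x ^ 2 + 9 * M ^ 2 * y x ^ 4) torusMeasure :=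
    (hy2.const_mul _).add (hy4.const_mul _)
  rw [hc, ← integral_add (hy2.const_mul _) (hy4.const_mul _), ← integral_add hI
    (integrable_const _), ← integral_const_mul]
  refine integral_mono_ae (Lp.memLp _).integrable_sq
    ((hI.add (integrable_const _)).const_mul _) ?_
  filter_upwards [hM, coeFn_tripleMul w w w, coeFn_tripleMul (f + w) (f + w) (f + w),
    coeFn_sobolevL6 z, Lp.coeFn_add f w, Lp.coeFn_add (nonlinearity f z) (tripleMul w w w),
    Lp.coeFn_sub y (tripleMul (f + w) (f + w) (f + w))] with x h1 h2 h3 h4 h5 h6 h7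
  have h8 : nonlinearity f z x = y x - (f x + y x) ^ 3 := by
    rw [nonlinearity, h7, Pi.sub_apply, h3, h5, Pi.add_apply, h4]
    ring
  rw [h6, Pi.add_apply, h8, h2, h4]
  change (y x - (f x + y x) ^ 3 + y x * (y x * y x)) ^ 2 ≤
    4 * ((1 + 9 * M ^ 4) * y x ^ 2 + 9 * M ^ 2 * y x ^ 4 + M ^ 6)
  set a := f x
  set b := y x
  have ha2 : a ^ 2 ≤ M ^ 2 := sq_le_sq' (abs_le.1 h1).1 (abs_le.1 h1).2
  have ha4 : a ^ 4 ≤ M ^ 4 := by nlinarith [sq_nonneg a, sq_nonneg M]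
  have ha6 : a ^ 6 ≤ M ^ 6 := by
    have := pow_le_pow_left₀ (sq_nonneg a) ha2 3
    nlinarith
  -- The cubes of `w` cancel. Of the remaining terms the largest is `3fw²`, and its square is
  -- bounded by `9M²w⁴`, which the quartic part of the energy controls.
  have e : b - (a + b) ^ 3 + b * (b * b) = b - 3 * a * b ^ 2 - 3 * a ^ 2 * b - a ^ 3 := by ring
  have hfour : ∀ p q r s : ℝ, (p - q - r - s) ^ 2 ≤ 4 * (p ^ 2 + q ^ 2 + r ^ 2 + s ^ 2) := by
    intro p q r s
    nlinarith [sq_nonneg (p + q), sq_nonneg (p + r), sq_nonneg (p + s), sq_nonneg (q - r),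
      sq_nonneg (q - s), sq_nonneg (r - s)]
  rw [e]
  refine (hfour _ _ _ _).trans ?_
  have i1 : 9 * a ^ 2 * b ^ 4 ≤ 9 * M ^ 2 * b ^ 4 := by gcongr
  have i2 : 9 * a ^ 4 * b ^ 2 ≤ 9 * M ^ 4 * b ^ 2 := by gcongr
  nlinarith

/-- The constant in the differential inequality for the energy. -/
def energyConst (M : ℝ) : ℝ := 1 + 2 * (2 * (1 + 9 * M ^ 4) + 36 * M ^ 2 + M ^ 6)

/-- The summand `1` in the energy serves to absorb the constant `M ^ 6` of the estimate for the
nonlinearity. -/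
lemma one_le_energy (t : ℝ) (U : FreqL2) : 1 ≤ energy t U := by
  have := inner_tripleMul_nonneg (propagator t U)
  have h : 0 ≤ ‖U‖ ^ 2 := by positivity
  rw [energy]
  linarith

lemma norm_sq_le_energy (t : ℝ) (U : FreqL2) : ‖U‖ ^ 2 ≤ 2 * energy t U := by
  have := inner_tripleMul_nonneg (propagator t U)
  rw [energy]
  linarith

lemma abs_deriv_energy_le {f : Lp ℝ 6 torusMeasure} {M : ℝ}
    (hM : ∀ᵐ x ∂torusMeasure, |f x| ≤ M) (t : ℝ) (U : FreqL2) :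
    |inner ℝ (imL2 (synthesis (propagator t U)))
      (nonlinearity f (propagator t U) + tripleMul (sobolevL6 (propagator t U))
        (sobolevL6 (propagator t U)) (sobolevL6 (propagator t U)))| ≤
      energyConst M * energy t U := by
  set z := propagator t U with hz
  have h1 := abs_real_inner_le_norm (imL2 (synthesis z))
    (nonlinearity f z + tripleMul (sobolevL6 z) (sobolevL6 z) (sobolevL6 z))
  have h2 := norm_nonlinearity_add_tripleMul_sq_le hM z
  have h3 : ‖imL2 (synthesis z)‖ ≤ ‖U‖ := by
    refine (norm_imL2_le _).trans ?_
    rw [LinearIsometryEquiv.norm_map, hz, norm_propagator]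
  have h4 : ‖realSynthesis (smoothing z)‖ ≤ ‖U‖ := by
    refine (norm_realSynthesis_le _).trans ((norm_smoothing_le _).trans ?_)
    rw [hz, norm_propagator]
  have h5 := norm_sq_le_energy t U
  have h6 : inner ℝ (realSynthesis (smoothing z))
      (tripleMul (sobolevL6 z) (sobolevL6 z) (sobolevL6 z)) ≤ 4 * energy t U := by
    have h : 0 ≤ ‖U‖ ^ 2 := by positivity
    rw [energy, ← hz]
    linarith
  have h7 := one_le_energy t U
  have h8 : ‖imL2 (synthesis z)‖ ^ 2 ≤ 2 * energy t U :=
    (pow_le_pow_left₀ (norm_nonneg _) h3 2).trans h5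
  have h9 : ‖realSynthesis (smoothing z)‖ ^ 2 ≤ 2 * energy t U :=
    (pow_le_pow_left₀ (norm_nonneg _) h4 2).trans h5
  set D := ‖nonlinearity f z + tripleMul (sobolevL6 z) (sobolevL6 z) (sobolevL6 z)‖
  have h10 : D ^ 2 ≤ 4 * ((1 + 9 * M ^ 4) * (2 * energy t U) + 9 * M ^ 2 * (4 * energy t U) +
      M ^ 6 * energy t U) := by
    refine h2.trans ?_
    have h11 : M ^ 6 ≤ M ^ 6 * energy t U := le_mul_of_one_le_right (by positivity) h7
    gcongr
  refine h1.trans ?_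
  rw [energyConst]
  -- By `2ab ≤ a² + b²`, half the sum of the bounds `h8` and `h10` is `energyConst M` times the
  -- energy.
  nlinarith [sq_nonneg (‖imL2 (synthesis z)‖ - D)]

/-- Grönwall's inequality forward in time; reflection in time gives the backward direction. -/
lemma le_mul_exp_of_abs_deriv_le {e e' : ℝ → ℝ} {τ C : ℝ}
    (he : ∀ t ∈ Ioo (-τ) τ, HasDerivAt e (e' t) t) (hpos : ∀ t, 0 ≤ e t)
    (hbd : ∀ t ∈ Ioo (-τ) τ, |e' t| ≤ C * e t) {t : ℝ} (ht : t ∈ Ioo (-τ) τ) :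
    e t ≤ e 0 * Real.exp (C * |t|) := by
  have key : ∀ (g g' : ℝ → ℝ), (∀ t ∈ Ioo (-τ) τ, HasDerivAt g (g' t) t) → (∀ t, 0 ≤ g t) →
      (∀ t ∈ Ioo (-τ) τ, |g' t| ≤ C * g t) → ∀ t ∈ Ioo (-τ) τ, 0 ≤ t →
      g t ≤ g 0 * Real.exp (C * t) := by
    intro g g' hg hg0 hb t ht h0
    have hsub : Icc 0 t ⊆ Ioo (-τ) τ := fun r hr => ⟨by linarith [hr.1, ht.2], by linarith [hr.2, ht.2]⟩
    have := norm_le_gronwallBound_of_norm_deriv_right_le (f := g) (f' := g') (δ := g 0) (K := C)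
      (ε := 0) (a := 0) (b := t) (fun r hr => (hg r (hsub hr)).continuousAt.continuousWithinAt)
      (fun r hr => (hg r (hsub (Ico_subset_Icc_self hr))).hasDerivWithinAt)
      (Real.norm_of_nonneg (hg0 0)).le (fun r hr => by
        rw [Real.norm_of_nonneg (hg0 r), add_zero]
        exact hb r (hsub (Ico_subset_Icc_self hr))) t ⟨h0, le_rfl⟩
    rwa [gronwallBound_ε0, sub_zero, Real.norm_of_nonneg (hg0 t)] at this
  rcases le_total 0 t with h | h
  · rw [abs_of_nonneg h]
    exact key e e' he hpos hbd t ht h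
  · rw [abs_of_nonpos h]
    have hmem : ∀ r ∈ Ioo (-τ) τ, -r ∈ Ioo (-τ) τ := fun r hr =>
      ⟨by linarith [hr.2], by linarith [hr.1]⟩
    have := key (fun r => e (-r)) (fun r => -e' (-r)) (fun r hr => by
      have h := (he (-r) (hmem r hr)).scomp r (hasDerivAt_neg r)
      rw [neg_smul, one_smul] at h
      exact h) (fun r => hpos _)
      (fun r hr => by rw [abs_neg]; exact hbd _ (hmem r hr)) (-t) (hmem t ht) (by linarith)
    simpa using this

/-- The cubic wave equation with a bounded perturbation is globally well-posed in the energy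
space. -/
theorem exists_global_interaction {f : ℝ → Lp ℝ 6 torusMeasure} (hf : Continuous f)
    (hM : ∀ T : ℝ, ∃ M : ℝ, ∀ t, |t| ≤ T → ∀ᵐ x ∂torusMeasure, |f t x| ≤ M) (U₀ : FreqL2) :
    ∃ U : ℝ → FreqL2, U 0 = U₀ ∧ ∀ t, HasDerivAt U (interactionField f t (U t)) t := by
  refine (isLocallyLipschitzField_interactionField hf).exists_global U₀ fun T hT => ?_
  obtain ⟨M, hM⟩ := hM T
  have hC : 0 ≤ energyConst M := by
    rw [energyConst]
    have : 0 ≤ M ^ 4 := by positivity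
    have : 0 ≤ M ^ 6 := by positivity
    positivity
  -- The bound on `U` comes from `‖U‖² ≤ 2 * energy` and the exponential growth of the energy up to
  -- time `T`.
  refine ⟨Real.sqrt (2 * (energy 0 U₀ * Real.exp (energyConst M * T))),
    fun τ hτ U hU0 hU t ht => ?_⟩
  have hτT : ∀ r ∈ Ioo (-τ) τ, |r| ≤ T := fun r hr => (abs_lt.2 hr).le.trans hτ.2
  have h1 := le_mul_exp_of_abs_deriv_le (e := fun r => energy r (U r)) (C := energyConst M)
    (fun r hr => hasDerivAt_energy (hU r hr))
    (fun r => zero_le_one.trans (one_le_energy r (U r)))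
    (fun r hr => abs_deriv_energy_le (hM r (hτT r hr)) r (U r)) ht
  refine Real.le_sqrt_of_sq_le ((norm_sq_le_energy t (U t)).trans ?_)
  gcongr
  refine h1.trans ?_
  rw [hU0]
  have := zero_le_one.trans (one_le_energy 0 U₀)
  gcongr
  exact hτT t ht

end Energy

/-! ## Time slices of continuous functions -/

section Slices

open Filter Topology Set
open scoped ENNReal NNReal

variable {f : ℝ × (Fin 3 → ℝ) → ℝ}

/-- The closure of the fundamental cube. -/
def closedCube : Set (Fin 3 → ℝ) := Icc 0 fun _ => 2 * Real.pi

lemma cube_subset_closedCube : cube ⊆ closedCube := fun _ hx =>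
  ⟨fun i => (hx i (mem_univ i)).1, fun i => (hx i (mem_univ i)).2.le⟩

lemma isCompact_closedCube : IsCompact closedCube := isCompact_Icc

lemma ae_mem_cube : ∀ᵐ x ∂torusMeasure, x ∈ cube :=
  ae_torusMeasure_iff.2 (ae_restrict_mem measurableSet_cube)

lemma exists_bound_on_strip {E : Type*} [NormedAddCommGroup E] {f : ℝ × (Fin 3 → ℝ) → E}
    (hf : Continuous f) (T : ℝ) :
    ∃ M : ℝ, ∀ t, |t| ≤ T → ∀ x ∈ closedCube, ‖f (t, x)‖ ≤ M := by
  obtain ⟨M, hM⟩ := (isCompact_Icc.prod isCompact_closedCube).exists_bound_of_continuousOn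
    (s := Icc (-T) T ×ˢ closedCube) hf.continuousOn
  exact ⟨M, fun t ht x hx => hM (t, x) ⟨abs_le.1 ht, hx⟩⟩

lemma continuous_slice {E : Type*} [TopologicalSpace E] {f : ℝ × (Fin 3 → ℝ) → E}
    (hf : Continuous f) (t : ℝ) : Continuous fun x => f (t, x) :=
  hf.comp (continuous_const.prodMk continuous_id)

lemma memLp_of_continuous {E : Type*} [NormedAddCommGroup E] [SecondCountableTopology E]
    {g : (Fin 3 → ℝ) → E} (hg : Continuous g) (p : ℝ≥0∞) : MemLp g p torusMeasure := by
  obtain ⟨M, hM⟩ := isCompact_closedCube.exists_bound_of_continuousOn hg.continuousOn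
  refine (memLp_top_of_bound hg.aestronglyMeasurable M ?_).mono_exponent le_top
  filter_upwards [ae_mem_cube] with x hx
  exact hM x (cube_subset_closedCube hx)

/-- The function `f(t, ·)` as an element of `L⁶`. -/
def sliceL6 (hf : Continuous f) (t : ℝ) : Lp ℝ 6 torusMeasure :=
  (memLp_of_continuous (continuous_slice hf t) 6).toLp _

lemma coeFn_sliceL6 (hf : Continuous f) (t : ℝ) :
    ∀ᵐ x ∂torusMeasure, sliceL6 hf t x = f (t, x) :=
  (memLp_of_continuous (continuous_slice hf t) 6).coeFn_toLp

lemma exists_bound_sliceL6 (hf : Continuous f) (T : ℝ) :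
    ∃ M : ℝ, ∀ t, |t| ≤ T → ∀ᵐ x ∂torusMeasure, |sliceL6 hf t x| ≤ M := by
  obtain ⟨M, hM⟩ := exists_bound_on_strip hf T
  refine ⟨M, fun t ht => ?_⟩
  filter_upwards [coeFn_sliceL6 hf t, ae_mem_cube] with x h1 h2
  rw [h1]
  exact hM t ht x (cube_subset_closedCube h2)

/-- Uniform continuity on a compact slab makes nearby slices uniformly close; as `torusMeasure` has
mass one, the sup norm dominates the `L⁶` norm. -/
lemma continuous_sliceL6 (hf : Continuous f) : Continuous (sliceL6 hf) := by
  rw [Metric.continuous_iff]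
  intro t₀ ε hε
  have huc : UniformContinuousOn f (Icc (t₀ - 1) (t₀ + 1) ×ˢ closedCube) :=
    (isCompact_Icc.prod isCompact_closedCube).uniformContinuousOn_of_continuous hf.continuousOn
  rw [Metric.uniformContinuousOn_iff] at huc
  obtain ⟨δ, hδ, h⟩ := huc (ε / 2) (by positivity)
  refine ⟨min δ 1, by positivity, fun t ht => ?_⟩
  rw [Real.dist_eq, lt_min_iff] at ht
  have ht1 := abs_lt.1 ht.2
  rw [dist_eq_norm]
  have hb : ∀ᵐ x ∂torusMeasure, ‖(sliceL6 hf t - sliceL6 hf t₀) x‖ ≤ ε / 2 := by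
    filter_upwards [Lp.coeFn_sub (sliceL6 hf t) (sliceL6 hf t₀), coeFn_sliceL6 hf t,
      coeFn_sliceL6 hf t₀, ae_mem_cube] with x h1 h2 h3 h4
    rw [h1, Pi.sub_apply, h2, h3, ← dist_eq_norm]
    have h4' := cube_subset_closedCube h4
    refine (h (t, x) ⟨⟨by linarith, by linarith⟩, h4'⟩ (t₀, x)
      ⟨⟨by linarith, by linarith⟩, h4'⟩ ?_).le
    rw [Prod.dist_eq, dist_self, max_eq_left dist_nonneg]
    exact ht.1
  have h5 := Lp.norm_le_of_ae_bound (by positivity) hb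
  have h6 : measureUnivNNReal torusMeasure = 1 := by simp [measureUnivNNReal]
  simp only [h6, NNReal.coe_one, Real.one_rpow, one_mul] at h5
  linarith

end Slices

/-! ## The energy space in terms of Fourier coefficients -/

section Encoding

open Filter Topology Set

lemma Hs.isometry_toLp (s : ℝ) : Isometry (Hs.toLp s) :=
  AddMonoidHomClass.isometry_of_norm _ fun _ => rfl

lemma Hs.continuous_iff {s : ℝ} {X : Type*} [TopologicalSpace X] {y : X → Hs s} :
    Continuous y ↔ Continuous fun x => Hs.toLp s (y x) :=
  (Hs.isometry_toLp s).isEmbedding.continuous_iff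

lemma Hs.hasDerivAt_of_toLp {s : ℝ} {y : ℝ → Hs s} {d : Hs s} {t : ℝ}
    (h : HasDerivAt (fun τ => Hs.toLp s (y τ)) (Hs.toLp s d) t) : HasDerivAt y d t := by
  rw [hasDerivAt_iff_tendsto_slope_zero] at h ⊢
  rw [(Hs.isometry_toLp s).isEmbedding.tendsto_nhds_iff]
  refine h.congr fun r => ?_
  simp only [Function.comp_apply, map_smul, map_sub]

lemma Hs.hasDerivAt_of_coeff {s : ℝ} {y d : ℝ → Hs s} (hd : Continuous d)
    (h : ∀ n t, HasDerivAt (fun τ => (y τ).coeff n) ((d t).coeff n) t) (t : ℝ) :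
    HasDerivAt y (d t) t := by
  refine Hs.hasDerivAt_of_toLp ?_
  exact FreqL2.hasDerivAt_of_coord (d := fun t => Hs.toLp s (d t)) (Hs.continuous_iff.1 hd)
    (fun n t => (h n t).const_mul _) t

lemma Hs.hasDerivAt_coeff {s : ℝ} {y : ℝ → Hs s} {d : Hs s} {t : ℝ} (h : HasDerivAt y d t)
    (n : Freq) : HasDerivAt (fun τ => (y τ).coeff n) (d.coeff n) t := by
  have h1 : HasDerivAt (fun τ => Hs.toLp s (y τ)) (Hs.toLp s d) t := by
    have := (LinearMap.mkContinuous (Hs.toLp s) 1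
      fun f => by rw [one_mul]; exact le_rfl).hasFDerivAt.comp_hasDerivAt t h
    exact this
  have h2 := (coordCLM n).hasFDerivAt.comp_hasDerivAt t h1
  have hb : ((bracket n ^ s : ℝ) : ℂ) ≠ 0 :=
    Complex.ofReal_ne_zero.2 (Real.rpow_pos_of_pos (bracket_pos n) s).ne'
  have h3 := h2.const_mul ((bracket n ^ s : ℝ) : ℂ)⁻¹
  refine (h3.congr_deriv ?_).congr_of_eventuallyEq (Eventually.of_forall fun τ => ?_)
  · simp only [coordCLM_apply, Hs.toLp_apply]
    field_simp
  · simp only [Function.comp_apply, coordCLM_apply, Hs.toLp_apply]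
    field_simp

lemma Hs.continuous_coeff {s : ℝ} {X : Type*} [TopologicalSpace X] {y : X → Hs s}
    (hy : Continuous y) (n : Freq) : Continuous fun x => (y x).coeff n := by
  have h := ((coordCLM n).continuous.comp (Hs.continuous_iff.1 hy)).const_smul
    (((bracket n ^ s : ℝ) : ℂ)⁻¹)
  have hb : ((bracket n ^ s : ℝ) : ℂ) ≠ 0 :=
    Complex.ofReal_ne_zero.2 (Real.rpow_pos_of_pos (bracket_pos n) s).ne'
  refine h.congr fun x => ?_
  simp only [Pi.smul_apply, Function.comp_apply, coordCLM_apply, Hs.toLp_apply, smul_eq_mul]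
  field_simp

/-- The element `⟨D⟩ w₀ + i w₁` of `ℓ²`, for `(w₀, w₁) ∈ H¹ × L²`. -/
def encode (h : Hs 1 × Hs 0) : FreqL2 := Hs.toLp 1 h.1 + Complex.I • Hs.toLp 0 h.2

lemma encode_apply (h : Hs 1 × Hs 0) (n : Freq) :
    encode h n = bracket n * h.1.coeff n + Complex.I * h.2.coeff n := by
  rw [encode, lp.coeFn_add, Pi.add_apply, lp.coeFn_smul, Pi.smul_apply, Hs.toLp_apply,
    Hs.toLp_apply, Real.rpow_one, Real.rpow_zero, Complex.ofReal_one, one_mul, smul_eq_mul]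

lemma continuous_encode : Continuous encode := by
  unfold encode
  exact ((Hs.isometry_toLp 1).continuous.comp continuous_fst).add
    (((Hs.isometry_toLp 0).continuous.comp continuous_snd).const_smul Complex.I)

/-- The inverse of `encode`. -/
def decode (z : FreqL2) : Hs 1 × Hs 0 :=
  (Hs.mk (fun n => ((bracket n)⁻¹ : ℝ) * realCoeff (realSynthesis z) n) <| by
    refine ⟨fun n => by simp [bracket_neg, realCoeff_neg], ?_⟩
    refine (realCoeff (realSynthesis z)).summable_sq.congr fun n => ?_
    have := (bracket_pos n).ne'
    rw [norm_mul, Complex.norm_real, Real.norm_of_nonneg (inv_nonneg.2 (bracket_pos n).le),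
      mul_one, Real.rpow_two]
    field_simp,
  Hs.mk (fun n => realCoeff (realSynthesis (-(Complex.I • z))) n) <| by
    refine ⟨realCoeff_neg _, ?_⟩
    refine (realCoeff (realSynthesis (-(Complex.I • z)))).summable_sq.congr fun n => ?_
    simp)

lemma decode_fst_coeff (z : FreqL2) (n : Freq) :
    (decode z).1.coeff n = ((bracket n)⁻¹ : ℝ) * realCoeff (realSynthesis z) n := rfl

lemma decode_snd_coeff (z : FreqL2) (n : Freq) :
    (decode z).2.coeff n = realCoeff (realSynthesis (-(Complex.I • z))) n := rfl

/-- Real even multipliers commute with taking the real part. -/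
lemma decode_fst_coeff_eq (z : FreqL2) (n : Freq) :
    (decode z).1.coeff n = realCoeff (realSynthesis (smoothing z)) n := by
  rw [decode_fst_coeff, realCoeff_realSynthesis, realCoeff_realSynthesis]
  simp only [smoothing_apply, map_mul, Complex.conj_ofReal, bracket_neg]
  ring

lemma encode_decode (z : FreqL2) : encode (decode z) = z := by
  ext n
  have hb : (bracket n : ℂ) ≠ 0 := by exact_mod_cast (bracket_pos n).ne'
  rw [encode_apply, decode_fst_coeff, decode_snd_coeff, realCoeff_realSynthesis,
    realCoeff_realSynthesis]
  simp only [lp.coeFn_neg, lp.coeFn_smul, Pi.neg_apply, Pi.smul_apply, smul_eq_mul, map_neg,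
    map_mul, Complex.conj_I]
  push_cast
  field_simp
  linear_combination (-z n + (starRingEnd ℂ) (z (-n))) * Complex.I_sq

/-- The real part of `⟨D⟩⁻¹(⟨D⟩w₀ + iw₁)` is `w₀`, because `⟨D⟩⁻¹w₁` is real. -/
lemma realSynthesis_smoothing_encode (h : Hs 1 × Hs 0) (n : Freq) :
    realCoeff (realSynthesis (smoothing (encode h))) n = h.1.coeff n := by
  have hb : (bracket n : ℂ) ≠ 0 := by exact_mod_cast (bracket_pos n).ne'
  rw [realCoeff_realSynthesis]
  simp only [smoothing_apply, encode_apply, bracket_neg, h.1.inSobolev.1 n, h.2.inSobolev.1 n,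
    map_mul, map_add, Complex.conj_ofReal, Complex.conj_I, Complex.conj_conj]
  push_cast
  field_simp
  ring

lemma encode_injective : Function.Injective encode := by
  intro h h' e
  have h1 : h.1 = h'.1 := by
    ext n
    rw [← realSynthesis_smoothing_encode, ← realSynthesis_smoothing_encode, e]
  refine Prod.ext h1 (Hs.ext fun n => ?_)
  have h2 : encode h n = encode h' n := by rw [e]
  rw [encode_apply, encode_apply, h1] at h2
  exact mul_left_cancel₀ Complex.I_ne_zero (add_left_cancel h2)

lemma decode_encode (h : Hs 1 × Hs 0) : decode (encode h) = h :=
  encode_injective (encode_decode _)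

lemma continuous_decode : Continuous decode := by
  refine Continuous.prodMk (Hs.continuous_iff.2 ?_) (Hs.continuous_iff.2 ?_)
  · have h : Continuous fun z : FreqL2 => realCoeff (realSynthesis z) :=
      realCoeff.continuous.comp realSynthesis.continuous
    refine h.congr fun z => ?_
    ext n
    have hb : (bracket n : ℂ) ≠ 0 := by exact_mod_cast (bracket_pos n).ne'
    rw [Hs.toLp_apply]
    change _ = _ * (decode z).1.coeff n
    rw [decode_fst_coeff, Real.rpow_one]
    push_cast
    field_simp
  · have h : Continuous fun z : FreqL2 => realCoeff (realSynthesis (-(Complex.I • z))) :=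
      realCoeff.continuous.comp (realSynthesis.continuous.comp
        (continuous_neg.comp (continuous_const_smul Complex.I)))
    refine h.congr fun z => ?_
    ext n
    rw [Hs.toLp_apply]
    change _ = _ * (decode z).2.coeff n
    rw [decode_snd_coeff]
    simp

end Encoding

/-! ## The perturbed cubic wave equation in the energy space -/

section Perturbation

open Filter Topology Set

variable {f : ℝ × (Fin 3 → ℝ) → ℝ}

/-- The cube of `f(t) + w`, as a function in `L²`, for `(w, ∂ₜw) = h`. -/
def cubicTerm (hf : Continuous f) (t : ℝ) (h : Hs 1 × Hs 0) : Lp ℝ 2 torusMeasure :=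
  tripleMul (sliceL6 hf t + sobolevL6 (encode h)) (sliceL6 hf t + sobolevL6 (encode h))
    (sliceL6 hf t + sobolevL6 (encode h))

lemma continuous_cubicTerm (hf : Continuous f) {W : ℝ → Hs 1 × Hs 0} (hW : Continuous W) :
    Continuous fun t => cubicTerm hf t (W t) := by
  have h : Continuous fun t => sliceL6 hf t + sobolevL6 (encode (W t)) :=
    (continuous_sliceL6 hf).add (sobolevL6.continuous.comp (continuous_encode.comp hW))
  exact continuous_tripleMul h h h

/-- `W = (w, ∂ₜw)` is a continuous curve in `H¹ × L²`, and `(∂ₜ² - Δ)w + (f + w)³ = 0` on the level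
of Fourier coefficients. -/
structure SolvesPerturbed (hf : Continuous f) (W : ℝ → Hs 1 × Hs 0) : Prop where
  continuous : Continuous W
  deriv_fst : ∀ t n, HasDerivAt (fun τ => (W τ).1.coeff n) ((W t).2.coeff n) t
  deriv_snd : ∀ t n, HasDerivAt (fun τ => (W τ).2.coeff n)
    (-(lenSq n : ℂ) * (W t).1.coeff n - realCoeff (cubicTerm hf t (W t)) n) t

lemma realCoeff_nonlinearity_encode (hf : Continuous f) (t : ℝ) (h : Hs 1 × Hs 0) (n : Freq) :
    realCoeff (nonlinearity (sliceL6 hf t) (encode h)) n =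
      h.1.coeff n - realCoeff (cubicTerm hf t h) n := by
  rw [nonlinearity, map_sub, lp.coeFn_sub, Pi.sub_apply, realSynthesis_smoothing_encode, cubicTerm]

lemma ofReal_bracket_sq (n : Freq) : (bracket n : ℂ) ^ 2 = 1 + lenSq n := by
  exact_mod_cast congrArg (fun r : ℝ => (r : ℂ)) (bracket_sq n)

/-- As `⟨D⟩² = 1 - Δ`, the second-order equation for `w` becomes `z' = -i⟨D⟩z + i(w - (f + w)³)`,
and conjugation by the group removes the linear term. Coordinatewise derivatives suffice, because
the resulting field is continuous along the curve in `ℓ²`. -/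
lemma SolvesPerturbed.hasDerivAt_interaction {hf : Continuous f} {W : ℝ → Hs 1 × Hs 0}
    (hW : SolvesPerturbed hf W) (t : ℝ) :
    HasDerivAt (fun τ => propagator (-τ) (encode (W τ)))
      (interactionField (sliceL6 hf) t (propagator (-t) (encode (W t)))) t := by
  have hc : Continuous fun τ => propagator (-τ) (encode (W τ)) :=
    continuous_propagator_neg (continuous_encode.comp hW.continuous)
  refine FreqL2.hasDerivAt_of_coord
    (d := fun t => interactionField (sliceL6 hf) t (propagator (-t) (encode (W t))))
    (continuous_interactionField (continuous_sliceL6 hf) hc) (fun n t => ?_) t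
  have h1 : HasDerivAt (fun τ : ℝ => ((-(-τ * bracket n) : ℝ) : ℂ) * Complex.I)
      (((-(-1 * bracket n) : ℝ) : ℂ) * Complex.I) t :=
    (((hasDerivAt_neg t).mul_const (bracket n)).neg.ofReal_comp).mul_const Complex.I
  have h2 : HasDerivAt (fun τ => encode (W τ) n) (bracket n * (W t).2.coeff n + Complex.I *
      (-(lenSq n : ℂ) * (W t).1.coeff n - realCoeff (cubicTerm hf t (W t)) n)) t := by
    simp only [encode_apply]
    exact ((hW.deriv_fst t n).const_mul _).add ((hW.deriv_snd t n).const_mul _)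
  refine (h1.cexp.mul h2).congr_deriv ?_
  rw [interactionField, propagator_propagator_neg]
  simp only [propagator_apply, lp.coeFn_smul, Pi.smul_apply, smul_eq_mul,
    realCoeff_nonlinearity_encode, encode_apply]
  have hb := ofReal_bracket_sq n
  push_cast
  linear_combination Complex.exp (-(-(t : ℂ) * bracket n) * Complex.I) * Complex.I *
    (W t).1.coeff n * hb + Complex.exp (-(-(t : ℂ) * bracket n) * Complex.I) * bracket n *
    (W t).2.coeff n * Complex.I_sq

lemma SolvesPerturbed.unique {hf : Continuous f} {W W' : ℝ → Hs 1 × Hs 0}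
    (hW : SolvesPerturbed hf W) (hW' : SolvesPerturbed hf W') (h0 : W 0 = W' 0) : W = W' := by
  funext t
  have h := (isLocallyLipschitzField_interactionField (continuous_sliceL6 hf)).eqOn
    (τ := |t| + 1) (fun r _ => hW.hasDerivAt_interaction r)
    (fun r _ => hW'.hasDerivAt_interaction r) (by simp [h0])
    (abs_lt.1 (by linarith : |t| < |t| + 1))
  have h1 := congrArg (propagator t) h
  simp only [propagator_propagator_neg] at h1
  exact encode_injective h1

theorem exists_solvesPerturbed (hf : Continuous f) (h : Hs 1 × Hs 0) :
    ∃ W : ℝ → Hs 1 × Hs 0, SolvesPerturbed hf W ∧ W 0 = h := by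
  obtain ⟨U, hU0, hU⟩ := exists_global_interaction (continuous_sliceL6 hf)
    (exists_bound_sliceL6 hf) (encode h)
  have hUc : Continuous U := continuous_iff_continuousAt.2 fun t => (hU t).continuousAt
  refine ⟨fun t => decode (propagator t (U t)), ⟨?_, fun t n => ?_, fun t n => ?_⟩, ?_⟩
  · exact continuous_decode.comp (continuous_propagator hUc)
  · have h1 := realSynthesis.hasFDerivAt.comp_hasDerivAt t (hasDerivAt_smoothing_propagator (hU t))
    rw [interactionField, realSynthesis_deriv, ← realSynthesis_I_smul] at h1
    have h2 := (coordCLM n).hasFDerivAt.comp_hasDerivAt t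
      (realCoeff.hasFDerivAt.comp_hasDerivAt t h1)
    refine h2.congr_of_eventuallyEq (Eventually.of_forall fun τ => ?_)
    exact decode_fst_coeff_eq _ _
  · set N := realCoeff (nonlinearity (sliceL6 hf t) (propagator t (U t))) with hN
    -- `z` need not be differentiable in `ℓ²`, but each of its coordinates is.
    have hZ : ∀ n, HasDerivAt (fun τ => propagator τ (U τ) n)
        (-Complex.I * bracket n * propagator t (U t) n + Complex.I * N n) t := fun n => by
      have h1 : HasDerivAt (fun τ : ℝ => ((-(τ * bracket n) : ℝ) : ℂ) * Complex.I)
          (((-(1 * bracket n) : ℝ) : ℂ) * Complex.I) t :=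
        (((hasDerivAt_id t).mul_const (bracket n)).neg.ofReal_comp).mul_const Complex.I
      have h2 : HasDerivAt (fun τ => U τ n) (interactionField (sliceL6 hf) t (U t) n) t :=
        (coordCLM n).hasFDerivAt.comp_hasDerivAt t (hU t)
      refine (h1.cexp.mul h2).congr_deriv ?_
      have h3 : propagator t (interactionField (sliceL6 hf) t (U t)) n = Complex.I * N n := by
        rw [interactionField, propagator_propagator_neg]
        rfl
      rw [propagator_apply] at h3
      rw [h3, propagator_apply]
      push_cast
      ring
    have hconj : HasDerivAt (fun τ => starRingEnd ℂ (propagator τ (U τ) (-n)))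
        (starRingEnd ℂ (-Complex.I * bracket (-n) * propagator t (U t) (-n) +
          Complex.I * N (-n))) t :=
      (Complex.conjCLE : ℂ →L[ℝ] ℂ).hasFDerivAt.comp_hasDerivAt t (hZ (-n))
    -- The coefficient of `Im z` is `(z n - conj (z (-n))) / (2i)`.
    have hform : ∀ z : FreqL2, (decode z).2.coeff n =
        (z n - starRingEnd ℂ (z (-n))) * (-Complex.I / 2) := fun z => by
      rw [decode_snd_coeff, realCoeff_realSynthesis]
      simp only [lp.coeFn_neg, lp.coeFn_smul, Pi.neg_apply, Pi.smul_apply, smul_eq_mul, map_neg,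
        map_mul, Complex.conj_I]
      ring
    have h4 := ((hZ n).sub hconj).mul_const (-Complex.I / 2)
    refine (h4.congr_deriv ?_).congr_of_eventuallyEq (Eventually.of_forall fun τ => hform _)
    -- `N` consists of the coefficients of a real function, so its contributions from `n` and `-n`
    -- add up instead of cancelling.
    have hNn : starRingEnd ℂ (N (-n)) = N n := by rw [hN, realCoeff_neg, Complex.conj_conj]
    have hN2 : N n = (decode (propagator t (U t))).1.coeff n -
        realCoeff (cubicTerm hf t (decode (propagator t (U t)))) n := by
      rw [← realCoeff_nonlinearity_encode, encode_decode]
    have hfst : (bracket n : ℂ) * (decode (propagator t (U t))).1.coeff n =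
        (propagator t (U t) n + starRingEnd ℂ (propagator t (U t) (-n))) / 2 := by
      have hb : (bracket n : ℂ) ≠ 0 := by exact_mod_cast (bracket_pos n).ne'
      rw [decode_fst_coeff, realCoeff_realSynthesis]
      push_cast
      field_simp
    have hb := ofReal_bracket_sq n
    simp only [map_add, map_mul, map_neg, Complex.conj_I, Complex.conj_ofReal, hNn, bracket_neg]
    linear_combination (norm := skip) hN2 + (bracket n : ℂ) * hfst -
      (decode (propagator t (U t))).1.coeff n * hb
    ring_nf
    rw [Complex.I_sq]
    ring
  · simp only [hU0, propagator_zero, decode_encode]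

end Perturbation

/-! ## Properties of the free evolution -/

section FreeEvolution

open Filter Topology Set

variable {s : ℝ}

lemma freeEvolution_fst_coeff (t : ℝ) (v : PhaseSpace s) (n : Freq) :
    (freeEvolution t v).1.coeff n = ((Real.cos (t * len n) : ℝ) : ℂ) * v.1.coeff n +
      ((sinSymbol t n : ℝ) : ℂ) * v.2.coeff n := rfl

lemma freeEvolution_snd_coeff (t : ℝ) (v : PhaseSpace s) (n : Freq) :
    (freeEvolution t v).2.coeff n =
      ((-(len n * Real.sin (t * len n)) : ℝ) : ℂ) * v.1.coeff n +
      ((Real.cos (t * len n) : ℝ) : ℂ) * v.2.coeff n := rfl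

lemma len_zero : len 0 = 0 := by simp [len, lenSq]

lemma hasDerivAt_sinSymbol (t : ℝ) (n : Freq) :
    HasDerivAt (fun τ => sinSymbol τ n) (Real.cos (t * len n)) t := by
  by_cases h : n = 0
  · subst h
    simp only [sinSymbol, if_true, len_zero, mul_zero, Real.cos_zero]
    exact hasDerivAt_id t
  · simp only [sinSymbol, h, if_false]
    have hl : len n ≠ 0 := (zero_lt_one.trans_le (one_le_len h)).ne'
    have h1 := (((hasDerivAt_id t).mul_const (len n)).sin).div_const (len n)
    refine h1.congr_deriv ?_
    simp only [id_eq]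
    field_simp

/-- In this form the frequency `0` needs no separate treatment: time derivatives and the group law
become identities in the two symbols `cos` and `sinSymbol`. -/
lemma len_mul_sin (t : ℝ) (n : Freq) :
    len n * Real.sin (t * len n) = lenSq n * sinSymbol t n := by
  by_cases h : n = 0
  · subst h
    simp [len_zero, lenSq]
  · have hl : len n ≠ 0 := (zero_lt_one.trans_le (one_le_len h)).ne'
    rw [sinSymbol, if_neg h, ← len_sq]
    field_simp

lemma hasDerivAt_cos_len (t : ℝ) (n : Freq) :
    HasDerivAt (fun τ => Real.cos (τ * len n)) (-(len n * Real.sin (t * len n))) t := by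
  have h1 := ((hasDerivAt_id t).mul_const (len n)).cos
  refine h1.congr_deriv ?_
  simp only [id_eq]
  ring

lemma hasDerivAt_freeEvolution_fst (v : PhaseSpace s) (n : Freq) (t : ℝ) :
    HasDerivAt (fun τ => (freeEvolution τ v).1.coeff n) ((freeEvolution t v).2.coeff n) t :=
  ((hasDerivAt_cos_len t n).ofReal_comp.mul_const _).add
    ((hasDerivAt_sinSymbol t n).ofReal_comp.mul_const _)

lemma hasDerivAt_freeEvolution_snd (v : PhaseSpace s) (n : Freq) (t : ℝ) :
    HasDerivAt (fun τ => (freeEvolution τ v).2.coeff n)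
      (-(lenSq n : ℂ) * (freeEvolution t v).1.coeff n) t := by
  have h1 : HasDerivAt (fun τ => -(len n * Real.sin (τ * len n)))
      (-(lenSq n * Real.cos (t * len n))) t := by
    simp only [len_mul_sin]
    exact ((hasDerivAt_sinSymbol t n).const_mul _).neg
  have h2 := (h1.ofReal_comp.mul_const (v.1.coeff n)).add
    ((hasDerivAt_cos_len t n).ofReal_comp.mul_const (v.2.coeff n))
  refine h2.congr_deriv ?_
  rw [freeEvolution_fst_coeff, len_mul_sin]
  push_cast
  ring

/-- Each entry is a multiplier between weighted `ℓ²` spaces. The weights of `H^s` and `H^{s-1}`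
differ by `⟨n⟩`, which balances the gain of `sinSymbol` and the loss of `|n| sin(t|n|)`. -/
lemma continuous_freeEvolution (v : PhaseSpace s) : Continuous fun t => freeEvolution t v := by
  have hcos : ∀ (a : ℝ) (g : Hs a) (y : ℝ → Hs a),
      (∀ t n, (y t).coeff n = ((Real.cos (t * len n) : ℝ) : ℂ) * g.coeff n) → Continuous y := by
    intro a g y hy
    refine Hs.continuous_iff.2 (FreqL2.continuous_of_multiplier
      (m := fun t n => ((Real.cos (t * len n) : ℝ) : ℂ)) (c := fun _ => Hs.toLp a g)
      (fun n => by fun_prop) (fun T => ⟨1, fun t _ n => ?_⟩) continuous_const fun t n => ?_)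
    · rw [Complex.norm_real]
      exact Real.abs_cos_le_one _
    · rw [Hs.toLp_apply, Hs.toLp_apply, hy]
      ring
  refine Continuous.prodMk (Continuous.add ?_ ?_) (Continuous.add ?_ ?_)
  · exact hcos _ v.1 _ fun t n => rfl
  · refine Hs.continuous_iff.2 (FreqL2.continuous_of_multiplier
      (m := fun t n => ((sinSymbol t n * bracket n : ℝ) : ℂ)) (c := fun _ => Hs.toLp (s - 1) v.2)
      (fun n => ?_) (fun T => ⟨T + 2, fun t ht n => ?_⟩) continuous_const fun t n => ?_)
    · have : Continuous fun t => sinSymbol t n :=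
        continuous_iff_continuousAt.2 fun t => (hasDerivAt_sinSymbol t n).continuousAt
      fun_prop
    · rw [Complex.norm_real, norm_mul, Real.norm_eq_abs, Real.norm_of_nonneg (bracket_pos n).le,
        ← le_div_iff₀ (bracket_pos n), div_eq_mul_inv]
      refine (abs_sinSymbol_le t n).trans ?_
      have := inv_nonneg.2 (bracket_pos n).le
      gcongr
    · rw [Hs.toLp_apply, Hs.toLp_apply, Hs.coeff_mk]
      have h : bracket n ^ s = bracket n * bracket n ^ (s - 1) := by
        conv_lhs => rw [show s = 1 + (s - 1) by ring, Real.rpow_add (bracket_pos n), Real.rpow_one]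
      rw [h]
      push_cast
      ring
  · refine Hs.continuous_iff.2 (FreqL2.continuous_of_multiplier
      (m := fun t n => ((-(len n * Real.sin (t * len n)) * (bracket n)⁻¹ : ℝ) : ℂ))
      (c := fun _ => Hs.toLp s v.1)
      (fun n => by fun_prop) (fun T => ⟨1, fun t ht n => ?_⟩) continuous_const fun t n => ?_)
    · rw [Complex.norm_real, norm_mul, norm_neg, norm_mul, Real.norm_of_nonneg (len_nonneg n),
        Real.norm_of_nonneg (inv_nonneg.2 (bracket_pos n).le), ← div_eq_mul_inv,
        div_le_one (bracket_pos n)]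
      exact (mul_le_of_le_one_right (len_nonneg n) (Real.abs_sin_le_one _)).trans
        (len_le_bracket n)
    · rw [Hs.toLp_apply, Hs.toLp_apply, Hs.coeff_mk]
      have h : bracket n ^ (s - 1) = bracket n ^ s * (bracket n)⁻¹ := by
        rw [Real.rpow_sub (bracket_pos n), Real.rpow_one, div_eq_mul_inv]
      rw [h]
      push_cast
      ring
  · exact hcos _ v.2 _ fun t n => rfl

lemma PhaseSpace.ext_coeff {v v' : PhaseSpace s} (h1 : ∀ n, v.1.coeff n = v'.1.coeff n)
    (h2 : ∀ n, v.2.coeff n = v'.2.coeff n) : v = v' :=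
  Prod.ext (Hs.ext h1) (Hs.ext h2)

lemma freeEvolution_zero (v : PhaseSpace s) : freeEvolution 0 v = v := by
  refine PhaseSpace.ext_coeff (fun n => ?_) fun n => ?_
  · rw [freeEvolution_fst_coeff]; simp [sinSymbol]
  · rw [freeEvolution_snd_coeff]; simp

lemma freeEvolution_add (t : ℝ) (v v' : PhaseSpace s) :
    freeEvolution t (v + v') = freeEvolution t v + freeEvolution t v' := by
  refine PhaseSpace.ext_coeff (fun n => ?_) fun n => ?_
  · simp only [freeEvolution_fst_coeff, Prod.fst_add, Prod.snd_add, Hs.coeff_add, Pi.add_apply]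
    ring
  · simp only [freeEvolution_snd_coeff, Prod.fst_add, Prod.snd_add, Hs.coeff_add, Pi.add_apply]
    ring

lemma cos_add_len (t t₀ : ℝ) (n : Freq) : Real.cos ((t + t₀) * len n) =
    Real.cos (t * len n) * Real.cos (t₀ * len n) -
      sinSymbol t n * (lenSq n * sinSymbol t₀ n) := by
  rw [← len_mul_sin, add_mul, Real.cos_add]
  by_cases h : n = 0
  · subst h
    simp [len_zero]
  · have hl : len n ≠ 0 := (zero_lt_one.trans_le (one_le_len h)).ne'
    rw [sinSymbol, if_neg h]
    field_simp

lemma sinSymbol_add (t t₀ : ℝ) (n : Freq) : sinSymbol (t + t₀) n =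
    Real.cos (t * len n) * sinSymbol t₀ n + sinSymbol t n * Real.cos (t₀ * len n) := by
  by_cases h : n = 0
  · subst h
    simp [len_zero, sinSymbol, add_comm]
  · have hl : len n ≠ 0 := (zero_lt_one.trans_le (one_le_len h)).ne'
    simp only [sinSymbol, if_neg h, add_mul, Real.sin_add]
    field_simp
    ring

lemma freeEvolution_freeEvolution (t t₀ : ℝ) (v : PhaseSpace s) :
    freeEvolution t (freeEvolution t₀ v) = freeEvolution (t + t₀) v := by
  refine PhaseSpace.ext_coeff (fun n => ?_) fun n => ?_
  · simp only [freeEvolution_fst_coeff, freeEvolution_snd_coeff, len_mul_sin, cos_add_len,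
      sinSymbol_add]
    push_cast
    ring
  · simp only [freeEvolution_fst_coeff, freeEvolution_snd_coeff, len_mul_sin, cos_add_len,
      sinSymbol_add]
    push_cast
    ring

lemma Hs.incl_coeff {a b : ℝ} (h : b ≤ a) (f : Hs a) : (f.incl h).coeff = f.coeff :=
  Hs.coeff_mk _ _

lemma Hs.continuous_incl {a b : ℝ} (h : b ≤ a) : Continuous (Hs.incl h) := by
  refine Hs.continuous_iff.2 ?_
  have hb : ∀ n, ‖((bracket n ^ (b - a) : ℝ) : ℂ)‖ ≤ 1 := fun n => by
    rw [Complex.norm_real, Real.norm_of_nonneg (Real.rpow_nonneg (bracket_pos n).le _)]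
    exact Real.rpow_le_one_of_one_le_of_nonpos (one_le_bracket n) (by linarith)
  refine ((multiplier _ 1 hb).continuous.comp (Hs.isometry_toLp a).continuous).congr fun f => ?_
  ext n
  rw [Function.comp_apply, multiplier_apply, Hs.toLp_apply, Hs.toLp_apply, Hs.incl_coeff,
    ← mul_assoc, ← Complex.ofReal_mul, ← Real.rpow_add (bracket_pos n), sub_add_cancel]

lemma continuous_inclEnergy (hs : s ≤ 1) : Continuous (inclEnergy hs) :=
  ((Hs.continuous_incl _).comp continuous_fst).prodMk ((Hs.continuous_incl _).comp continuous_snd)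

lemma inclEnergy_fst_coeff (hs : s ≤ 1) (w : Hs 1 × Hs 0) :
    (inclEnergy hs w).1.coeff = w.1.coeff := Hs.incl_coeff hs w.1

lemma inclEnergy_snd_coeff (hs : s ≤ 1) (w : Hs 1 × Hs 0) :
    (inclEnergy hs w).2.coeff = w.2.coeff := Hs.incl_coeff (by linarith) w.2

lemma inclEnergy_injective (hs : s ≤ 1) : Function.Injective (inclEnergy hs) := fun w w' h => by
  refine Prod.ext (Hs.ext fun n => ?_) (Hs.ext fun n => ?_)
  · rw [← inclEnergy_fst_coeff hs, h, inclEnergy_fst_coeff]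
  · rw [← inclEnergy_snd_coeff hs, h, inclEnergy_snd_coeff]

lemma inclEnergy_add (hs : s ≤ 1) (w w' : Hs 1 × Hs 0) :
    inclEnergy hs (w + w') = inclEnergy hs w + inclEnergy hs w' :=
  PhaseSpace.ext_coeff
    (fun n => by
      rw [inclEnergy_fst_coeff, Prod.fst_add, Prod.fst_add, Hs.coeff_add, Hs.coeff_add,
        inclEnergy_fst_coeff, inclEnergy_fst_coeff])
    (fun n => by
      rw [inclEnergy_snd_coeff, Prod.snd_add, Prod.snd_add, Hs.coeff_add, Hs.coeff_add,
        inclEnergy_snd_coeff, inclEnergy_snd_coeff])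

/-- The second factor of `PhaseSpace 1` is `Hs (1 - 1)`, a type different from `Hs 0`. This
inequality and the next provide the inclusions in both directions. -/
lemma energy_exponent_le : (1 : ℝ) - 1 ≤ 0 := (sub_self 1).le

lemma le_energy_exponent : (0 : ℝ) ≤ 1 - 1 := (sub_self 1).ge

/-- The free evolution in the energy space. -/
def energyEvolution (t : ℝ) (h : Hs 1 × Hs 0) : Hs 1 × Hs 0 :=
  ((freeEvolution t ((h.1, h.2.incl energy_exponent_le) : PhaseSpace 1)).1,
    (freeEvolution t ((h.1, h.2.incl energy_exponent_le) : PhaseSpace 1)).2.incl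
      le_energy_exponent)

lemma energyEvolution_fst_coeff (t : ℝ) (h : Hs 1 × Hs 0) (n : Freq) :
    (energyEvolution t h).1.coeff n = ((Real.cos (t * len n) : ℝ) : ℂ) * h.1.coeff n +
      ((sinSymbol t n : ℝ) : ℂ) * h.2.coeff n := by
  unfold energyEvolution
  rw [freeEvolution_fst_coeff, Hs.incl_coeff]

lemma energyEvolution_snd_coeff (t : ℝ) (h : Hs 1 × Hs 0) (n : Freq) :
    (energyEvolution t h).2.coeff n =
      ((-(len n * Real.sin (t * len n)) : ℝ) : ℂ) * h.1.coeff n +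
      ((Real.cos (t * len n) : ℝ) : ℂ) * h.2.coeff n := by
  unfold energyEvolution
  rw [Hs.incl_coeff, freeEvolution_snd_coeff, Hs.incl_coeff]

lemma continuous_energyEvolution (h : Hs 1 × Hs 0) : Continuous fun t => energyEvolution t h := by
  have h1 := continuous_freeEvolution ((h.1, h.2.incl energy_exponent_le) : PhaseSpace 1)
  exact (continuous_fst.comp h1).prodMk ((Hs.continuous_incl _).comp (continuous_snd.comp h1))

lemma inclEnergy_energyEvolution (hs : s ≤ 1) (t : ℝ) (h : Hs 1 × Hs 0) :
    inclEnergy hs (energyEvolution t h) = freeEvolution t (inclEnergy hs h) := by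
  refine PhaseSpace.ext_coeff (fun n => ?_) fun n => ?_
  · rw [inclEnergy_fst_coeff, energyEvolution_fst_coeff, freeEvolution_fst_coeff,
      inclEnergy_fst_coeff, inclEnergy_snd_coeff]
  · rw [inclEnergy_snd_coeff, energyEvolution_snd_coeff, freeEvolution_snd_coeff,
      inclEnergy_fst_coeff, inclEnergy_snd_coeff]

end FreeEvolution

/-! ## Jointly measurable representatives -/

section Representative

open Filter Topology Set
open scoped ENNReal NNReal

/-- Outside `freqBall k` the factor `⟨n⟩⁻¹` is below `2^{-k}`. -/
lemma norm_truncate_sub_le (b : FreqL2) (k : ℕ) :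
    ‖truncate (freqBall k) (smoothing b) - smoothing b‖ ≤ (1 / 2) ^ k * ‖b‖ := by
  refine FreqL2.norm_le_of_forall_le (by positivity) fun n => ?_
  rw [lp.coeFn_sub, Pi.sub_apply, truncate_apply]
  by_cases hn : n ∈ freqBall k
  · rw [if_pos hn, sub_self, norm_zero]
    positivity
  · rw [if_neg hn, zero_sub, norm_neg, smoothing_apply, norm_mul, Complex.norm_real,
      Real.norm_of_nonneg (inv_nonneg.2 (bracket_pos n).le), one_div, inv_pow]
    rw [mem_freqBall, not_le] at hn
    gcongr

lemma lintegral_enorm_le_norm (g : Lp ℂ 2 torusMeasure) :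
    ∫⁻ x, ‖g x‖ₑ ∂torusMeasure ≤ ENNReal.ofReal ‖g‖ := by
  rw [← eLpNorm_one_eq_lintegral_enorm, Lp.norm_def, ENNReal.ofReal_toReal (Lp.eLpNorm_ne_top _)]
  exact eLpNorm_le_eLpNorm_of_exponent_le (by norm_num) (Lp.aestronglyMeasurable g)

/-- The dyadic partial sums of the Fourier series of a function in `H¹` converge almost
everywhere. -/
lemma ae_tendsto_trigPoly (b : FreqL2) :
    ∀ᵐ x ∂torusMeasure, Tendsto (fun k => trigPoly (freqBall k) (smoothing b) x) atTop
      (𝓝 (synthesis (smoothing b) x)) := by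
  let g : ℕ → Lp ℂ 2 torusMeasure := fun k =>
    synthesis (truncate (freqBall k) (smoothing b) - smoothing b)
  have hm : ∀ k, AEMeasurable (fun x => ‖g k x‖ₑ) torusMeasure := fun k =>
    (Lp.aestronglyMeasurable (g k)).enorm
  -- The errors are geometrically small in `L²`, hence in `L¹`. So almost everywhere their sum is
  -- finite and they tend to zero; no subsequence has to be chosen.
  have hInt : ∫⁻ x, ∑' k, ‖g k x‖ₑ ∂torusMeasure ≠ ⊤ := by
    rw [lintegral_tsum hm]
    have hs : Summable fun k : ℕ => (1 / 2 : ℝ) ^ k * ‖b‖ :=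
      (summable_geometric_two).mul_right _
    refine ne_top_of_le_ne_top hs.tsum_ofReal_ne_top (ENNReal.tsum_le_tsum fun k => ?_)
    refine (lintegral_enorm_le_norm _).trans (ENNReal.ofReal_le_ofReal ?_)
    rw [synthesis.norm_map]
    exact norm_truncate_sub_le b k
  have hsub : ∀ᵐ x ∂torusMeasure, ∀ k, g k x =
      trigPoly (freqBall k) (smoothing b) x - synthesis (smoothing b) x := by
    rw [ae_all_iff]
    intro k
    simp only [g, map_sub]
    filter_upwards [Lp.coeFn_sub (synthesis (truncate (freqBall k) (smoothing b)))
      (synthesis (smoothing b)), synthesis_truncate (freqBall k) (smoothing b)] with x h1 h2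
    rw [h1, Pi.sub_apply, h2]
  filter_upwards [hsub, ae_lt_top' (AEMeasurable.tsum hm) hInt] with x h1 h2
  have h3 := ENNReal.tendsto_atTop_zero_of_tsum_ne_top h2.ne
  rw [tendsto_iff_edist_tendsto_0]
  refine h3.congr fun k => ?_
  rw [h1, edist_eq_enorm_sub]

lemma smoothing_toLp (h : Hs 1) : (smoothing (Hs.toLp 1 h) : Freq → ℂ) = h.coeff := by
  ext n
  have hb : (bracket n : ℂ) ≠ 0 := by exact_mod_cast (bracket_pos n).ne'
  rw [smoothing_apply, Hs.toLp_apply, Real.rpow_one]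
  push_cast
  field_simp

lemma realSynthesis_smoothing_encode_eq (h : Hs 1 × Hs 0) :
    realSynthesis (smoothing (encode h)) = realSynthesis (smoothing (Hs.toLp 1 h.1)) := by
  refine realCoeff_injective ?_
  ext n
  rw [realSynthesis_smoothing_encode, realCoeff_realSynthesis_of_symm, smoothing_toLp]
  intro n
  rw [smoothing_toLp, h.1.inSobolev.1]

/-- A jointly measurable function of `(t, x)` that represents `w`, for `W = (w, ∂ₜw)`. -/
def spaceTimeRep (W : ℝ → Hs 1 × Hs 0) (p : ℝ × (Fin 3 → ℝ)) : ℝ :=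
  limsup (fun k => (trigPoly (freqBall k) (W p.1).1.coeff p.2).re) atTop

/-- Representatives picked separately for each time need not be jointly measurable, whereas an upper
limit of jointly continuous functions is measurable even where the series diverges. -/
lemma measurable_spaceTimeRep {W : ℝ → Hs 1 × Hs 0} (hW : Continuous W) :
    Measurable (spaceTimeRep W) := by
  refine Measurable.limsup fun k => ?_
  have h : Continuous fun p : ℝ × (Fin 3 → ℝ) =>
      (trigPoly (freqBall k) (W p.1).1.coeff p.2).re := by
    refine Complex.continuous_re.comp (continuous_finsetSum _ fun n _ => ?_)
    exact (Hs.continuous_coeff ((continuous_fst.comp hW).comp continuous_fst) n).mul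
      ((continuous_character n).comp continuous_snd)
  exact h.measurable

lemma ae_spaceTimeRep (W : ℝ → Hs 1 × Hs 0) (t : ℝ) :
    ∀ᵐ x ∂torusMeasure, spaceTimeRep W (t, x) = sobolevL6 (encode (W t)) x := by
  filter_upwards [ae_tendsto_trigPoly (Hs.toLp 1 (W t).1), coeFn_sobolevL6 (encode (W t)),
    coeFn_reL2 (synthesis (smoothing (Hs.toLp 1 (W t).1)))] with x h1 h2 h3
  rw [h2, realSynthesis_smoothing_encode_eq, realSynthesis_def, h3]
  rw [smoothing_toLp] at h1
  exact ((Complex.continuous_re.tendsto _).comp h1).limsup_eq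

/-- A measurable function whose time slices form a continuous curve in `L⁶` is in `L³_loc`. -/
lemma memLp_of_continuous_slices {G : ℝ × (Fin 3 → ℝ) → ℝ} (hG : Measurable G)
    {g : ℝ → Lp ℝ 6 torusMeasure} (hg : Continuous g)
    (h : ∀ t, ∀ᵐ x ∂torusMeasure, G (t, x) = g t x) (T : ℝ) :
    MemLp G 3 (volume.restrict (Icc (-T) T ×ˢ cube)) := by
  obtain ⟨M, hM⟩ := (isCompact_Icc (a := -T) (b := T)).exists_bound_of_continuousOn
    hg.continuousOn
  have hμ : (volume.restrict (Icc (-T) T ×ˢ cube) : Measure (ℝ × (Fin 3 → ℝ))) =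
      (volume.restrict (Icc (-T) T)).prod (volume.restrict cube) := by
    rw [Measure.prod_restrict, Measure.volume_eq_prod]
  have hfin : IsFiniteMeasure (volume.restrict cube : Measure (Fin 3 → ℝ)) :=
    ⟨by rw [Measure.restrict_apply_univ, volume_cube]; exact ENNReal.ofReal_lt_top⟩
  rw [hμ]
  -- By Tonelli the sixth power is integrated over slices whose `L⁶` norms are bounded on `[-T, T]`.
  -- On a set of finite measure `L⁶ ⊂ L³`.
  have h6 : MemLp G 6 ((volume.restrict (Icc (-T) T)).prod (volume.restrict cube)) := by
    refine ⟨hG.aestronglyMeasurable, ?_⟩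
    rw [eLpNorm_lt_top_iff_lintegral_rpow_enorm_lt_top (by norm_num) (by norm_num),
      lintegral_prod _ (hG.enorm.pow_const _).aemeasurable]
    have hin : ∀ t ∈ Icc (-T) T, ∫⁻ x in cube, ‖G (t, x)‖ₑ ^ (6 : ℝ≥0∞).toReal ≤
        ENNReal.ofReal ((2 * Real.pi) ^ 3) * ENNReal.ofReal M ^ (6 : ℝ) := fun t ht => by
      rw [restrict_cube_eq, lintegral_smul_measure, smul_eq_mul]
      gcongr
      have h1 : ∫⁻ x, ‖G (t, x)‖ₑ ^ (6 : ℝ≥0∞).toReal ∂torusMeasure =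
          ∫⁻ x, ‖g t x‖ₑ ^ ((6 : ℝ≥0) : ℝ) ∂torusMeasure := by
        refine lintegral_congr_ae ?_
        filter_upwards [h t] with x hx
        rw [hx]
        norm_num
      rw [h1, ← eLpNorm_nnreal_pow_eq_lintegral (by norm_num)]
      have h2 : eLpNorm (g t) ((6 : ℝ≥0) : ℝ≥0∞) torusMeasure ≤ ENNReal.ofReal M := by
        have h3 := hM t ht
        rw [Lp.norm_def] at h3
        exact (ENNReal.le_ofReal_iff_toReal_le (Lp.eLpNorm_ne_top (g t))
          (ENNReal.toReal_nonneg.trans h3)).2 h3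
      exact ENNReal.rpow_le_rpow h2 (by norm_num)
    refine (setLIntegral_mono' measurableSet_Icc hin).trans_lt ?_
    rw [setLIntegral_const]
    refine ENNReal.mul_lt_top (ENNReal.mul_lt_top ENNReal.ofReal_lt_top
      (ENNReal.rpow_lt_top_of_nonneg (by norm_num) ENNReal.ofReal_ne_top)) ?_
    simp
  exact h6.mono_exponent (by norm_num)

end Representative

/-! ## Test functions and their Fourier coefficients -/

section TestFunctions

open Filter Topology Set
open scoped ContDiff

/-- The derivative of `φ` in the direction `e`. -/
def dirDeriv (e : ℝ × (Fin 3 → ℝ)) (φ : ℝ × (Fin 3 → ℝ) → ℝ) (p : ℝ × (Fin 3 → ℝ)) : ℝ :=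
  fderiv ℝ φ p e

/-- The unit vector in the direction of time. -/
def timeDir : ℝ × (Fin 3 → ℝ) := (1, 0)

/-- The unit vectors in space. -/
def spaceDir (i : Fin 3) : ℝ × (Fin 3 → ℝ) := (0, Pi.single i 1)

lemma IsTestFunction.differentiableAt {φ : ℝ × (Fin 3 → ℝ) → ℝ} (hφ : IsTestFunction φ)
    (p : ℝ × (Fin 3 → ℝ)) : DifferentiableAt ℝ φ p :=
  hφ.smooth.differentiable (by simp) p

lemma IsTestFunction.continuous {φ : ℝ × (Fin 3 → ℝ) → ℝ} (hφ : IsTestFunction φ) :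
    Continuous φ := hφ.smooth.continuous

lemma IsTestFunction.dirDeriv {φ : ℝ × (Fin 3 → ℝ) → ℝ} (hφ : IsTestFunction φ)
    (e : ℝ × (Fin 3 → ℝ)) : IsTestFunction (dirDeriv e φ) where
  smooth := (hφ.smooth.fderiv_right (m := ∞) (by simp)).clm_apply contDiff_const
  periodic t x n := by
    have h : (fun p : ℝ × (Fin 3 → ℝ) => φ (p + (0, fun i => 2 * Real.pi * n i))) = φ := by
      funext p
      have := hφ.periodic p.1 p.2 n
      rw [← this]
      congr 1
      ext <;> simp
    have h1 := fderiv_comp_add_right (𝕜 := ℝ) (f := φ) (x := (t, x))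
      ((0, fun i => 2 * Real.pi * n i) : ℝ × (Fin 3 → ℝ))
    rw [h] at h1
    unfold CubicWave.dirDeriv
    rw [h1]
    congr 2
    ext <;> simp
  compactSupport := by
    obtain ⟨T, hT⟩ := hφ.compactSupport
    refine ⟨T, fun t x ht => ?_⟩
    have h : φ =ᶠ[𝓝 (t, x)] fun _ => 0 := by
      have ho : IsOpen {p : ℝ × (Fin 3 → ℝ) | T < |p.1|} :=
        isOpen_lt continuous_const continuous_fst.abs
      filter_upwards [ho.mem_nhds (show (t, x) ∈ {p : ℝ × (Fin 3 → ℝ) | T < |p.1|} from ht)]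
        with p hp using hT p.1 p.2 hp
    unfold CubicWave.dirDeriv
    rw [h.fderiv_eq]
    simp

lemma IsTestFunction.hasDerivAt_time {φ : ℝ × (Fin 3 → ℝ) → ℝ} (hφ : IsTestFunction φ)
    (t : ℝ) (x : Fin 3 → ℝ) :
    HasDerivAt (fun τ => φ (τ, x)) (CubicWave.dirDeriv timeDir φ (t, x)) t :=
  (hφ.differentiableAt (t, x)).hasFDerivAt.comp_hasDerivAt t
    ((hasDerivAt_id t).prodMk (hasDerivAt_const t x))

lemma IsTestFunction.hasDerivAt_space {φ : ℝ × (Fin 3 → ℝ) → ℝ} (hφ : IsTestFunction φ)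
    (t : ℝ) (x : Fin 3 → ℝ) (i : Fin 3) (r : ℝ) :
    HasDerivAt (fun r => φ (t, Function.update x i r))
      (CubicWave.dirDeriv (spaceDir i) φ (t, Function.update x i r)) r :=
  (hφ.differentiableAt (t, Function.update x i r)).hasFDerivAt.comp_hasDerivAt r
    ((hasDerivAt_const r t).prodMk (hasDerivAt_update x i r))

/-- Directional derivatives of test functions are again test functions, so this form allows
induction on the order of the derivatives. -/
lemma IsTestFunction.waveOp_eq {φ : ℝ × (Fin 3 → ℝ) → ℝ} (hφ : IsTestFunction φ)
    (p : ℝ × (Fin 3 → ℝ)) :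
    waveOp φ p = CubicWave.dirDeriv timeDir (CubicWave.dirDeriv timeDir φ) p -
      ∑ i, CubicWave.dirDeriv (spaceDir i) (CubicWave.dirDeriv (spaceDir i) φ) p := by
  obtain ⟨t, x⟩ := p
  unfold waveOp
  congr 1
  · rw [iteratedDeriv_succ, iteratedDeriv_one]
    have h1 : deriv (fun τ => φ (τ, x)) = fun τ => CubicWave.dirDeriv timeDir φ (τ, x) :=
      funext fun τ => (hφ.hasDerivAt_time τ x).deriv
    simp only [h1]
    exact ((hφ.dirDeriv timeDir).hasDerivAt_time t x).deriv
  · refine Finset.sum_congr rfl fun i _ => ?_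
    rw [iteratedDeriv_succ, iteratedDeriv_one]
    have h1 : deriv (fun r => φ (t, Function.update x i r)) =
        fun r => CubicWave.dirDeriv (spaceDir i) φ (t, Function.update x i r) :=
      funext fun r => (hφ.hasDerivAt_space t x i r).deriv
    simp only [h1]
    rw [((hφ.dirDeriv (spaceDir i)).hasDerivAt_space t x i (x i)).deriv, Function.update_eq_self]

lemma IsTestFunction.continuous_waveOp {φ : ℝ × (Fin 3 → ℝ) → ℝ} (hφ : IsTestFunction φ) :
    Continuous (waveOp φ) := by
  have h : waveOp φ = fun p => CubicWave.dirDeriv timeDir (CubicWave.dirDeriv timeDir φ) p -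
      ∑ i, CubicWave.dirDeriv (spaceDir i) (CubicWave.dirDeriv (spaceDir i) φ) p :=
    funext hφ.waveOp_eq
  rw [h]
  exact ((hφ.dirDeriv _).dirDeriv _).continuous.sub
    (continuous_finsetSum _ fun i _ => ((hφ.dirDeriv _).dirDeriv _).continuous)

lemma IsTestFunction.waveOp_eq_zero {φ : ℝ × (Fin 3 → ℝ) → ℝ} (hφ : IsTestFunction φ) :
    ∃ T : ℝ, ∀ (t : ℝ) (x : Fin 3 → ℝ), T < |t| → φ (t, x) = 0 ∧ waveOp φ (t, x) = 0 := by
  have h := fun e => ((hφ.dirDeriv e).dirDeriv e).compactSupport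
  choose T hT using h
  obtain ⟨T₀, hT₀⟩ := hφ.compactSupport
  refine ⟨|T₀| + (|T timeDir| + ∑ i, |T (spaceDir i)|), fun t x ht => ⟨hT₀ t x ?_, ?_⟩⟩
  · have h1 : 0 ≤ ∑ i, |T (spaceDir i)| := Finset.sum_nonneg fun _ _ => abs_nonneg _
    linarith [le_abs_self T₀, abs_nonneg (T timeDir)]
  · have h1 : ∀ i, |T (spaceDir i)| ≤ ∑ i, |T (spaceDir i)| := fun i =>
      Finset.single_le_sum (f := fun i => |T (spaceDir i)|) (fun _ _ => abs_nonneg _)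
        (Finset.mem_univ i)
    have h2 := (abs_nonneg _).trans (h1 0)
    rw [hφ.waveOp_eq, hT timeDir t x (by linarith [abs_nonneg T₀, le_abs_self (T timeDir)]),
      Finset.sum_eq_zero, sub_zero]
    intro i _
    exact hT (spaceDir i) t x
      (by linarith [abs_nonneg T₀, abs_nonneg (T timeDir), le_abs_self (T (spaceDir i)), h1 i])

/-- The `n`-th Fourier coefficient of a function on the torus. -/
def torusCoeff (g : (Fin 3 → ℝ) → ℝ) (n : Freq) : ℂ :=
  ∫ x, (g x : ℂ) * starRingEnd ℂ (character n x) ∂torusMeasure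

/-- The divergence theorem on the closed cube; opposite faces cancel by periodicity. -/
lemma integral_partial_eq_zero {F : (Fin 3 → ℝ) → ℂ} (hF : ContDiff ℝ 1 F)
    (hper : ∀ (x : Fin 3 → ℝ) (n : Freq), F (fun i => x i + 2 * Real.pi * n i) = F x)
    (i : Fin 3) : ∫ x, fderiv ℝ F x (Pi.single i 1) ∂torusMeasure = 0 := by
  have hc : Continuous fun x => fderiv ℝ F x (Pi.single i 1) :=
    (hF.continuous_fderiv (by simp)).clm_apply continuous_const
  have hset : (cube : Set (Fin 3 → ℝ)) =ᵐ[volume] Icc 0 fun _ => 2 * Real.pi :=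
    Measure.univ_pi_Ico_ae_eq_Icc (μ := fun _ : Fin 3 => (volume : Measure ℝ))
      (f := 0) (g := fun _ => 2 * Real.pi)
  rw [integral_torusMeasure, setIntegral_congr_set hset]
  -- The vector field has `F` as its `i`-th component and no other.
  have hdiv := integral_divergence_of_hasFDerivAt_off_countable' (E := ℂ) (n := 2)
    (0 : Fin 3 → ℝ) (fun _ => 2 * Real.pi) (fun _ => by positivity)
    (fun j => if j = i then F else 0) (fun j x => if j = i then fderiv ℝ F x else 0) ∅
    countable_empty (fun j => ?_) (fun x _ j => ?_) ?_
  · have hsum : ∀ x : Fin 3 → ℝ, ∑ j, (if j = i then fderiv ℝ F x else 0) (Pi.single j (1 : ℝ)) =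
        fderiv ℝ F x (Pi.single i 1) := fun x => by
      rw [Finset.sum_eq_single i]
      · simp
      · intro j _ hj; simp [hj]
      · simp
    simp only [hsum] at hdiv
    rw [hdiv, Finset.sum_eq_zero, smul_zero]
    intro j _
    by_cases hj : j = i
    · subst hj
      simp only [if_true]
      rw [sub_eq_zero]
      congr 1
      funext y
      -- The two faces orthogonal to direction `j` differ by one period in that direction.
      rw [← hper (j.insertNth ((0 : Fin 3 → ℝ) j) y) (Pi.single j 1)]
      congr 1
      funext k
      refine Fin.succAboveCases j ?_ (fun k => ?_) k
      · simp
      · simp [Fin.succAbove_ne]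
    · simp [hj]
  · by_cases hj : j = i
    · simpa [hj] using hF.continuous.continuousOn
    · simp only [hj, if_false]
      exact continuousOn_const
  · by_cases hj : j = i
    · simpa [hj] using (hF.differentiable (by simp) x).hasFDerivAt
    · simp only [hj, if_false]
      exact hasFDerivAt_const _ _
  · have hsum : ∀ x : Fin 3 → ℝ, ∑ j, (if j = i then fderiv ℝ F x else 0) (Pi.single j (1 : ℝ)) =
        fderiv ℝ F x (Pi.single i 1) := fun x => by
      rw [Finset.sum_eq_single i]
      · simp
      · intro j _ hj; simp [hj]
      · simp
    simp only [hsum]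
    exact hc.continuousOn.integrableOn_compact isCompact_Icc

lemma integrable_slice_mul_conj {φ : ℝ × (Fin 3 → ℝ) → ℝ} (hφ : Continuous φ) (t : ℝ) (n : Freq) :
    Integrable (fun x => (φ (t, x) : ℂ) * starRingEnd ℂ (character n x)) torusMeasure :=
  integrable_mul_conj_character (memLp_one_iff_integrable.1 (memLp_of_continuous
    (Complex.continuous_ofReal.comp (continuous_slice hφ t)) 1)) n

/-- Integration by parts: the integral of `∂ᵢ(φ e^{-i n·x})` over the torus vanishes. -/
lemma IsTestFunction.torusCoeff_space {φ : ℝ × (Fin 3 → ℝ) → ℝ} (hφ : IsTestFunction φ)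
    (t : ℝ) (i : Fin 3) (n : Freq) :
    torusCoeff (fun x => CubicWave.dirDeriv (spaceDir i) φ (t, x)) n =
      Complex.I * n i * torusCoeff (fun x => φ (t, x)) n := by
  let F : (Fin 3 → ℝ) → ℂ := fun x => (φ (t, x) : ℂ) * character (-n) x
  have hφ1 : ContDiff ℝ 1 fun x => φ (t, x) :=
    (hφ.smooth.of_le (by simp)).comp (contDiff_const.prodMk contDiff_id)
  have hF : ContDiff ℝ 1 F :=
    (Complex.ofRealCLM.contDiff.comp hφ1).mul (contDiff_character (-n))
  have h0 := integral_partial_eq_zero hF (fun x m => by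
    simp only [F, hφ.periodic, character_add_period]) i
  have hder : ∀ x, fderiv ℝ F x (Pi.single i 1) =
      (CubicWave.dirDeriv (spaceDir i) φ (t, x) : ℂ) * starRingEnd ℂ (character n x) -
        Complex.I * n i * ((φ (t, x) : ℂ) * starRingEnd ℂ (character n x)) := fun x => by
    have h1 : HasFDerivAt (fun x => φ (t, x))
        ((fderiv ℝ φ (t, x)).comp (ContinuousLinearMap.inr ℝ ℝ (Fin 3 → ℝ))) x :=
      (hφ.differentiableAt (t, x)).hasFDerivAt.comp x (hasFDerivAt_prodMk_right t x)
    have h2 := (Complex.ofRealCLM.hasFDerivAt.comp x h1).mul (hasFDerivAt_character (-n) x)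
    have h3 : HasFDerivAt F _ x := h2
    rw [h3.fderiv, ← character_neg]
    simp only [FunLike.coe_add, Pi.add_apply, FunLike.coe_smul, Pi.smul_apply,
      FunLike.coe_sum, Finset.sum_apply, ContinuousLinearMap.comp_apply,
      ContinuousLinearMap.proj_apply, Complex.ofRealCLM_apply, smul_eq_mul, Function.comp_apply,
      ContinuousLinearMap.inr_apply]
    rw [Finset.sum_eq_single i]
    · simp only [Pi.single_eq_same, Pi.neg_apply, CubicWave.dirDeriv, spaceDir]
      push_cast
      ring
    · intro j _ hj
      simp [Pi.single_eq_of_ne hj]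
    · simp
  simp only [hder] at h0
  rw [integral_sub (integrable_slice_mul_conj (hφ.dirDeriv _).continuous t n)
    ((integrable_slice_mul_conj hφ.continuous t n).const_mul _), integral_const_mul,
    sub_eq_zero] at h0
  exact h0

lemma IsTestFunction.hasDerivAt_torusCoeff {φ : ℝ × (Fin 3 → ℝ) → ℝ} (hφ : IsTestFunction φ)
    (t : ℝ) (n : Freq) :
    HasDerivAt (fun τ => torusCoeff (fun x => φ (τ, x)) n)
      (torusCoeff (fun x => CubicWave.dirDeriv timeDir φ (t, x)) n) t := by
  obtain ⟨M, hM⟩ := exists_bound_on_strip (hφ.dirDeriv timeDir).continuous (|t| + 1)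
  refine (hasDerivAt_integral_of_dominated_loc_of_deriv_le (μ := torusMeasure)
    (F := fun τ x => (φ (τ, x) : ℂ) * starRingEnd ℂ (character n x))
    (F' := fun τ x => (CubicWave.dirDeriv timeDir φ (τ, x) : ℂ) * starRingEnd ℂ (character n x))
    (bound := fun _ => M) (Metric.ball_mem_nhds t one_pos)
    (Eventually.of_forall fun τ => (integrable_slice_mul_conj hφ.continuous τ n).1)
    (integrable_slice_mul_conj hφ.continuous t n)
    (integrable_slice_mul_conj (hφ.dirDeriv timeDir).continuous t n).1 ?_ (integrable_const M)
    ?_).2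
  · filter_upwards [ae_mem_cube] with x hx τ hτ
    have hτ' : |τ| ≤ |t| + 1 := by
      rw [Metric.mem_ball, Real.dist_eq] at hτ
      have := abs_sub_abs_le_abs_sub τ t
      linarith
    rw [norm_mul, RCLike.norm_conj, norm_character, mul_one, Complex.norm_real]
    exact hM τ hτ' x (cube_subset_closedCube hx)
  · exact Eventually.of_forall fun x τ _ =>
      (hφ.hasDerivAt_time τ x).ofReal_comp.mul_const _

lemma IsTestFunction.torusCoeff_waveOp {φ : ℝ × (Fin 3 → ℝ) → ℝ} (hφ : IsTestFunction φ)
    (t : ℝ) (n : Freq) :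
    torusCoeff (fun x => waveOp φ (t, x)) n =
      torusCoeff (fun x => CubicWave.dirDeriv timeDir (CubicWave.dirDeriv timeDir φ) (t, x)) n +
        lenSq n * torusCoeff (fun x => φ (t, x)) n := by
  have hsp : ∀ i, torusCoeff
      (fun x => CubicWave.dirDeriv (spaceDir i) (CubicWave.dirDeriv (spaceDir i) φ) (t, x)) n =
      -((n i : ℝ) ^ 2 : ℝ) * torusCoeff (fun x => φ (t, x)) n := fun i => by
    rw [(hφ.dirDeriv _).torusCoeff_space, hφ.torusCoeff_space]
    push_cast
    linear_combination (n i : ℂ) ^ 2 * torusCoeff (fun x => φ (t, x)) n * Complex.I_sq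
  have h1 : torusCoeff (fun x => waveOp φ (t, x)) n =
      torusCoeff (fun x => CubicWave.dirDeriv timeDir (CubicWave.dirDeriv timeDir φ) (t, x)) n -
      ∑ i, torusCoeff
        (fun x => CubicWave.dirDeriv (spaceDir i) (CubicWave.dirDeriv (spaceDir i) φ) (t, x)) n := by
    unfold torusCoeff
    rw [← integral_finsetSum _ fun i _ =>
      integrable_slice_mul_conj ((hφ.dirDeriv _).dirDeriv _).continuous t n,
      ← integral_sub (integrable_slice_mul_conj ((hφ.dirDeriv _).dirDeriv _).continuous t n)
        (integrable_finsetSum _ fun i _ =>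
          integrable_slice_mul_conj ((hφ.dirDeriv _).dirDeriv _).continuous t n)]
    refine integral_congr_ae (Eventually.of_forall fun x => ?_)
    simp only [hφ.waveOp_eq]
    push_cast
    rw [sub_mul, Finset.sum_mul]
  rw [h1, Finset.sum_congr rfl fun i _ => hsp i, lenSq, ← Finset.sum_mul]
  push_cast
  rw [Finset.sum_neg_distrib]
  ring

end TestFunctions

/-! ## The equation in the sense of distributions -/

section WeakFormulation

open Filter Topology Set
open scoped ENNReal

/-- The integrand of the weak formulation. -/
def weakIntegrand (V φ : ℝ × (Fin 3 → ℝ) → ℝ) (p : ℝ × (Fin 3 → ℝ)) : ℝ :=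
  V p * waveOp φ p + V p ^ 3 * φ p

lemma integrableOn_weakIntegrand {V φ : ℝ × (Fin 3 → ℝ) → ℝ} (hφ : IsTestFunction φ)
    (hV : ∀ T : ℝ, MemLp V 3 (volume.restrict (Icc (-T) T ×ˢ cube))) :
    IntegrableOn (weakIntegrand V φ) (univ ×ˢ cube) := by
  obtain ⟨T, hT⟩ := hφ.waveOp_eq_zero
  obtain ⟨M, hM⟩ := exists_bound_on_strip hφ.continuous T
  obtain ⟨M', hM'⟩ := exists_bound_on_strip hφ.continuous_waveOp T
  have hms : MeasurableSet (Icc (-T) T ×ˢ cube : Set (ℝ × (Fin 3 → ℝ))) :=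
    measurableSet_Icc.prod measurableSet_cube
  have hfin : IsFiniteMeasure
      (volume.restrict (Icc (-T) T ×ˢ cube) : Measure (ℝ × (Fin 3 → ℝ))) := by
    refine ⟨?_⟩
    rw [Measure.restrict_apply_univ, Measure.volume_eq_prod, Measure.prod_prod, volume_cube]
    exact ENNReal.mul_lt_top (by simp) ENNReal.ofReal_lt_top
  have h1 : Integrable V (volume.restrict (Icc (-T) T ×ˢ cube)) :=
    (hV T).integrable (by norm_num)
  have h3 : Integrable (fun p => V p ^ 3) (volume.restrict (Icc (-T) T ×ˢ cube)) := by
    refine ((hV T).integrable_norm_pow (by norm_num)).mono' (h1.1.pow 3)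
      (Eventually.of_forall fun p => ?_)
    rw [norm_pow]
  have hon : IntegrableOn (weakIntegrand V φ) (Icc (-T) T ×ˢ cube) := by
    refine Integrable.add (h1.mul_bdd (c := M') hφ.continuous_waveOp.aestronglyMeasurable ?_)
      (h3.mul_bdd (c := M) hφ.continuous.aestronglyMeasurable ?_)
    · filter_upwards [ae_restrict_mem hms] with p hp
      exact hM' p.1 (abs_le.2 hp.1) p.2 (cube_subset_closedCube hp.2)
    · filter_upwards [ae_restrict_mem hms] with p hp
      exact hM p.1 (abs_le.2 hp.1) p.2 (cube_subset_closedCube hp.2)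
  refine hon.of_forall_sdiff_eq_zero (MeasurableSet.univ.prod measurableSet_cube) fun p hp => ?_
  have hp1 : T < |p.1| := by
    by_contra hcon
    exact hp.2 ⟨abs_le.1 (not_lt.1 hcon), hp.1.2⟩
  rw [weakIntegrand, (hT p.1 p.2 hp1).1, (hT p.1 p.2 hp1).2]
  simp

lemma integral_weakIntegrand {V φ : ℝ × (Fin 3 → ℝ) → ℝ} (hφ : IsTestFunction φ)
    (hV : ∀ T : ℝ, MemLp V 3 (volume.restrict (Icc (-T) T ×ˢ cube))) :
    ∫ p in univ ×ˢ cube, weakIntegrand V φ p =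
      (2 * Real.pi) ^ 3 * ∫ t, ∫ x, weakIntegrand V φ (t, x) ∂torusMeasure := by
  have h := integrableOn_weakIntegrand hφ hV
  rw [Measure.volume_eq_prod] at h ⊢
  rw [setIntegral_prod _ h, Measure.restrict_univ, ← integral_const_mul]
  refine integral_congr_ae (Eventually.of_forall fun t => ?_)
  simp only [integral_torusMeasure, smul_eq_mul]
  rw [mul_inv_cancel_left₀ (by positivity)]

/-- A continuous function on the torus as an element of `L²`. -/
def continuousL2 {h : (Fin 3 → ℝ) → ℝ} (hh : Continuous h) : Lp ℝ 2 torusMeasure :=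
  (memLp_of_continuous hh 2).toLp h

lemma coeFn_continuousL2 {h : (Fin 3 → ℝ) → ℝ} (hh : Continuous h) :
    ∀ᵐ x ∂torusMeasure, continuousL2 hh x = h x :=
  (memLp_of_continuous hh 2).coeFn_toLp

lemma realCoeff_continuousL2 {h : (Fin 3 → ℝ) → ℝ} (hh : Continuous h) (n : Freq) :
    realCoeff (continuousL2 hh) n = torusCoeff h n := by
  rw [realCoeff_apply, torusCoeff]
  refine integral_congr_ae ?_
  filter_upwards [coeFn_continuousL2 hh] with x hx
  rw [hx]

lemma integrable_mul_continuous {h : (Fin 3 → ℝ) → ℝ} (hh : Continuous h)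
    (g : Lp ℝ 2 torusMeasure) : Integrable (fun x => g x * h x) torusMeasure := by
  refine (L2.integrable_inner (𝕜 := ℝ) (continuousL2 hh) g).congr ?_
  filter_upwards [coeFn_continuousL2 hh] with x hx
  rw [hx]
  simp [mul_comm]

/-- Parseval's formula. -/
lemma hasSum_parseval {h : (Fin 3 → ℝ) → ℝ} (hh : Continuous h) (c : FreqL2) :
    HasSum (fun n => (starRingEnd ℂ (torusCoeff h n) * c n).re)
      (∫ x, realSynthesis c x * h x ∂torusMeasure) := by
  have h1 := Complex.reCLM.hasSum (lp.hasSum_inner (𝕜 := ℂ) (realCoeff (continuousL2 hh)) c)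
  have h2 : inner ℂ (realCoeff (continuousL2 hh)) c =
      inner ℂ (ofRealL2 (continuousL2 hh)) (synthesis c) := by
    rw [realCoeff_def, ← synthesis.inner_map_map, LinearIsometryEquiv.apply_symm_apply]
  convert h1 using 1
  · funext n
    simp only [realCoeff_continuousL2, RCLike.inner_apply,
      Complex.reCLM_apply, mul_comm]
  · rw [h2, L2.inner_def]
    have h6 := integral_re (L2.integrable_inner (𝕜 := ℂ) (ofRealL2 (continuousL2 hh))
      (synthesis c))
    rw [Complex.reCLM_apply]
    refine Eq.trans ?_ h6
    refine integral_congr_ae ?_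
    filter_upwards [coeFn_continuousL2 hh, coeFn_ofRealL2 (continuousL2 hh),
      coeFn_reL2 (synthesis c)] with x h3 h4 h5
    rw [realSynthesis_def, h5, h4, h3]
    simp

lemma norm_continuousL2_le {h : (Fin 3 → ℝ) → ℝ} (hh : Continuous h) {M : ℝ}
    (hM : ∀ x ∈ closedCube, ‖h x‖ ≤ M) : ‖continuousL2 hh‖ ≤ M := by
  have h0 : (0 : Fin 3 → ℝ) ∈ closedCube := ⟨le_rfl, fun _ => by positivity⟩
  have hb : ∀ᵐ x ∂torusMeasure, ‖continuousL2 hh x‖ ≤ M := by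
    filter_upwards [coeFn_continuousL2 hh, ae_mem_cube] with x h1 h2
    rw [h1]
    exact hM x (cube_subset_closedCube h2)
  have h5 := Lp.norm_le_of_ae_bound ((norm_nonneg _).trans (hM 0 h0)) hb
  have h6 : measureUnivNNReal torusMeasure = 1 := by simp [measureUnivNNReal]
  simpa only [h6, NNReal.coe_one, Real.one_rpow, one_mul] using h5

/-- The bound does not depend on `F`. It dominates the partial sums when the sum over frequencies is
exchanged with the time integral. -/
lemma abs_sum_parseval_le {h : (Fin 3 → ℝ) → ℝ} (hh : Continuous h) (c : FreqL2)
    (F : Finset Freq) {M R : ℝ} (hM : ∀ x ∈ closedCube, ‖h x‖ ≤ M) (hR : ‖c‖ ≤ R) :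
    |∑ n ∈ F, (starRingEnd ℂ (torusCoeff h n) * c n).re| ≤ M ^ 2 + R ^ 2 := by
  have h1 : ∀ n, |(starRingEnd ℂ (torusCoeff h n) * c n).re| ≤
      ‖realCoeff (continuousL2 hh) n‖ ^ 2 + ‖c n‖ ^ 2 := fun n => by
    refine (Complex.abs_re_le_norm _).trans ?_
    rw [norm_mul, RCLike.norm_conj, realCoeff_continuousL2]
    nlinarith [sq_nonneg (‖torusCoeff h n‖ - ‖c n‖), sq_nonneg ‖torusCoeff h n‖,
      sq_nonneg ‖c n‖]
  refine (Finset.abs_sum_le_sum_abs _ _).trans ((Finset.sum_le_sum fun n _ => h1 n).trans ?_)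
  rw [Finset.sum_add_distrib]
  refine add_le_add ?_ ?_
  · refine ((realCoeff (continuousL2 hh)).summable_sq.sum_le_tsum F
      fun _ _ => sq_nonneg _).trans ?_
    rw [← FreqL2.norm_sq, norm_realCoeff]
    exact pow_le_pow_left₀ (norm_nonneg _) (norm_continuousL2_le hh hM) 2
  · refine (c.summable_sq.sum_le_tsum F fun _ _ => sq_nonneg _).trans ?_
    rw [← FreqL2.norm_sq]
    exact pow_le_pow_left₀ (norm_nonneg _) hR 2

lemma IsTestFunction.continuous_torusCoeff {φ : ℝ × (Fin 3 → ℝ) → ℝ} (hφ : IsTestFunction φ)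
    (n : Freq) : Continuous fun t => torusCoeff (fun x => φ (t, x)) n :=
  continuous_iff_continuousAt.2 fun t => (hφ.hasDerivAt_torusCoeff t n).continuousAt

/-- The equation for the Fourier coefficients implies the weak formulation. -/
lemma integral_weakIntegrand_eq_zero {V φ : ℝ × (Fin 3 → ℝ) → ℝ} (hφ : IsTestFunction φ)
    {Y N : ℝ → FreqL2} (hY : Continuous Y) (hN : Continuous N)
    (hVY : ∀ t, ∀ᵐ x ∂torusMeasure, V (t, x) = realSynthesis (Y t) x)
    (hVN : ∀ t, ∀ᵐ x ∂torusMeasure, V (t, x) ^ 3 = realSynthesis (N t) x)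
    {Z : ℝ → Freq → ℂ} (hYZ : ∀ t n, HasDerivAt (fun τ => Y τ n) (Z t n) t)
    (hZ : ∀ t n, HasDerivAt (fun τ => Z τ n) (-(lenSq n : ℂ) * Y t n - N t n) t) :
    ∫ t, ∫ x, weakIntegrand V φ (t, x) ∂torusMeasure = 0 := by
  obtain ⟨T₀, hT₀⟩ := hφ.waveOp_eq_zero
  obtain ⟨T₁, hT₁⟩ := (hφ.dirDeriv timeDir).compactSupport
  -- The margin makes the test function and its time derivative vanish at the endpoints `±T`
  -- themselves.
  set T : ℝ := |T₀| + |T₁| + 1 with hTdef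
  have hTpos : 0 < T := by positivity
  have hTT₀ : T₀ < T := by linarith [le_abs_self T₀, abs_nonneg T₁]
  have hTT₁ : T₁ < T := by linarith [le_abs_self T₁, abs_nonneg T₀]
  let F : Freq → ℝ → ℝ := fun n t =>
    (starRingEnd ℂ (torusCoeff (fun x => waveOp φ (t, x)) n) * Y t n).re +
      (starRingEnd ℂ (torusCoeff (fun x => φ (t, x)) n) * N t n).re
  have hsum : ∀ t, HasSum (fun n => F n t) (∫ x, weakIntegrand V φ (t, x) ∂torusMeasure) :=
    fun t => by
    have hc1 := continuous_slice hφ.continuous_waveOp t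
    have hc2 := continuous_slice hφ.continuous t
    have h1 : ∫ x, weakIntegrand V φ (t, x) ∂torusMeasure =
        (∫ x, realSynthesis (Y t) x * waveOp φ (t, x) ∂torusMeasure) +
          ∫ x, realSynthesis (N t) x * φ (t, x) ∂torusMeasure := by
      rw [← integral_add (integrable_mul_continuous hc1 _) (integrable_mul_continuous hc2 _)]
      refine integral_congr_ae ?_
      filter_upwards [hVY t, hVN t] with x h2 h3
      rw [weakIntegrand, h3, h2]
    rw [h1]
    exact (hasSum_parseval hc1 (Y t)).add (hasSum_parseval hc2 (N t))
  have hFm : ∀ n, Continuous (F n) := fun n => by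
    have hYn : Continuous fun t => Y t n := (coordCLM n).continuous.comp hY
    have hNn : Continuous fun t => N t n := (coordCLM n).continuous.comp hN
    have hw : Continuous fun t => torusCoeff (fun x => waveOp φ (t, x)) n := by
      simp only [hφ.torusCoeff_waveOp]
      exact (((hφ.dirDeriv timeDir).dirDeriv timeDir).continuous_torusCoeff n).add
        (continuous_const.mul (hφ.continuous_torusCoeff n))
    exact (Complex.continuous_re.comp ((Complex.continuous_conj.comp hw).mul hYn)).add
      (Complex.continuous_re.comp
        ((Complex.continuous_conj.comp (hφ.continuous_torusCoeff n)).mul hNn))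
  have hzero : ∀ n, ∫ t in (-T)..T, F n t = 0 := fun n => by
    let A : ℝ → ℂ := fun t => torusCoeff (fun x => φ (t, x)) n
    let A' : ℝ → ℂ := fun t => torusCoeff (fun x => dirDeriv timeDir φ (t, x)) n
    have hA : ∀ t, HasDerivAt (fun τ => starRingEnd ℂ (A τ)) (starRingEnd ℂ (A' t)) t := fun t =>
      (Complex.conjCLE : ℂ →L[ℝ] ℂ).hasFDerivAt.comp_hasDerivAt t (hφ.hasDerivAt_torusCoeff t n)
    have hA' : ∀ t, HasDerivAt (fun τ => starRingEnd ℂ (A' τ)) (starRingEnd ℂ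
        (torusCoeff (fun x => dirDeriv timeDir (dirDeriv timeDir φ) (t, x)) n)) t := fun t =>
      (Complex.conjCLE : ℂ →L[ℝ] ℂ).hasFDerivAt.comp_hasDerivAt t
        ((hφ.dirDeriv timeDir).hasDerivAt_torusCoeff t n)
    -- `F n` is an exact derivative: the cross terms `conj A' * Z` cancel, and the equation for `Z`
    -- converts `-conj A * Z'` into `conj A * (|n|² Y + N)`. The boundary values vanish with `A` and
    -- `A'`.
    have hB : ∀ t, HasDerivAt
        (fun τ => (starRingEnd ℂ (A' τ) * Y τ n - starRingEnd ℂ (A τ) * Z τ n).re) (F n t) t :=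
      fun t => by
      have h1 := Complex.reCLM.hasFDerivAt.comp_hasDerivAt t
        (((hA' t).mul (hYZ t n)).sub ((hA t).mul (hZ t n)))
      refine h1.congr_deriv ?_
      simp only [F, hφ.torusCoeff_waveOp, Complex.reCLM_apply, ← Complex.add_re]
      congr 1
      simp only [map_add, map_mul, Complex.conj_ofReal, A, A']
      ring
    have hAz : ∀ t, T ≤ |t| → A t = 0 ∧ A' t = 0 := fun t ht => by
      constructor
      · simp only [A, torusCoeff, (hT₀ t _ (hTT₀.trans_le ht)).1]
        simp
      · simp only [A', torusCoeff, hT₁ t _ (hTT₁.trans_le ht)]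
        simp
    rw [intervalIntegral.integral_eq_sub_of_hasDerivAt (fun t _ => hB t)
      ((hFm n).intervalIntegrable _ _)]
    have e1 := hAz T (le_abs_self T)
    have e2 := hAz (-T) (by rw [abs_neg]; exact le_abs_self T)
    simp [e1.1, e1.2, e2.1, e2.2]
  -- Dominated convergence passes from finite sums of frequencies to the full spatial integral.
  have hlim : Tendsto (fun k => ∫ t in (-T)..T, ∑ n ∈ freqBall k, F n t) atTop
      (𝓝 (∫ t in (-T)..T, ∫ x, weakIntegrand V φ (t, x) ∂torusMeasure)) := by
    obtain ⟨M, hM⟩ := exists_bound_on_strip hφ.continuous T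
    obtain ⟨M', hM'⟩ := exists_bound_on_strip hφ.continuous_waveOp T
    obtain ⟨R, hR⟩ := (isCompact_Icc (a := -T) (b := T)).exists_bound_of_continuousOn
      hY.continuousOn
    obtain ⟨R', hR'⟩ := (isCompact_Icc (a := -T) (b := T)).exists_bound_of_continuousOn
      hN.continuousOn
    refine intervalIntegral.tendsto_integral_filter_of_dominated_convergence
      (fun _ => (M' ^ 2 + R ^ 2) + (M ^ 2 + R' ^ 2)) (Eventually.of_forall fun k =>
        (continuous_finsetSum _ fun n _ => hFm n).aestronglyMeasurable)
      (Eventually.of_forall fun k => Eventually.of_forall fun t ht => ?_)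
      intervalIntegrable_const
      (Eventually.of_forall fun t _ => (hsum t).comp tendsto_freqBall)
    rw [uIoc_of_le (by linarith)] at ht
    have ht' : t ∈ Icc (-T) T := Ioc_subset_Icc_self ht
    rw [Real.norm_eq_abs, Finset.sum_add_distrib]
    refine (abs_add_le _ _).trans (add_le_add ?_ ?_)
    · exact abs_sum_parseval_le (continuous_slice hφ.continuous_waveOp t) _ _
        (hM' t (abs_le.2 ht')) (hR t ht')
    · exact abs_sum_parseval_le (continuous_slice hφ.continuous t) _ _
        (hM t (abs_le.2 ht')) (hR' t ht')
  have hk : ∀ k, ∫ t in (-T)..T, ∑ n ∈ freqBall k, F n t = 0 := fun k => by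
    rw [intervalIntegral.integral_finsetSum fun n _ => (hFm n).intervalIntegrable _ _]
    exact Finset.sum_eq_zero fun n _ => hzero n
  simp only [hk] at hlim
  rw [← setIntegral_eq_integral_of_forall_compl_eq_zero (s := Ioc (-T) T),
    ← intervalIntegral.integral_of_le (by linarith)]
  · exact tendsto_nhds_unique hlim tendsto_const_nhds
  · intro t ht
    have h1 : T₀ < |t| := by
      refine hTT₀.trans_le ?_
      by_contra hcon
      have := abs_lt.1 (not_le.1 hcon)
      exact ht ⟨this.1, this.2.le⟩
    simp [weakIntegrand, (hT₀ t _ h1).1, (hT₀ t _ h1).2]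

end WeakFormulation

/-! ## Existence of solutions -/

section Existence

open Filter Topology Set

variable {s : ℝ} {f : ℝ × (Fin 3 → ℝ) → ℝ}

/-- The continuous function `f` represents the free evolution with datum `v`. -/
structure RepresentsFree (f : ℝ × (Fin 3 → ℝ) → ℝ) (v : PhaseSpace s) : Prop where
  continuous : Continuous f
  coeffs : ∀ t, HasFourierCoeffs (fun x => f (t, x)) (freeEvolution t v).1.coeff

lemma inclEnergy_sub (hs : s ≤ 1) (w w' : Hs 1 × Hs 0) :
    inclEnergy hs (w - w') = inclEnergy hs w - inclEnergy hs w' := by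
  rw [eq_sub_iff_add_eq, ← inclEnergy_add, sub_add_cancel]

/-- The `L²` function `f(t) + w`, for `(w, ∂ₜw) = h`. -/
def perturbedL2 (hf : Continuous f) (t : ℝ) (h : Hs 1 × Hs 0) : Lp ℝ 2 torusMeasure :=
  continuousL2 (continuous_slice hf t) + realSynthesis (smoothing (encode h))

lemma coeFn_perturbedL2 (hf : Continuous f) (t : ℝ) (h : Hs 1 × Hs 0) :
    ∀ᵐ x ∂torusMeasure, perturbedL2 hf t h x = f (t, x) + sobolevL6 (encode h) x := by
  filter_upwards [Lp.coeFn_add (continuousL2 (continuous_slice hf t))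
    (realSynthesis (smoothing (encode h))), coeFn_continuousL2 (continuous_slice hf t),
    coeFn_sobolevL6 (encode h)] with x h1 h2 h3
  rw [perturbedL2, h1, Pi.add_apply, h2, h3]

lemma coeFn_cubicTerm (hf : Continuous f) (t : ℝ) (h : Hs 1 × Hs 0) :
    ∀ᵐ x ∂torusMeasure, cubicTerm hf t h x = (f (t, x) + sobolevL6 (encode h) x) ^ 3 := by
  filter_upwards [coeFn_tripleMul (sliceL6 hf t + sobolevL6 (encode h))
    (sliceL6 hf t + sobolevL6 (encode h)) (sliceL6 hf t + sobolevL6 (encode h)),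
    Lp.coeFn_add (sliceL6 hf t) (sobolevL6 (encode h)), coeFn_sliceL6 hf t] with x h1 h2 h3
  rw [cubicTerm, h1, h2, Pi.add_apply, h3]
  ring

lemma RepresentsFree.realCoeff_perturbedL2 {v : PhaseSpace s} (hv : RepresentsFree f v)
    (t : ℝ) (h : Hs 1 × Hs 0) (n : Freq) :
    realCoeff (perturbedL2 hv.continuous t h) n =
      (freeEvolution t v).1.coeff n + h.1.coeff n := by
  rw [perturbedL2, map_add, lp.coeFn_add, Pi.add_apply, realSynthesis_smoothing_encode,
    realCoeff_continuousL2, torusCoeff, (hasFourierCoeffs_iff.1 (hv.coeffs t)).2]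

lemma hasFourierCoeffs_of_ae_eq {V : (Fin 3 → ℝ) → ℝ} {g : Lp ℝ 2 torusMeasure}
    (h : ∀ᵐ x ∂torusMeasure, V x = g x) : HasFourierCoeffs V (realCoeff g) := by
  refine hasFourierCoeffs_iff.2 ⟨?_, fun n => ?_⟩
  · exact ((Lp.memLp g).integrable (by norm_num)).congr (h.mono fun x hx => hx.symm)
  · rw [realCoeff_apply]
    refine integral_congr_ae ?_
    filter_upwards [h] with x hx
    rw [hx]

/-- The curve `(v, ∂ₜv)` that is the sum of a free evolution and a curve in the energy space. -/
def perturbedCurve (hs : s ≤ 1) (v : PhaseSpace s) (W : ℝ → Hs 1 × Hs 0) (t : ℝ) :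
    PhaseSpace s := freeEvolution t v + inclEnergy hs (W t)

lemma perturbedCurve_fst_coeff (hs : s ≤ 1) (v : PhaseSpace s) (W : ℝ → Hs 1 × Hs 0) (t : ℝ)
    (n : Freq) : (perturbedCurve hs v W t).1.coeff n =
      (freeEvolution t v).1.coeff n + (W t).1.coeff n := by
  rw [perturbedCurve, Prod.fst_add, Hs.coeff_add, Pi.add_apply, inclEnergy_fst_coeff]

lemma perturbedCurve_snd_coeff (hs : s ≤ 1) (v : PhaseSpace s) (W : ℝ → Hs 1 × Hs 0) (t : ℝ)
    (n : Freq) : (perturbedCurve hs v W t).2.coeff n =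
      (freeEvolution t v).2.coeff n + (W t).2.coeff n := by
  rw [perturbedCurve, Prod.snd_add, Hs.coeff_add, Pi.add_apply, inclEnergy_snd_coeff]

lemma continuous_perturbedCurve (hs : s ≤ 1) (v : PhaseSpace s) {W : ℝ → Hs 1 × Hs 0}
    (hW : Continuous W) : Continuous (perturbedCurve hs v W) :=
  (continuous_freeEvolution v).add ((continuous_inclEnergy hs).comp hW)

/-- The representing function is `f` plus the jointly measurable representative of `w`. As `s ≥ 0`,
the solution is a continuous curve in `L²`, to which Parseval's formula applies. -/
lemma SolvesPerturbed.solvesCubicWave (hs₀ : 0 ≤ s) (hs : s ≤ 1) {v : PhaseSpace s}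
    (hv : RepresentsFree f v) {W : ℝ → Hs 1 × Hs 0} (hW : SolvesPerturbed hv.continuous W) :
    SolvesCubicWave fun t => (perturbedCurve hs v W t).1 := by
  have hVae : ∀ t, ∀ᵐ x ∂torusMeasure,
      f (t, x) + spaceTimeRep W (t, x) = f (t, x) + sobolevL6 (encode (W t)) x := fun t => by
    filter_upwards [ae_spaceTimeRep W t] with x hx
    rw [hx]
  have hL2 : ∀ t, ∀ᵐ x ∂torusMeasure,
      f (t, x) + spaceTimeRep W (t, x) = perturbedL2 hv.continuous t (W t) x := fun t => by
    filter_upwards [hVae t, coeFn_perturbedL2 hv.continuous t (W t)] with x h1 h2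
    rw [h1, h2]
  have hLp : ∀ T : ℝ, MemLp (fun p => f p + spaceTimeRep W p) 3
      (volume.restrict (Icc (-T) T ×ˢ cube)) := by
    refine memLp_of_continuous_slices
      (hv.continuous.measurable.add (measurable_spaceTimeRep hW.continuous))
      (g := fun t => sliceL6 hv.continuous t + sobolevL6 (encode (W t)))
      ((continuous_sliceL6 hv.continuous).add
        (sobolevL6.continuous.comp (continuous_encode.comp hW.continuous))) fun t => ?_
    filter_upwards [hVae t, Lp.coeFn_add (sliceL6 hv.continuous t) (sobolevL6 (encode (W t))),
      coeFn_sliceL6 hv.continuous t] with x h1 h2 h3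
    rw [h1, h2, Pi.add_apply, h3]
  refine ⟨fun p => f p + spaceTimeRep W p, hLp, Eventually.of_forall fun t => ?_, fun φ hφ => ?_⟩
  · have h1 := hasFourierCoeffs_of_ae_eq (hL2 t)
    have h2 : (realCoeff (perturbedL2 hv.continuous t (W t)) : Freq → ℂ) =
        (perturbedCurve hs v W t).1.coeff := by
      funext n
      rw [hv.realCoeff_perturbedL2, perturbedCurve_fst_coeff]
    rwa [h2] at h1
  · have h0 := integral_weakIntegrand hφ hLp
    refine h0.trans ?_
    let Y : ℝ → FreqL2 := fun t => Hs.toLp 0 ((perturbedCurve hs v W t).1.incl hs₀)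
    have hYn : ∀ t n, Y t n = (freeEvolution t v).1.coeff n + (W t).1.coeff n := fun t n => by
      simp only [Y]
      rw [Hs.toLp_apply, Hs.incl_coeff, perturbedCurve_fst_coeff, Real.rpow_zero,
        Complex.ofReal_one, one_mul]
    have hYr : ∀ t, Y t = realCoeff (perturbedL2 hv.continuous t (W t)) := fun t => by
      ext n
      rw [hYn, hv.realCoeff_perturbedL2]
    rw [integral_weakIntegrand_eq_zero hφ (Y := Y)
      (N := fun t => realCoeff (cubicTerm hv.continuous t (W t)))
      (Z := fun t n => (freeEvolution t v).2.coeff n + (W t).2.coeff n), mul_zero]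
    · exact Hs.continuous_iff.1 ((Hs.continuous_incl hs₀).comp
        (continuous_fst.comp (continuous_perturbedCurve hs v hW.continuous)))
    · exact realCoeff.continuous.comp (continuous_cubicTerm hv.continuous hW.continuous)
    · intro t
      rw [hYr, realSynthesis_realCoeff]
      exact hL2 t
    · intro t
      rw [realSynthesis_realCoeff]
      filter_upwards [hVae t, coeFn_cubicTerm hv.continuous t (W t)] with x h1 h2
      rw [h1, h2]
    · intro t n
      simp only [hYn]
      exact (hasDerivAt_freeEvolution_fst v n t).add (hW.deriv_fst t n)
    · intro t n
      refine ((hasDerivAt_freeEvolution_snd v n t).add (hW.deriv_snd t n)).congr_deriv ?_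
      rw [hYn]
      ring

theorem SolvesPerturbed.isGlobalSolution (hs₀ : 0 ≤ s) (hs : s ≤ 1) {v : PhaseSpace s}
    (hv : RepresentsFree f v) {W : ℝ → Hs 1 × Hs 0} (hW : SolvesPerturbed hv.continuous W) :
    IsGlobalSolution hs (v + inclEnergy hs (W 0)) (perturbedCurve hs v W) where
  initial := by rw [perturbedCurve, freeEvolution_zero]
  deriv t := by
    refine Hs.hasDerivAt_of_coeff (d := fun t => (perturbedCurve hs v W t).2)
      (continuous_snd.comp (continuous_perturbedCurve hs v hW.continuous)) (fun n t => ?_) t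
    simp only [Hs.incl_coeff, perturbedCurve_fst_coeff, perturbedCurve_snd_coeff]
    exact (hasDerivAt_freeEvolution_fst v n t).add (hW.deriv_fst t n)
  equation := hW.solvesCubicWave hs₀ hs hv
  remainder := by
    -- The remainder is measured from the free evolution of the whole datum, which already contains
    -- that of `W 0`.
    refine ⟨fun t => W t - energyEvolution t (W 0),
      hW.continuous.sub (continuous_energyEvolution _), fun t => ?_⟩
    rw [inclEnergy_sub, inclEnergy_energyEvolution, freeEvolution_add, perturbedCurve]
    abel

end Existence

/-! ## Weak derivatives of continuous functions of one variable -/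

section WeakDerivative

open Filter Topology Set
open scoped ContDiff Convolution

/-- Mollification: the derivative of `ρₖ * H` at a point tests `H` against the derivative of a
reflected translate of `ρₖ`, so it vanishes. Each mollification is constant, and so is the limit. -/
lemma eq_of_forall_integral_deriv_eq_zero {H : ℝ → ℝ} (hH : Continuous H)
    (h : ∀ ψ : ℝ → ℝ, ContDiff ℝ ∞ ψ → HasCompactSupport ψ → ∫ t, deriv ψ t * H t = 0)
    (a b : ℝ) : H a = H b := by
  let ρ : ℕ → ContDiffBump (0 : ℝ) := fun k =>
    ⟨1 / (k + 1) / 2, 1 / (k + 1), by positivity, half_lt_self (by positivity)⟩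
  have hρ : Tendsto (fun k => (ρ k).rOut) atTop (𝓝 0) := tendsto_one_div_add_atTop_nhds_zero_nat
  have hlim := ContDiffBump.convolution_tendsto_right_of_continuous (μ := volume) hρ hH
  have hconst : ∀ k, ((ρ k).normed volume ⋆[ContinuousLinearMap.lsmul ℝ ℝ, volume] H) a =
      ((ρ k).normed volume ⋆[ContinuousLinearMap.lsmul ℝ ℝ, volume] H) b := fun k => by
    have hsm : ContDiff ℝ ∞ ((ρ k).normed volume) := (ρ k).contDiff_normed
    have hcs : HasCompactSupport ((ρ k).normed volume) := (ρ k).hasCompactSupport_normed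
    have hd := fun x => hcs.hasDerivAt_convolution_left (μ := volume)
      (ContinuousLinearMap.lsmul ℝ ℝ) (hsm.of_le (by simp)) hH.locallyIntegrable x
    refine is_const_of_deriv_eq_zero (fun x => (hd x).differentiableAt) (fun x => ?_) a b
    rw [(hd x).deriv, convolution_eq_swap]
    have h1 := h (fun t => (ρ k).normed volume (x - t)) (hsm.comp (contDiff_const.sub contDiff_id))
      (hcs.comp_homeomorph (Homeomorph.subLeft x))
    have h2 : ∀ t, deriv (fun t => (ρ k).normed volume (x - t)) t =
        -deriv ((ρ k).normed volume) (x - t) := fun t => deriv_comp_const_sub _ _ _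
    simp only [h2, neg_mul, integral_neg, neg_eq_zero] at h1
    simpa using h1
  exact tendsto_nhds_unique (hlim a) ((hlim b).congr fun k => (hconst k).symm)

/-- With `G = ∫ g`, integrating by parts gives `∫ ψ'(u' + G) = -∫ (ψ''u + ψg) = 0`. Hence `u' + G`
is constant. -/
lemma hasDerivAt_of_weak {u u' g : ℝ → ℝ} (hu : ∀ t, HasDerivAt u (u' t) t)
    (hu' : Continuous u') (hg : Continuous g)
    (h : ∀ ψ : ℝ → ℝ, ContDiff ℝ ∞ ψ → HasCompactSupport ψ →
      ∫ t, (deriv (deriv ψ) t * u t + ψ t * g t) = 0) (t : ℝ) : HasDerivAt u' (-g t) t := by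
  have hG : ∀ t, HasDerivAt (fun t => ∫ r in (0 : ℝ)..t, g r) (g t) t := fun t =>
    intervalIntegral.integral_hasDerivAt_right (hg.intervalIntegrable _ _)
      hg.aestronglyMeasurable.stronglyMeasurableAtFilter hg.continuousAt
  have hGc : Continuous fun t => ∫ r in (0 : ℝ)..t, g r :=
    continuous_iff_continuousAt.2 fun t => (hG t).continuousAt
  have huc : Continuous u := continuous_iff_continuousAt.2 fun t => (hu t).continuousAt
  have hconst := eq_of_forall_integral_deriv_eq_zero (hu'.add hGc) fun ψ hψ hψc => by
    have hψ1 : ContDiff ℝ ∞ (deriv ψ) := hψ.iterate_deriv 1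
    have hψ2 : ContDiff ℝ ∞ (deriv (deriv ψ)) := hψ1.iterate_deriv 1
    have hd : ∀ t, HasDerivAt ψ (deriv ψ t) t := fun t =>
      (hψ.differentiable (by simp) t).hasDerivAt
    have hd1 : ∀ t, HasDerivAt (deriv ψ) (deriv (deriv ψ) t) t := fun t =>
      (hψ1.differentiable (by simp) t).hasDerivAt
    have hInt : ∀ {p q : ℝ → ℝ}, Continuous p → HasCompactSupport p → Continuous q →
        Integrable fun t => p t * q t := fun hp hpc hq =>
      (hp.mul hq).integrable_of_hasCompactSupport hpc.mul_right
    have i1 := hInt hψ1.continuous hψc.deriv hu'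
    have i2 := hInt hψ2.continuous hψc.deriv.deriv huc
    have i3 := hInt hψ.continuous hψc hg
    have i4 := hInt hψ1.continuous hψc.deriv hGc
    have e1 := integral_mul_deriv_eq_deriv_mul_of_integrable (fun t _ => hd1 t) (fun t _ => hu t)
      i1 i2 (hInt hψ1.continuous hψc.deriv huc)
    have e2 := integral_mul_deriv_eq_deriv_mul_of_integrable (fun t _ => hd t) (fun t _ => hG t)
      i3 i4 (hInt hψ.continuous hψc hGc)
    have e3 := h ψ hψ hψc
    rw [integral_add i2 i3] at e3
    simp only [Pi.add_apply, mul_add]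
    rw [integral_add i1 i4]
    linarith
  have hu'eq : ∀ r, u' r = u' 0 - ∫ x in (0 : ℝ)..r, g x := fun r => by
    have h1 := hconst r 0
    simp only [Pi.add_apply, intervalIntegral.integral_same] at h1
    linarith
  exact ((hG t).const_sub (u' 0)).congr_of_eventuallyEq (Eventually.of_forall hu'eq)

end WeakDerivative

/-! ## Uniqueness of solutions -/

section Uniqueness

open Filter Topology Set
open scoped ContDiff

/-- The product of a function of time and a component of a character. -/
def productTest (ψ : ℝ → ℝ) (K : ℂ →L[ℝ] ℝ) (n : Freq) (p : ℝ × (Fin 3 → ℝ)) : ℝ :=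
  ψ p.1 * K (starRingEnd ℂ (character n p.2))

lemma isTestFunction_productTest {ψ : ℝ → ℝ} (hψ : ContDiff ℝ ∞ ψ) (hψc : HasCompactSupport ψ)
    (K : ℂ →L[ℝ] ℝ) (n : Freq) : IsTestFunction (productTest ψ K n) where
  smooth := by
    have h : ContDiff ℝ ∞ fun p : ℝ × (Fin 3 → ℝ) => starRingEnd ℂ (character n p.2) :=
      (Complex.conjCLE : ℂ →L[ℝ] ℂ).contDiff.comp ((contDiff_character n).comp contDiff_snd)
    exact (hψ.comp contDiff_fst).mul (K.contDiff.comp h)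
  periodic t x m := by simp only [productTest, character_add_period]
  compactSupport := by
    obtain ⟨T, hT⟩ := hψc.isCompact.isBounded.exists_norm_le
    refine ⟨T, fun t x ht => ?_⟩
    have : ψ t = 0 := by
      by_contra h
      exact absurd (hT t (subset_tsupport ψ h)) (not_le.2 ht)
    rw [productTest, this, zero_mul]

lemma hasDerivAt_conj_character_update (n : Freq) (x : Fin 3 → ℝ) (i : Fin 3) (r : ℝ) :
    HasDerivAt (fun r => starRingEnd ℂ (character n (Function.update x i r)))
      (-(Complex.I * n i) * starRingEnd ℂ (character n (Function.update x i r))) r := by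
  simp only [← character_neg]
  have h := (hasFDerivAt_character (-n) (Function.update x i r)).comp_hasDerivAt r
    (hasDerivAt_update x i r)
  refine h.congr_deriv ?_
  simp only [FunLike.coe_sum, Finset.sum_apply, FunLike.coe_smul, Pi.smul_apply,
    ContinuousLinearMap.comp_apply, ContinuousLinearMap.proj_apply, Complex.ofRealCLM_apply,
    smul_eq_mul]
  rw [Finset.sum_eq_single i]
  · simp
  · intro j _ hj
    simp [Pi.single_eq_of_ne hj]
  · simp

lemma waveOp_productTest (ψ : ℝ → ℝ) (K : ℂ →L[ℝ] ℝ) (n : Freq) (p : ℝ × (Fin 3 → ℝ)) :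
    waveOp (productTest ψ K n) p =
      (deriv (deriv ψ) p.1 + lenSq n * ψ p.1) * K (starRingEnd ℂ (character n p.2)) := by
  have ht : iteratedDeriv 2 (fun τ => productTest ψ K n (τ, p.2)) p.1 =
      deriv (deriv ψ) p.1 * K (starRingEnd ℂ (character n p.2)) := by
    unfold productTest
    have h1 : deriv (fun τ => ψ τ * K (starRingEnd ℂ (character n p.2))) =
        fun τ => deriv ψ τ * K (starRingEnd ℂ (character n p.2)) :=
      funext fun τ => deriv_mul_const_field _
    rw [iteratedDeriv_succ, iteratedDeriv_one, h1]
    exact deriv_mul_const_field _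
  have hx : ∀ i, iteratedDeriv 2 (fun r => productTest ψ K n (p.1, Function.update p.2 i r))
      (p.2 i) = -((n i : ℝ) ^ 2) * (ψ p.1 * K (starRingEnd ℂ (character n p.2))) := fun i => by
    unfold productTest
    have h1 : deriv (fun r => ψ p.1 * K (starRingEnd ℂ (character n (Function.update p.2 i r)))) =
        fun r => ψ p.1 * K (-(Complex.I * n i) *
          starRingEnd ℂ (character n (Function.update p.2 i r))) := funext fun r =>
      ((K.hasFDerivAt.comp_hasDerivAt r
        (hasDerivAt_conj_character_update n p.2 i r)).const_mul _).deriv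
    rw [iteratedDeriv_succ, iteratedDeriv_one, h1]
    refine ((K.hasFDerivAt.comp_hasDerivAt (p.2 i) ((hasDerivAt_conj_character_update n p.2 i
      (p.2 i)).const_mul (-(Complex.I * n i)))).const_mul (ψ p.1)).deriv.trans ?_
    rw [Function.update_eq_self]
    have h2 : -(Complex.I * n i) * (-(Complex.I * n i) * starRingEnd ℂ (character n p.2)) =
        (-((n i : ℝ) ^ 2)) • starRingEnd ℂ (character n p.2) := by
      rw [Complex.real_smul]
      push_cast
      linear_combination (n i : ℂ) ^ 2 * starRingEnd ℂ (character n p.2) * Complex.I_sq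
    rw [h2, map_smul, smul_eq_mul]
    ring
  rw [waveOp, ht, Finset.sum_congr rfl fun i _ => hx i, ← Finset.sum_mul,
    Finset.sum_neg_distrib, lenSq]
  ring

lemma integral_mul_character (g : Lp ℝ 2 torusMeasure) (K : ℂ →L[ℝ] ℝ) (n : Freq) :
    Integrable (fun x => g x * K (starRingEnd ℂ (character n x))) torusMeasure ∧
    ∫ x, g x * K (starRingEnd ℂ (character n x)) ∂torusMeasure = K (realCoeff g n) := by
  have hi : Integrable (fun x => (g x : ℂ) * starRingEnd ℂ (character n x)) torusMeasure :=
    integrable_mul_conj_character ((Lp.memLp g).integrable (by norm_num)).ofReal n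
  have hK : ∀ x, K ((g x : ℂ) * starRingEnd ℂ (character n x)) =
      g x * K (starRingEnd ℂ (character n x)) := fun x => by
    rw [← Complex.real_smul, map_smul, smul_eq_mul]
  constructor
  · exact (K.integrable_comp hi).congr (Eventually.of_forall hK)
  · rw [realCoeff_apply, ← K.integral_comp_comm hi]
    exact integral_congr_ae (Eventually.of_forall fun x => (hK x).symm)

/-- An integrable function with an integrable cube is in `L²`. -/
lemma memLp_two_of_integrable_cube {g : (Fin 3 → ℝ) → ℝ} (h1 : Integrable g torusMeasure)
    (h3 : Integrable (fun x => ‖g x‖ ^ 3) torusMeasure) : MemLp g 2 torusMeasure := by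
  rw [memLp_two_iff_integrable_sq h1.1]
  refine (h1.norm.add h3).mono' (h1.1.pow 2) (Eventually.of_forall fun x => ?_)
  have h0 := norm_nonneg (g x)
  rw [norm_pow, Pi.add_apply]
  nlinarith [mul_nonneg h0 (sq_nonneg (‖g x‖ - 1)), mul_nonneg h0 h0]

/-- Fubini on the strips `|t| ≤ T` for integer `T`, a countable family, so that one null set of
times suffices. -/
lemma ae_integrable_cube {V : ℝ × (Fin 3 → ℝ) → ℝ}
    (hV : ∀ T : ℝ, MemLp V 3 (volume.restrict (Icc (-T) T ×ˢ cube))) :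
    ∀ᵐ t : ℝ, Integrable (fun x => ‖V (t, x)‖ ^ 3) torusMeasure := by
  have h : ∀ T : ℕ, ∀ᵐ t : ℝ, t ∈ Icc (-(T : ℝ)) T →
      Integrable (fun x => ‖V (t, x)‖ ^ 3) torusMeasure := fun T => by
    have h1 := (hV T).integrable_norm_pow (by norm_num)
    rw [Measure.volume_eq_prod, ← Measure.prod_restrict] at h1
    have h2 := h1.prod_right_ae
    rw [ae_restrict_iff' measurableSet_Icc] at h2
    filter_upwards [h2] with t ht htT
    exact integrable_torusMeasure_iff.2 (ht htT)
  filter_upwards [ae_all_iff.2 h] with t ht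
  obtain ⟨T, hT⟩ := exists_nat_ge |t|
  exact ht T (abs_le.1 hT)

/-- Test functions are real, so the complex coefficients are reached only through real functionals;
`Re` and `Im` recover them. -/
lemma hasDerivAt_of_components {y : ℝ → ℂ} {d : ℂ} {t : ℝ}
    (h : ∀ K : ℂ →L[ℝ] ℝ, HasDerivAt (fun τ => K (y τ)) (K d) t) : HasDerivAt y d t := by
  have h1 := (h Complex.reCLM).ofReal_comp
  have h2 := (h Complex.imCLM).ofReal_comp.mul_const Complex.I
  refine ((h1.add h2).congr_deriv (Complex.re_add_im d)).congr_of_eventuallyEq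
    (Eventually.of_forall fun τ => (Complex.re_add_im (y τ)).symm)

variable {s : ℝ} {f : ℝ × (Fin 3 → ℝ) → ℝ}

/-- The weak formulation implies the equation for the Fourier coefficients. -/
lemma SolvesCubicWave.hasDerivAt_snd {hs : s ≤ 1} {v : PhaseSpace s}
    (hv : RepresentsFree f v) {W : ℝ → Hs 1 × Hs 0} (hW : Continuous W)
    (hd : ∀ t n, HasDerivAt (fun τ => (W τ).1.coeff n) ((W t).2.coeff n) t)
    (h : SolvesCubicWave fun t => (perturbedCurve hs v W t).1) (t : ℝ) (n : Freq) :
    HasDerivAt (fun τ => (W τ).2.coeff n)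
      (-(lenSq n : ℂ) * (W t).1.coeff n - realCoeff (cubicTerm hv.continuous t (W t)) n) t := by
  obtain ⟨V, hV, hVc, hweak⟩ := h
  let y : ℝ → ℂ := fun t => (freeEvolution t v).1.coeff n + (W t).1.coeff n
  let y' : ℝ → ℂ := fun t => (freeEvolution t v).2.coeff n + (W t).2.coeff n
  let N : ℝ → ℂ := fun t => realCoeff (cubicTerm hv.continuous t (W t)) n
  have hy : ∀ t, HasDerivAt y (y' t) t := fun t =>
    (hasDerivAt_freeEvolution_fst v n t).add (hd t n)
  have hyc : Continuous y := continuous_iff_continuousAt.2 fun t => (hy t).continuousAt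
  have hy'c : Continuous y' :=
    (continuous_iff_continuousAt.2 fun t => (hasDerivAt_freeEvolution_snd v n t).continuousAt).add
      (Hs.continuous_coeff (continuous_snd.comp hW) n)
  have hNc : Continuous N := (coordCLM n).continuous.comp
    (realCoeff.continuous.comp (continuous_cubicTerm hv.continuous hW))
  -- For almost every time the slice of `V` lies in `L²`, where Fourier coefficients determine it.
  -- This identifies `V` with `f + w`, and hence `V³` with the cubic term, which coefficients of `V`
  -- alone do not show.
  have hVae : ∀ᵐ t : ℝ, ∀ᵐ x ∂torusMeasure, V (t, x) = perturbedL2 hv.continuous t (W t) x := by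
    filter_upwards [hVc, ae_integrable_cube hV] with t h1 h2
    rw [hasFourierCoeffs_iff] at h1
    have h3 := memLp_two_of_integrable_cube h1.1 h2
    have h4 : h3.toLp (fun x => V (t, x)) = perturbedL2 hv.continuous t (W t) := by
      refine realCoeff_injective ?_
      ext m
      rw [hv.realCoeff_perturbedL2, ← perturbedCurve_fst_coeff hs, ← h1.2 m, realCoeff_apply]
      refine integral_congr_ae ?_
      filter_upwards [h3.coeFn_toLp] with x hx
      rw [hx]
    rw [← h4]
    filter_upwards [h3.coeFn_toLp] with x hx
    exact hx.symm
  -- Testing with `ψ(t) K(e^{-i n·x})` leaves the weak form of `y'' = -|n|²y - N` in time alone.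
  have hK : ∀ K : ℂ →L[ℝ] ℝ, HasDerivAt (fun τ => K (y' τ))
      (K (-(lenSq n : ℂ) * y t - N t)) t := fun K => by
    have h1 := hasDerivAt_of_weak (u := fun t => K (y t)) (u' := fun t => K (y' t))
      (g := fun t => lenSq n * K (y t) + K (N t))
      (fun t => K.hasFDerivAt.comp_hasDerivAt t (hy t)) (K.continuous.comp hy'c)
      ((continuous_const.mul (K.continuous.comp hyc)).add (K.continuous.comp hNc))
      (fun ψ hψ hψc => ?_) t
    · refine h1.congr_deriv ?_
      have e : -(lenSq n : ℂ) * y t - N t = -(lenSq n • y t) - N t := by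
        rw [Complex.real_smul, neg_mul]
      rw [e, map_sub, map_neg, map_smul, smul_eq_mul]
      ring
    · have hφ := isTestFunction_productTest hψ hψc K n
      have h2 : ∫ p in univ ×ˢ cube, weakIntegrand V (productTest ψ K n) p = 0 := hweak _ hφ
      rw [integral_weakIntegrand hφ hV, mul_eq_zero, or_iff_right (by positivity)] at h2
      rw [← h2]
      refine integral_congr_ae ?_
      filter_upwards [hVae] with τ hτ
      have i1 := integral_mul_character (perturbedL2 hv.continuous τ (W τ)) K n
      have i2 := integral_mul_character (cubicTerm hv.continuous τ (W τ)) K n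
      have h3 : ∫ x, weakIntegrand V (productTest ψ K n) (τ, x) ∂torusMeasure =
          ∫ x, ((deriv (deriv ψ) τ + lenSq n * ψ τ) *
            (perturbedL2 hv.continuous τ (W τ) x * K (starRingEnd ℂ (character n x))) +
            ψ τ * (cubicTerm hv.continuous τ (W τ) x *
              K (starRingEnd ℂ (character n x)))) ∂torusMeasure := by
        refine integral_congr_ae ?_
        filter_upwards [hτ, coeFn_perturbedL2 hv.continuous τ (W τ),
          coeFn_cubicTerm hv.continuous τ (W τ)] with x h4 h5 h6
        rw [weakIntegrand, waveOp_productTest, h6, ← h5, ← h4, productTest]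
        ring
      rw [h3, integral_add (i1.1.const_mul _) (i2.1.const_mul _), integral_const_mul,
        integral_const_mul, i1.2, i2.2, hv.realCoeff_perturbedL2]
      simp only [y, N]
      ring
  -- Subtracting the linear equation of the free evolution leaves the equation for `w`.
  have h5 := (hasDerivAt_of_components hK).sub (hasDerivAt_freeEvolution_snd v n t)
  refine (h5.congr_deriv ?_).congr_of_eventuallyEq (Eventually.of_forall fun τ => ?_)
  · simp only [y, N]
    ring
  · simp only [y', Pi.sub_apply]
    ring

/-- The given remainder is relative to the free evolution of `v + h`. Adding the free evolution of
`h`, a continuous curve in the energy space, makes it relative to that of `v`, which `f` represents.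
-/
theorem IsGlobalSolution.exists_solvesPerturbed {hs : s ≤ 1} {v : PhaseSpace s}
    (hv : RepresentsFree f v) {h : Hs 1 × Hs 0} {z : ℝ → PhaseSpace s}
    (hz : IsGlobalSolution hs (v + inclEnergy hs h) z) :
    ∃ W, SolvesPerturbed hv.continuous W ∧ W 0 = h ∧ z = perturbedCurve hs v W := by
  obtain ⟨w, hw, hzw⟩ := hz.remainder
  let W : ℝ → Hs 1 × Hs 0 := fun t => w t + energyEvolution t h
  have hWc : Continuous W := hw.add (continuous_energyEvolution h)
  have hzW : z = perturbedCurve hs v W := by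
    funext t
    rw [hzw, perturbedCurve, inclEnergy_add, inclEnergy_energyEvolution, freeEvolution_add]
    abel
  have hd : ∀ t n, HasDerivAt (fun τ => (W τ).1.coeff n) ((W t).2.coeff n) t := fun t n => by
    have h1 := (Hs.hasDerivAt_coeff (hz.deriv t) n).sub (hasDerivAt_freeEvolution_fst v n t)
    rw [hzW] at h1
    simp only [Hs.incl_coeff, perturbedCurve_fst_coeff, perturbedCurve_snd_coeff] at h1
    refine (h1.congr_deriv (add_sub_cancel_left _ _)).congr_of_eventuallyEq
      (Eventually.of_forall fun τ => (add_sub_cancel_left _ _).symm)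
  refine ⟨W, ⟨hWc, hd, fun t n => ?_⟩, ?_, hzW⟩
  · refine SolvesCubicWave.hasDerivAt_snd (hs := hs) hv hWc hd ?_ t n
    rw [← hzW]
    exact hz.equation
  · have h0 := hz.initial
    rw [hzW, perturbedCurve, freeEvolution_zero] at h0
    exact inclEnergy_injective hs (add_left_cancel h0)

end Uniqueness

/-! ## The flow -/

section Flow

open Filter Topology Set

variable {s : ℝ} {f : ℝ × (Fin 3 → ℝ) → ℝ}

/-- The data that differ by an element of the energy space from a datum whose free evolution is
a continuous function. -/
def solvableData (hs : s ≤ 1) : Set (PhaseSpace s) :=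
  {u | ∃ (f : ℝ × (Fin 3 → ℝ) → ℝ) (v : PhaseSpace s) (h : Hs 1 × Hs 0),
    RepresentsFree f v ∧ u = v + inclEnergy hs h}

lemma continuous_shift (hf : Continuous f) (t₀ : ℝ) :
    Continuous fun p : ℝ × (Fin 3 → ℝ) => f (p.1 + t₀, p.2) :=
  hf.comp ((continuous_fst.add continuous_const).prodMk continuous_snd)

lemma RepresentsFree.shift {v : PhaseSpace s} (hv : RepresentsFree f v) (t₀ : ℝ) :
    RepresentsFree (fun p => f (p.1 + t₀, p.2)) (freeEvolution t₀ v) where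
  continuous := continuous_shift hv.continuous t₀
  coeffs t := by
    rw [freeEvolution_freeEvolution]
    exact hv.coeffs (t + t₀)

lemma SolvesPerturbed.shift {hf : Continuous f} {W : ℝ → Hs 1 × Hs 0}
    (hW : SolvesPerturbed hf W) (t₀ : ℝ) :
    SolvesPerturbed (continuous_shift hf t₀) fun t => W (t + t₀) where
  continuous := hW.continuous.comp (continuous_id.add continuous_const)
  deriv_fst t n := (hW.deriv_fst (t + t₀) n).comp_add_const t t₀
  deriv_snd t n := (hW.deriv_snd (t + t₀) n).comp_add_const t t₀

/-- The description of the solution with datum `v + h`. -/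
lemma RepresentsFree.exists_solution (hs₀ : 0 ≤ s) (hs : s ≤ 1) {v : PhaseSpace s}
    (hv : RepresentsFree f v) (h : Hs 1 × Hs 0) :
    ∃ W, SolvesPerturbed hv.continuous W ∧ W 0 = h ∧
      IsGlobalSolution hs (v + inclEnergy hs h) (perturbedCurve hs v W) := by
  obtain ⟨W, hW, hW0⟩ := CubicWave.exists_solvesPerturbed hv.continuous h
  refine ⟨W, hW, hW0, ?_⟩
  rw [← hW0]
  exact hW.isGlobalSolution hs₀ hs hv

lemma IsGlobalSolution.unique {hs : s ≤ 1} {u : PhaseSpace s} (hu : u ∈ solvableData hs)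
    {z z' : ℝ → PhaseSpace s} (hz : IsGlobalSolution hs u z) (hz' : IsGlobalSolution hs u z') :
    z = z' := by
  obtain ⟨f, v, h, hv, rfl⟩ := hu
  obtain ⟨W, hW, hW0, rfl⟩ := hz.exists_solvesPerturbed hv
  obtain ⟨W', hW', hW'0, rfl⟩ := hz'.exists_solvesPerturbed hv
  rw [hW.unique hW' (hW0.trans hW'0.symm)]

open Classical in
/-- The flow of the cubic wave equation; `0` if there is no solution. -/
def waveFlow (hs : s ≤ 1) (t : ℝ) (u : PhaseSpace s) : PhaseSpace s :=
  if h : ∃ z, IsGlobalSolution hs u z then h.choose t else 0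

lemma isGlobalSolution_waveFlow (hs₀ : 0 ≤ s) (hs : s ≤ 1) {u : PhaseSpace s}
    (hu : u ∈ solvableData hs) : IsGlobalSolution hs u fun t => waveFlow hs t u := by
  have h : ∃ z, IsGlobalSolution hs u z := by
    obtain ⟨f, v, h, hv, rfl⟩ := hu
    obtain ⟨W, -, -, hW⟩ := hv.exists_solution hs₀ hs h
    exact ⟨_, hW⟩
  have e : (fun t => waveFlow hs t u) = h.choose := funext fun t => dif_pos h
  rw [e]
  exact h.choose_spec

/-- The flow preserves the set of data, and it is reversible. -/
lemma waveFlow_mem_and_inverse (hs₀ : 0 ≤ s) (hs : s ≤ 1) {u : PhaseSpace s}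
    (hu : u ∈ solvableData hs) (t : ℝ) :
    waveFlow hs t u ∈ solvableData hs ∧ waveFlow hs (-t) (waveFlow hs t u) = u := by
  obtain ⟨f, v, h, hv, rfl⟩ := id hu
  obtain ⟨W, hW, hW0, hz⟩ := hv.exists_solution hs₀ hs h
  have e : waveFlow hs t (v + inclEnergy hs h) = perturbedCurve hs v W t :=
    congrFun ((isGlobalSolution_waveFlow hs₀ hs hu).unique hu hz) t
  have hmem : perturbedCurve hs v W t ∈ solvableData hs :=
    ⟨_, freeEvolution t v, W t, hv.shift t, rfl⟩
  rw [e]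
  refine ⟨hmem, ?_⟩
  -- The translated curve is the solution that starts from the state at time `t`; followed for time
  -- `-t` it returns to the original datum.
  have hz' := (hW.shift t).isGlobalSolution hs₀ hs (hv.shift t)
  simp only [zero_add] at hz'
  have e' := congrFun ((isGlobalSolution_waveFlow hs₀ hs hmem).unique hmem hz') (-t)
  rw [e', perturbedCurve, freeEvolution_freeEvolution, neg_add_cancel, freeEvolution_zero, hW0]

lemma image_waveFlow (hs₀ : 0 ≤ s) (hs : s ≤ 1) (t : ℝ) :
    waveFlow hs t '' solvableData hs = solvableData hs := by
  refine Subset.antisymm ?_ fun u hu => ?_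
  · rintro _ ⟨u, hu, rfl⟩
    exact (waveFlow_mem_and_inverse hs₀ hs hu t).1
  · obtain ⟨h1, h2⟩ := waveFlow_mem_and_inverse hs₀ hs hu (-t)
    exact ⟨_, h1, by rwa [neg_neg] at h2⟩

lemma RepresentsFree.mem_solvableData (hs : s ≤ 1) {v : PhaseSpace s}
    (hv : RepresentsFree f v) : v ∈ solvableData hs :=
  ⟨f, v, 0, hv, by
    have h : inclEnergy hs 0 = 0 := by
      have := inclEnergy_sub hs 0 0
      rwa [sub_zero, sub_self] at this
    rw [h, add_zero]⟩

end Flow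

/-! ## Dyadic blocks of the free evolution -/

section DyadicBlocks

open Filter Topology Set

variable {s : ℝ}

/-- The partial sum of the Fourier series of the free evolution over `⟨n⟩ ≤ 2^k`. -/
def freeSum (k : ℕ) (v : PhaseSpace s) (p : ℝ × (Fin 3 → ℝ)) : ℝ :=
  (trigPoly (freqBall k) (freeEvolution p.1 v).1.coeff p.2).re

/-- The part of the free evolution with frequencies `2^k < ⟨n⟩ ≤ 2^{k+1}`. -/
def freeBlock (k : ℕ) (v : PhaseSpace s) (p : ℝ × (Fin 3 → ℝ)) : ℝ :=
  freeSum (k + 1) v p - freeSum k v p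

open Classical in
/-- The frequencies with `2^k < ⟨n⟩ ≤ 2^{k+1}`. -/
def freqShell (k : ℕ) : Finset Freq := freqBall (k + 1) \ freqBall k

lemma mem_freqShell {k : ℕ} {n : Freq} :
    n ∈ freqShell k ↔ 2 ^ k < bracket n ∧ bracket n ≤ 2 ^ (k + 1) := by
  classical
  rw [freqShell, Finset.mem_sdiff, mem_freqBall, mem_freqBall, not_le, and_comm]

lemma card_freqShell_le (k : ℕ) : ((freqShell k).card : ℝ) ≤ 125 * (2 ^ k) ^ 3 := by
  classical
  have h1 : (freqShell k).card ≤ (2 * 2 ^ (k + 1) + 1) ^ 3 :=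
    (Finset.card_le_card Finset.sdiff_subset).trans (card_freqBall_le _)
  have h2 : ((freqShell k).card : ℝ) ≤ (2 * 2 ^ (k + 1) + 1) ^ 3 := by exact_mod_cast h1
  have h3 : (1 : ℝ) ≤ 2 ^ k := one_le_pow₀ one_le_two
  calc ((freqShell k).card : ℝ) ≤ (2 * 2 ^ (k + 1) + 1) ^ 3 := h2
    _ ≤ (5 * 2 ^ k) ^ 3 := by gcongr; rw [pow_succ]; linarith
    _ = _ := by ring

lemma freeBlock_eq (k : ℕ) (v : PhaseSpace s) (p : ℝ × (Fin 3 → ℝ)) :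
    freeBlock k v p =
      ∑ n ∈ freqShell k, ((freeEvolution p.1 v).1.coeff n * character n p.2).re := by
  classical
  rw [freeBlock, freeSum, freeSum, trigPoly, trigPoly, ← Complex.sub_re, freqShell,
    ← Finset.sum_sdiff (freqBall_mono k.le_succ), add_sub_cancel_right, Complex.re_sum]

lemma continuous_freeSum (k : ℕ) (v : PhaseSpace s) : Continuous (freeSum k v) := by
  refine Complex.continuous_re.comp (continuous_finsetSum _ fun n _ => ?_)
  exact (Hs.continuous_coeff (continuous_fst.comp ((continuous_freeEvolution v).comp
    continuous_fst)) n).mul ((continuous_character n).comp continuous_snd)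

lemma continuous_freeBlock (k : ℕ) (v : PhaseSpace s) : Continuous (freeBlock k v) :=
  (continuous_freeSum _ v).sub (continuous_freeSum _ v)

lemma norm_coeff_fst_le (hs₀ : 0 ≤ s) (v : PhaseSpace s) (n : Freq) : ‖v.1.coeff n‖ ≤ ‖v‖ := by
  have h1 : ‖Hs.toLp s v.1 n‖ ≤ ‖v.1‖ := lp.norm_apply_le_norm (by simp) (Hs.toLp s v.1) n
  rw [Hs.toLp_apply, norm_mul, Complex.norm_real,
    Real.norm_of_nonneg (Real.rpow_nonneg (bracket_pos n).le _)] at h1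
  refine le_trans ?_ (h1.trans (norm_fst_le v))
  exact le_mul_of_one_le_left (norm_nonneg _) (Real.one_le_rpow (one_le_bracket n) hs₀)

lemma norm_coeff_snd_le (hs₀ : 0 ≤ s) (v : PhaseSpace s) (n : Freq) :
    ‖v.2.coeff n‖ ≤ bracket n * ‖v‖ := by
  have h1 : ‖Hs.toLp (s - 1) v.2 n‖ ≤ ‖v.2‖ :=
    lp.norm_apply_le_norm (by simp) (Hs.toLp (s - 1) v.2) n
  rw [Hs.toLp_apply, norm_mul, Complex.norm_real,
    Real.norm_of_nonneg (Real.rpow_nonneg (bracket_pos n).le _)] at h1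
  have h2 : (bracket n)⁻¹ ≤ bracket n ^ (s - 1) := by
    rw [← Real.rpow_neg_one]
    exact Real.rpow_le_rpow_of_exponent_le (one_le_bracket n) (by linarith)
  have h3 : (bracket n)⁻¹ * ‖v.2.coeff n‖ ≤ ‖v‖ :=
    (mul_le_mul_of_nonneg_right h2 (norm_nonneg _)).trans (h1.trans (norm_snd_le v))
  rwa [inv_mul_le_iff₀ (bracket_pos n)] at h3

lemma norm_freeEvolution_fst_le (hs₀ : 0 ≤ s) (v : PhaseSpace s) (n : Freq) (t : ℝ) :
    ‖(freeEvolution t v).1.coeff n‖ ≤ (|t| + 3) * ‖v‖ := by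
  rw [freeEvolution_fst_coeff]
  refine (norm_add_le _ _).trans ?_
  rw [norm_mul, norm_mul, Complex.norm_real, Complex.norm_real, Real.norm_eq_abs,
    Real.norm_eq_abs]
  have h1 := norm_coeff_fst_le hs₀ v n
  have h2 := norm_coeff_snd_le hs₀ v n
  have h3 := bracket_pos n
  calc |Real.cos (t * len n)| * ‖v.1.coeff n‖ + |sinSymbol t n| * ‖v.2.coeff n‖
      ≤ 1 * ‖v‖ + (|t| + 2) * (bracket n)⁻¹ * (bracket n * ‖v‖) := by
        gcongr
        · exact Real.abs_cos_le_one _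
        · exact abs_sinSymbol_le t n
    _ = (|t| + 3) * ‖v‖ := by field_simp; ring

lemma norm_freeEvolution_snd_le (hs₀ : 0 ≤ s) (v : PhaseSpace s) (n : Freq) (t : ℝ) :
    ‖(freeEvolution t v).2.coeff n‖ ≤ 2 * bracket n * ‖v‖ := by
  rw [freeEvolution_snd_coeff]
  refine (norm_add_le _ _).trans ?_
  rw [norm_mul, norm_mul, Complex.norm_real, Complex.norm_real, Real.norm_eq_abs,
    Real.norm_eq_abs, abs_neg, abs_mul, abs_of_nonneg (len_nonneg n)]
  have h1 := norm_coeff_fst_le hs₀ v n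
  have h2 := norm_coeff_snd_le hs₀ v n
  have h3 := bracket_pos n
  calc len n * |Real.sin (t * len n)| * ‖v.1.coeff n‖ + |Real.cos (t * len n)| * ‖v.2.coeff n‖
      ≤ bracket n * 1 * ‖v‖ + 1 * (bracket n * ‖v‖) := by
        gcongr
        · exact len_le_bracket n
        · exact Real.abs_sin_le_one _
        · exact Real.abs_cos_le_one _
    _ = 2 * bracket n * ‖v‖ := by ring

lemma norm_character_sub_le (n : Freq) (x y : Fin 3 → ℝ) :
    ‖character n x - character n y‖ ≤ 3 * bracket n * ‖x - y‖ := by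
  refine Convex.norm_image_sub_le_of_norm_hasFDerivWithin_le (s := univ)
    (fun z _ => (hasFDerivAt_character n z).hasFDerivWithinAt) (fun z _ => ?_) convex_univ
    (mem_univ y) (mem_univ x)
  have hb := (bracket_pos n).le
  refine ContinuousLinearMap.opNorm_le_bound _ (by positivity) fun w => ?_
  rw [sum_apply]
  refine (norm_sum_le _ _).trans ?_
  have h : ∀ i ∈ (Finset.univ : Finset (Fin 3)),
      ‖((Complex.I * n i * character n z) • (Complex.ofRealCLM ∘L
        (ContinuousLinearMap.proj i : (Fin 3 → ℝ) →L[ℝ] ℝ))) w‖ ≤ bracket n * ‖w‖ := by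
    intro i _
    simp only [smul_apply, ContinuousLinearMap.comp_apply, smul_eq_mul, norm_mul, norm_character,
      Complex.norm_I, one_mul, mul_one]
    gcongr
    · have := (abs_apply_le_len n i).trans (len_le_bracket n)
      simpa using this
    · simpa using norm_le_pi_norm w i
  refine (Finset.sum_le_card_nsmul _ _ _ h).trans ?_
  simp [mul_assoc]

lemma abs_freeTerm_sub_le (hs₀ : 0 ≤ s) (v : PhaseSpace s) (n : Freq) {L : ℝ}
    {p q : ℝ × (Fin 3 → ℝ)} (hq : |q.1| ≤ L) :
    |((freeEvolution p.1 v).1.coeff n * character n p.2).re -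
      ((freeEvolution q.1 v).1.coeff n * character n q.2).re| ≤
      (3 * L + 11) * bracket n * ‖v‖ * ‖p - q‖ := by
  have hb0 := (bracket_pos n).le
  have h1 : ‖(freeEvolution p.1 v).1.coeff n - (freeEvolution q.1 v).1.coeff n‖ ≤
      2 * bracket n * ‖v‖ * ‖p.1 - q.1‖ :=
    Convex.norm_image_sub_le_of_norm_hasDerivWithin_le (s := univ)
      (f := fun t => (freeEvolution t v).1.coeff n)
      (f' := fun t => (freeEvolution t v).2.coeff n)
      (fun t _ => (hasDerivAt_freeEvolution_fst v n t).hasDerivWithinAt)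
      (fun t _ => norm_freeEvolution_snd_le hs₀ v n t) convex_univ (mem_univ _) (mem_univ _)
  have h2 := norm_character_sub_le n p.2 q.2
  have h3 : ‖(freeEvolution q.1 v).1.coeff n‖ ≤ (L + 3) * ‖v‖ :=
    (norm_freeEvolution_fst_le hs₀ v n q.1).trans (by gcongr)
  have hp1 : ‖p.1 - q.1‖ ≤ ‖p - q‖ := norm_fst_le (p - q)
  have hp2 : ‖p.2 - q.2‖ ≤ ‖p - q‖ := norm_snd_le (p - q)
  rw [← Complex.sub_re]
  refine (Complex.abs_re_le_norm _).trans ?_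
  generalize (freeEvolution p.1 v).1.coeff n = a at *
  generalize (freeEvolution q.1 v).1.coeff n = a' at *
  have hx := norm_character n p.2
  generalize character n p.2 = e at *
  generalize character n q.2 = e' at *
  generalize ‖p - q‖ = δ at *
  have hA : ‖a - a'‖ ≤ 2 * bracket n * ‖v‖ * δ := h1.trans (by gcongr)
  have hE : ‖e - e'‖ ≤ 3 * bracket n * δ := h2.trans (by gcongr)
  have hL : 0 ≤ (L + 3) * ‖v‖ := (norm_nonneg _).trans h3
  calc ‖a * e - a' * e'‖ = ‖(a - a') * e + a' * (e - e')‖ := by congr 1; ring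
    _ ≤ ‖(a - a') * e‖ + ‖a' * (e - e')‖ := norm_add_le _ _
    _ = ‖a - a'‖ + ‖a'‖ * ‖e - e'‖ := by rw [norm_mul, norm_mul, hx, mul_one]
    _ ≤ 2 * bracket n * ‖v‖ * δ + (L + 3) * ‖v‖ * (3 * bracket n * δ) :=
        add_le_add hA (mul_le_mul h3 hE (norm_nonneg _) hL)
    _ = (3 * L + 11) * bracket n * ‖v‖ * δ := by ring

/-- A shell has `O(2^{3k})` frequencies, and each term has Lipschitz constant `O(2^k)`. The
coefficients are estimated only by the norm of the datum, since the mesh `2^{-5k}` compensates for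
any loss up to `2^{4k}`. -/
lemma abs_freeBlock_sub_le (hs₀ : 0 ≤ s) (v : PhaseSpace s) (k : ℕ) {L : ℝ}
    {p q : ℝ × (Fin 3 → ℝ)} (hq : |q.1| ≤ L) :
    |freeBlock k v p - freeBlock k v q| ≤
      250 * (3 * L + 11) * ‖v‖ * (2 ^ k) ^ 4 * ‖p - q‖ := by
  have hL : 0 ≤ L := (abs_nonneg _).trans hq
  have hterm : ∀ n ∈ freqShell k,
      |((freeEvolution p.1 v).1.coeff n * character n p.2).re -
        ((freeEvolution q.1 v).1.coeff n * character n q.2).re| ≤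
      (3 * L + 11) * (2 * 2 ^ k) * ‖v‖ * ‖p - q‖ := fun n hn => by
    have hb : bracket n ≤ 2 * 2 ^ k := by
      have := (mem_freqShell.1 hn).2
      rwa [pow_succ, mul_comm] at this
    refine (abs_freeTerm_sub_le hs₀ v n hq).trans ?_
    gcongr
  rw [freeBlock_eq, freeBlock_eq, ← Finset.sum_sub_distrib]
  refine (Finset.abs_sum_le_sum_abs _ _).trans ((Finset.sum_le_card_nsmul _ _ _ hterm).trans ?_)
  rw [nsmul_eq_mul]
  have h := mul_le_mul_of_nonneg_right (card_freqShell_le k)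
    (by positivity : 0 ≤ (3 * L + 11) * (2 * 2 ^ k) * ‖v‖ * ‖p - q‖)
  refine h.trans (le_of_eq ?_)
  ring

/-- The indices of the points of a grid of mesh `2 ^ (-5 * k)` in the cube `[-L, L]⁴`. -/
def gridIndex (L k : ℕ) : Finset (ℤ × (Fin 3 → ℤ)) :=
  Finset.Icc (-(L * 2 ^ (5 * k) : ℤ)) (L * 2 ^ (5 * k)) ×ˢ
    Fintype.piFinset fun _ => Finset.Icc (-(L * 2 ^ (5 * k) : ℤ)) (L * 2 ^ (5 * k))

/-- The points of a grid of mesh `2 ^ (-5 * k)`. -/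
def gridPoint (k : ℕ) (j : ℤ × (Fin 3 → ℤ)) : ℝ × (Fin 3 → ℝ) :=
  ((j.1 : ℝ) / 2 ^ (5 * k), fun i => (j.2 i : ℝ) / 2 ^ (5 * k))

lemma exists_grid_real (L k : ℕ) {r : ℝ} (hr : |r| ≤ L) :
    ∃ j ∈ Finset.Icc (-(L * 2 ^ (5 * k) : ℤ)) (L * 2 ^ (5 * k)),
      |r - (j : ℝ) / 2 ^ (5 * k)| ≤ 1 / 2 ^ (5 * k) := by
  have hpos : (0 : ℝ) < 2 ^ (5 * k) := by positivity
  obtain ⟨h1, h2⟩ := abs_le.1 hr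
  refine ⟨⌊r * 2 ^ (5 * k)⌋, ?_, ?_⟩
  · rw [Finset.mem_Icc]
    constructor
    · rw [Int.le_floor]
      push_cast
      nlinarith
    · have h3 := Int.floor_le (r * 2 ^ (5 * k))
      have h4 : ((⌊r * 2 ^ (5 * k)⌋ : ℤ) : ℝ) ≤ L * 2 ^ (5 * k) := by nlinarith
      exact_mod_cast h4
  · have h3 := Int.floor_le (r * 2 ^ (5 * k))
    have h4 := Int.lt_floor_add_one (r * 2 ^ (5 * k))
    rw [sub_div' hpos.ne', abs_div, abs_of_pos hpos]
    gcongr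
    rw [abs_le]
    constructor <;> linarith

/-- The cube `[-L, L]⁴`. -/
def spaceTimeBox (L : ℕ) : Set (ℝ × (Fin 3 → ℝ)) := {p | |p.1| ≤ L ∧ ∀ i, |p.2 i| ≤ L}

lemma exists_gridPoint {L : ℕ} (k : ℕ) {p : ℝ × (Fin 3 → ℝ)} (hp : p ∈ spaceTimeBox L) :
    ∃ j ∈ gridIndex L k, ‖p - gridPoint k j‖ ≤ 1 / 2 ^ (5 * k) := by
  obtain ⟨j0, h0, h0'⟩ := exists_grid_real L k hp.1
  choose j hj hj' using fun i => exists_grid_real L k (hp.2 i)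
  refine ⟨(j0, j), Finset.mem_product.2 ⟨h0, Fintype.mem_piFinset.2 hj⟩, ?_⟩
  refine max_le h0' ?_
  exact (pi_norm_le_iff_of_nonneg (by positivity)).2 hj'

lemma abs_gridPoint_le {L k : ℕ} {j : ℤ × (Fin 3 → ℤ)} (hj : j ∈ gridIndex L k) :
    |(gridPoint k j).1| ≤ L := by
  have h := Finset.mem_Icc.1 (Finset.mem_product.1 hj).1
  rw [gridPoint, abs_div, abs_of_pos (by positivity : (0 : ℝ) < 2 ^ (5 * k)),
    div_le_iff₀ (by positivity), abs_le]
  constructor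
  · exact_mod_cast h.1
  · exact_mod_cast h.2

/-- The decay rate of the dyadic blocks. -/
def blockRate (s : ℝ) : ℝ := 2 ^ (-(s / 2))

/-- The data for which the dyadic blocks of the free evolution decay on the grids. -/
def gridRegularData (s : ℝ) : Set (PhaseSpace s) :=
  {v | ∀ L : ℕ, ∀ᶠ k in atTop, ∀ j ∈ gridIndex L k,
    |freeBlock k v (gridPoint k j)| ≤ blockRate s ^ k}

lemma blockRate_pos (s : ℝ) : 0 < blockRate s := Real.rpow_pos_of_pos two_pos _

lemma blockRate_lt_one (hs₀ : 0 < s) : blockRate s < 1 :=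
  Real.rpow_lt_one_of_one_lt_of_neg one_lt_two (by linarith)

lemma isCompact_spaceTimeBox (L : ℕ) : IsCompact (spaceTimeBox L) := by
  have h : spaceTimeBox L = Icc (-(L : ℝ)) L ×ˢ univ.pi fun _ => Icc (-(L : ℝ)) L := by
    ext p
    simp only [spaceTimeBox, mem_ofPred_eq, mem_prod, mem_univ_pi, mem_Icc, abs_le]
  rw [h]
  exact isCompact_Icc.prod (isCompact_univ_pi fun _ => isCompact_Icc)

/-- The nearest grid point contributes `blockRate s ^ k`, and the distance to it `2^{4k} 2^{-5k} =
2^{-k}`, up to constants; both are summable. -/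
lemma exists_summable_bound (hs₀ : 0 < s) {v : PhaseSpace s} (hv : v ∈ gridRegularData s)
    (L : ℕ) : ∃ b : ℕ → ℝ, Summable b ∧ ∀ k, ∀ p ∈ spaceTimeBox L, ‖freeBlock k v p‖ ≤ b k := by
  obtain ⟨K, hK⟩ := eventually_atTop.1 (hv L)
  have hM := fun k => (isCompact_spaceTimeBox L).exists_bound_of_continuousOn
    (continuous_freeBlock k v).continuousOn
  choose M hM using hM
  let C : ℝ := 250 * (3 * L + 11) * ‖v‖
  -- The finitely many blocks before the grid estimate sets in are bounded by compactness of the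
  -- box.
  refine ⟨fun k => if k < K then M k else blockRate s ^ k + C * (1 / 2) ^ k, ?_, fun k p hp => ?_⟩
  · rw [← summable_nat_add_iff K]
    have h1 : Summable fun k => blockRate s ^ k + C * (1 / 2 : ℝ) ^ k :=
      (summable_geometric_of_lt_one (blockRate_pos s).le (blockRate_lt_one hs₀)).add
        (summable_geometric_two.mul_left C)
    refine ((summable_nat_add_iff K).2 h1).congr fun k => ?_
    simp
  · by_cases hk : k < K
    · simpa only [hk, if_true] using hM k p hp
    · simp only [hk, if_false]
      obtain ⟨j, hj, hpj⟩ := exists_gridPoint k hp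
      have h1 := hK k (not_lt.1 hk) j hj
      have h2 := abs_freeBlock_sub_le hs₀.le v k (p := p) (abs_gridPoint_le hj)
      have h3 : 250 * (3 * L + 11) * ‖v‖ * (2 ^ k) ^ 4 * ‖p - gridPoint k j‖ ≤
          C * (1 / 2) ^ k := by
        calc _ ≤ C * (2 ^ k) ^ 4 * (1 / 2 ^ (5 * k)) := by
              simp only [C]
              gcongr
          _ = C * (1 / 2) ^ k := by
              rw [mul_comm 5 k, pow_mul, div_pow, one_pow]
              have : (2 : ℝ) ^ k ≠ 0 := by positivity
              field_simp
      rw [Real.norm_eq_abs]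
      have h4 := abs_sub_abs_le_abs_sub (freeBlock k v p) (freeBlock k v (gridPoint k j))
      linarith

/-- The sum of the dyadic blocks of the free evolution. -/
def freeLimit (v : PhaseSpace s) (p : ℝ × (Fin 3 → ℝ)) : ℝ :=
  freeSum 0 v p + ∑' k, freeBlock k v p

lemma continuous_freeLimit (hs₀ : 0 < s) {v : PhaseSpace s} (hv : v ∈ gridRegularData s) :
    Continuous (freeLimit v) := by
  refine (continuous_freeSum 0 v).add (continuous_iff_continuousAt.2 fun p => ?_)
  obtain ⟨L, hL⟩ := exists_nat_gt ‖p‖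
  obtain ⟨b, hb, hbb⟩ := exists_summable_bound hs₀ hv L
  have h1 : ContinuousOn (fun p => ∑' k, freeBlock k v p) (spaceTimeBox L) :=
    continuousOn_tsum (fun k => (continuous_freeBlock k v).continuousOn) hb hbb
  refine h1.continuousAt (mem_of_superset
    ((isOpen_lt continuous_norm continuous_const).mem_nhds hL) fun q hq => ?_)
  have hq' : ‖q‖ ≤ L := le_of_lt hq
  exact ⟨(norm_fst_le q).trans hq',
    fun i => ((norm_le_pi_norm q.2 i).trans (norm_snd_le q)).trans hq'⟩

lemma sum_freeBlock (v : PhaseSpace s) (p : ℝ × (Fin 3 → ℝ)) (k : ℕ) :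
    freeSum 0 v p + ∑ i ∈ Finset.range k, freeBlock i v p = freeSum k v p := by
  simp only [freeBlock, Finset.sum_range_sub fun k => freeSum k v p]
  ring

/-- Both `n` and `-n` must lie in the ball, since taking the real part mixes the two coefficients.
-/
lemma torusCoeff_freeSum (v : PhaseSpace s) (t : ℝ) (n : Freq) :
    ∀ᶠ k in atTop, torusCoeff (fun x => freeSum k v (t, x)) n =
      (freeEvolution t v).1.coeff n := by
  obtain ⟨K, hK⟩ := pow_unbounded_of_one_lt (bracket n) one_lt_two
  filter_upwards [eventually_ge_atTop K] with k hk
  have hn : n ∈ freqBall k := freqBall_mono hk (mem_freqBall.2 hK.le)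
  have hn' : -n ∈ freqBall k := by rwa [mem_freqBall, bracket_neg, ← mem_freqBall]
  have h1 : torusCoeff (fun x => freeSum k v (t, x)) n =
      realCoeff (realSynthesis (truncate (freqBall k) (freeEvolution t v).1.coeff)) n := by
    rw [realCoeff_apply, torusCoeff]
    refine integral_congr_ae ?_
    filter_upwards [coeFn_reL2 (synthesis (truncate (freqBall k) (freeEvolution t v).1.coeff)),
      synthesis_truncate (freqBall k) (freeEvolution t v).1.coeff] with x h2 h3
    rw [realSynthesis_def, h2, h3, freeSum]
  rw [h1, realCoeff_realSynthesis, truncate_apply, truncate_apply, if_pos hn, if_pos hn',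
    (freeEvolution t v).1.inSobolev.1, Complex.conj_conj]
  ring

/-- Each Fourier coefficient of the partial sums is eventually constant, and the summable bound on
blocks passes it to the limit by dominated convergence. -/
lemma representsFree_freeLimit (hs₀ : 0 < s) {v : PhaseSpace s} (hv : v ∈ gridRegularData s) :
    RepresentsFree (freeLimit v) v where
  continuous := continuous_freeLimit hs₀ hv
  coeffs t := by
    have hc := continuous_freeLimit hs₀ hv
    refine hasFourierCoeffs_iff.2 ⟨memLp_one_iff_integrable.1
      (memLp_of_continuous (continuous_slice hc t) 1), fun n => ?_⟩
    obtain ⟨L, hL⟩ := exists_nat_ge (max |t| (2 * Real.pi))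
    have hbox : ∀ x ∈ cube, (t, x) ∈ spaceTimeBox L := fun x hx =>
      ⟨(le_max_left _ _).trans hL, fun i => by
        have h1 := hx i (mem_univ i)
        rw [abs_of_nonneg h1.1]
        exact h1.2.le.trans ((le_max_right _ _).trans hL)⟩
    obtain ⟨b, hb, hbb⟩ := exists_summable_bound hs₀ hv L
    obtain ⟨M, hM⟩ := (isCompact_spaceTimeBox L).exists_bound_of_continuousOn
      (continuous_freeSum 0 v).continuousOn
    have hlim : Tendsto (fun k => torusCoeff (fun x => freeSum k v (t, x)) n) atTop
        (𝓝 (∫ x, (freeLimit v (t, x) : ℂ) * starRingEnd ℂ (character n x) ∂torusMeasure)) := by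
      refine tendsto_integral_of_dominated_convergence (fun _ => M + ∑' k, b k)
        (fun k => (integrable_slice_mul_conj (continuous_freeSum k v) t n).1)
        (integrable_const _) (fun k => ?_) ?_
      · filter_upwards [ae_mem_cube] with x hx
        have hbx := fun k => hbb k (t, x) (hbox x hx)
        rw [norm_mul, RCLike.norm_conj, norm_character, mul_one, Complex.norm_real,
          ← sum_freeBlock]
        refine (norm_add_le _ _).trans (add_le_add (hM _ (hbox x hx)) ?_)
        refine (norm_sum_le _ _).trans ((Finset.sum_le_sum fun k _ => hbx k).trans ?_)
        exact hb.sum_le_tsum _ fun k _ => (norm_nonneg _).trans (hbx k)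
      · filter_upwards [ae_mem_cube] with x hx
        have hsum : Summable fun k => freeBlock k v (t, x) :=
          Summable.of_norm_bounded hb fun k => hbb k (t, x) (hbox x hx)
        have h1 := hsum.hasSum.tendsto_sum_nat.const_add (freeSum 0 v (t, x))
        simp only [sum_freeBlock] at h1
        exact ((Complex.continuous_ofReal.tendsto _).comp h1).mul_const _
    exact tendsto_nhds_unique hlim
      (tendsto_const_nhds.congr' ((torusCoeff_freeSum v t n).mono fun k hk => hk.symm))

/-- Only countably many point evaluations of blocks enter, and each is a continuous function of
finitely many Fourier coefficients. -/
lemma measurableSet_gridRegularData (s : ℝ) : MeasurableSet (gridRegularData s) := by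
  have hm : ∀ k p, Measurable fun v : PhaseSpace s => freeBlock k v p := fun k p => by
    simp only [freeBlock_eq, freeEvolution_fst_coeff]
    refine Finset.measurable_sum _ fun n _ => Complex.measurable_re.comp ?_
    have h1 : Measurable fun v : PhaseSpace s => v.1.coeff n :=
      (Hs.continuous_coeff continuous_id n).measurable.comp measurable_fst
    have h2 : Measurable fun v : PhaseSpace s => v.2.coeff n :=
      (Hs.continuous_coeff continuous_id n).measurable.comp measurable_snd
    exact ((h1.const_mul _).add (h2.const_mul _)).mul_const _
  have h : gridRegularData s = ⋂ L : ℕ, ⋃ K : ℕ, ⋂ k ≥ K, ⋂ j ∈ gridIndex L k,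
      {v | |freeBlock k v (gridPoint k j)| ≤ blockRate s ^ k} := by
    ext v
    simp only [gridRegularData, eventually_atTop, mem_ofPred_eq, mem_iInter, mem_iUnion]
  rw [h]
  refine MeasurableSet.iInter fun L => MeasurableSet.iUnion fun K => MeasurableSet.iInter fun k =>
    MeasurableSet.iInter fun _ => MeasurableSet.biInter (Finset.countable_toSet _) fun j _ => ?_
  exact measurableSet_le (hm k _).abs measurable_const

end DyadicBlocks

/-! ## Decay of the dyadic blocks of randomised data -/

section Randomisation

open Filter Topology Set
open scoped NNReal ENNReal

/-- The mode `cos(n·x)` or `sin(n·x)`. -/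
def modeOf (b : Bool) (n : Freq) : Mode :=
  if h : n = 0 then .const else if b then .cos n h else .sin n h

/-- The function `cos(n·x)` or `sin(n·x)`. -/
def trigPart (b : Bool) (n : Freq) (x : Fin 3 → ℝ) : ℝ :=
  if b then (character n x).re else (character n x).im

lemma freq_modeOf (b : Bool) (n : Freq) : (modeOf b n).freq = n := by
  by_cases h : n = 0
  · simp [modeOf, h, Mode.freq]
  · cases b <;> simp [modeOf, h, Mode.freq]

lemma modeOf_injective :
    Function.Injective fun q : Bool × {n : Freq // n ≠ 0} => modeOf q.1 q.2.1 := by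
  rintro ⟨b, n, hn⟩ ⟨b', n', hn'⟩ h
  have h1 : n = n' := by
    have := congrArg Mode.freq h
    simpa only [freq_modeOf] using this
  subst h1
  cases b <;> cases b' <;> simp_all [modeOf]

lemma abs_trigPart_le (b : Bool) (n : Freq) (x : Fin 3 → ℝ) : |trigPart b n x| ≤ 1 := by
  cases b
  · simpa [trigPart, norm_character] using Complex.abs_im_le_norm (character n x)
  · simpa [trigPart, norm_character] using Complex.abs_re_le_norm (character n x)

lemma re_trigCoeff_mul (d : Mode → ℝ) {n : Freq} (hn : n ≠ 0) (x : Fin 3 → ℝ) :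
    (trigCoeff d n * character n x).re =
      (d (modeOf true n) + d (modeOf true (-n))) / 2 * trigPart true n x +
        (d (modeOf false n) - d (modeOf false (-n))) / 2 * trigPart false n x := by
  have hn' : -n ≠ 0 := neg_ne_zero.2 hn
  have e : trigCoeff d n = (((d (modeOf true n) + d (modeOf true (-n))) / 2 : ℝ) : ℂ) -
      (((d (modeOf false n) - d (modeOf false (-n))) / 2 : ℝ) : ℂ) * Complex.I := by
    simp only [trigCoeff, modeOf, hn, hn', dite_false, if_true, Bool.false_eq_true, if_false]
    push_cast
    have hI : Complex.I ≠ 0 := Complex.I_ne_zero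
    field_simp
    linear_combination ((d (.sin n hn) : ℂ) - d (.sin (-n) hn')) * Complex.I_sq
  rw [e, sub_mul, Complex.sub_re, Complex.re_ofReal_mul, mul_assoc, Complex.re_ofReal_mul,
    Complex.I_mul_re]
  simp only [trigPart, if_true, Bool.false_eq_true, if_false]
  ring

/-- A sum over frequencies, symmetric under `n ↦ -n`, in terms of the real modes. -/
lemma sum_re_trigCoeff_mul {F : Finset Freq} (hF : ∀ n, -n ∈ F ↔ n ∈ F) (h0 : 0 ∉ F)
    (d : Mode → ℝ) {m : Freq → ℝ} (hm : ∀ n, m (-n) = m n) (x : Fin 3 → ℝ) :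
    ∑ n ∈ F, m n * (trigCoeff d n * character n x).re =
      ∑ b : Bool, ∑ n ∈ F, m n * trigPart b n x * d (modeOf b n) := by
  have hc : ∀ n, trigPart true (-n) x = trigPart true n x := fun n => by
    simp [trigPart, character_neg]
  have hs : ∀ n, trigPart false (-n) x = -trigPart false n x := fun n => by
    simp [trigPart, character_neg]
  -- The modes at `n` and `-n` both contribute to the coefficient at `n`. Reindexing by `n ↦ -n`,
  -- with cosine even and sine odd, collects each mode into a single term.
  have e1 : ∑ n ∈ F, m n * trigPart true n x * d (modeOf true (-n)) =
      ∑ n ∈ F, m n * trigPart true n x * d (modeOf true n) :=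
    Finset.sum_equiv (Equiv.neg Freq) (fun n => (hF n).symm) fun n _ => by
      simp only [Equiv.neg_apply, hm, hc]
  have e2 : ∑ n ∈ F, m n * trigPart false n x * d (modeOf false (-n)) =
      -∑ n ∈ F, m n * trigPart false n x * d (modeOf false n) := by
    rw [← Finset.sum_neg_distrib]
    exact Finset.sum_equiv (Equiv.neg Freq) (fun n => (hF n).symm) fun n _ => by
      simp only [Equiv.neg_apply, hm, hs]
      ring
  rw [Fintype.sum_bool]
  have e3 : ∑ n ∈ F, m n * (trigCoeff d n * character n x).re =
      2⁻¹ * (∑ n ∈ F, m n * trigPart true n x * d (modeOf true n) +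
        ∑ n ∈ F, m n * trigPart true n x * d (modeOf true (-n))) +
      2⁻¹ * (∑ n ∈ F, m n * trigPart false n x * d (modeOf false n) -
        ∑ n ∈ F, m n * trigPart false n x * d (modeOf false (-n))) := by
    rw [← Finset.sum_add_distrib, ← Finset.sum_sub_distrib, Finset.mul_sum, Finset.mul_sum,
      ← Finset.sum_add_distrib]
    refine Finset.sum_congr rfl fun n hn => ?_
    rw [re_trigCoeff_mul d (fun h => h0 (h ▸ hn))]
    ring
  rw [e3, e1, e2]
  ring

/-- The symbols of `cos(t√-Δ)` and `sin(t√-Δ)/√-Δ`. -/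
def freeSymbol (j : Fin 2) (t : ℝ) (n : Freq) : ℝ :=
  if j = 0 then Real.cos (t * len n) else sinSymbol t n

lemma freeSymbol_neg (j : Fin 2) (t : ℝ) (n : Freq) : freeSymbol j t (-n) = freeSymbol j t n := by
  simp only [freeSymbol, len_neg, sinSymbol_neg]

/-- The real modes with frequencies in a dyadic shell. -/
def shellModes (k : ℕ) : Finset (Fin 2 × Bool × {n : Freq // n ≠ 0}) :=
  Finset.univ ×ˢ Finset.univ ×ˢ (freqShell k).subtype (· ≠ 0)

lemma zero_notMem_freqShell (k : ℕ) : (0 : Freq) ∉ freqShell k := by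
  rw [mem_freqShell, not_and_or]
  left
  have : bracket 0 = 1 := by simp [bracket, lenSq]
  rw [this, not_lt]
  exact one_le_pow₀ one_le_two

/-- Distinct indices belong to distinct modes, so for random data each variable occurs once, as the
tail estimate for independent sums requires. -/
lemma freeBlock_eq_sum_modes {s : ℝ} {v : PhaseSpace s} {d : Fin 2 → Mode → ℝ}
    (h₀ : ∀ n, v.1.coeff n = trigCoeff (d 0) n) (h₁ : ∀ n, v.2.coeff n = trigCoeff (d 1) n)
    (k : ℕ) (p : ℝ × (Fin 3 → ℝ)) :
    freeBlock k v p = ∑ i ∈ shellModes k, freeSymbol i.1 p.1 i.2.2.1 *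
      trigPart i.2.1 i.2.2.1 p.2 * d i.1 (modeOf i.2.1 i.2.2.1) := by
  have hz := zero_notMem_freqShell k
  have hsym : ∀ n, -n ∈ freqShell k ↔ n ∈ freqShell k := fun n => by
    rw [mem_freqShell, mem_freqShell, bracket_neg]
  have h1 : freeBlock k v p =
      ∑ j : Fin 2, ∑ n ∈ freqShell k,
        freeSymbol j p.1 n * (trigCoeff (d j) n * character n p.2).re := by
    rw [freeBlock_eq, Fin.sum_univ_two, ← Finset.sum_add_distrib]
    refine Finset.sum_congr rfl fun n _ => ?_
    rw [freeEvolution_fst_coeff, h₀, h₁, add_mul, Complex.add_re, mul_assoc, mul_assoc,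
      Complex.re_ofReal_mul, Complex.re_ofReal_mul]
    simp [freeSymbol]
  rw [h1, shellModes, Finset.sum_product]
  refine Finset.sum_congr rfl fun j _ => ?_
  rw [sum_re_trigCoeff_mul hsym hz (d j) (freeSymbol_neg j p.1), Finset.sum_product]
  refine Finset.sum_congr rfl fun b _ => ?_
  have hne : ∀ n ∈ freqShell k, n ≠ 0 := fun n hn h => hz (by rwa [h] at hn)
  symm
  convert Finset.sum_subtype_of_mem
    (fun n => freeSymbol j p.1 n * trigPart b n p.2 * d j (modeOf b n)) hne

/-- The Sobolev exponents of the two components of the data. -/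
def dataExponent (s : ℝ) (j : Fin 2) : ℝ := if j = 0 then s else s - 1

/-- `blockRate s ^ (4 * k)` is `2^{-2sk}`, the order of the variance of a block. The threshold
`blockRate s ^ k` is thus the square root of the standard deviation, far above it for large `k`. -/
lemma one_le_blockRate_mul (s : ℝ) (hs₀ : 0 ≤ s) {k : ℕ} {n : Freq} (hn : 2 ^ k < bracket n) :
    1 ≤ blockRate s ^ (4 * k) * bracket n ^ (2 * s) := by
  have h1 : blockRate s ^ (4 * k) = ((2 : ℝ) ^ k) ^ (-(2 * s)) := by
    rw [blockRate, ← Real.rpow_natCast, ← Real.rpow_mul two_pos.le, ← Real.rpow_natCast,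
      ← Real.rpow_mul two_pos.le]
    congr 1
    push_cast
    ring
  have h2 : (0 : ℝ) < 2 ^ k := by positivity
  rw [h1, Real.rpow_neg h2.le, ← div_eq_inv_mul, one_le_div (Real.rpow_pos_of_pos h2 _)]
  exact Real.rpow_le_rpow h2.le hn.le (by linarith)

/-- The symbol of the second component gains `⟨n⟩⁻¹`, which matches the exponent `s - 1` of its
data. -/
lemma freeSymbol_sq_le {s : ℝ} (hs₀ : 0 ≤ s) {k : ℕ} {n : Freq} (hn : 2 ^ k < bracket n)
    (j : Fin 2) {t L : ℝ} (ht : |t| ≤ L) :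
    freeSymbol j t n ^ 2 ≤
      (L + 2) ^ 2 * blockRate s ^ (4 * k) * bracket n ^ (2 * dataExponent s j) := by
  have hb := bracket_pos n
  have h1 := one_le_blockRate_mul s hs₀ hn
  have hL : 0 ≤ L := (abs_nonneg _).trans ht
  have hr := (pow_pos (blockRate_pos s) (4 * k)).le
  fin_cases j
  · simp only [freeSymbol, dataExponent, Fin.zero_eta, if_true]
    calc Real.cos (t * len n) ^ 2 ≤ 1 := Real.cos_sq_le_one _
      _ ≤ (L + 2) ^ 2 * (blockRate s ^ (4 * k) * bracket n ^ (2 * s)) := by nlinarith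
      _ = _ := by ring
  · simp only [freeSymbol, dataExponent, Fin.mk_one, one_ne_zero, if_false]
    have h2 : sinSymbol t n ^ 2 ≤ ((L + 2) * (bracket n)⁻¹) ^ 2 := by
      refine sq_le_sq.2 (((abs_sinSymbol_le t n).trans ?_).trans (le_abs_self _))
      gcongr
    have h3 : bracket n ^ (2 * (s - 1)) = bracket n ^ (2 * s) * ((bracket n)⁻¹) ^ 2 := by
      rw [show 2 * (s - 1) = 2 * s - (2 : ℕ) by push_cast; ring, Real.rpow_sub hb,
        Real.rpow_natCast, inv_pow, div_eq_mul_inv]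
    rw [h3]
    calc sinSymbol t n ^ 2 ≤ ((L + 2) * (bracket n)⁻¹) ^ 2 := h2
      _ = (L + 2) ^ 2 * ((bracket n)⁻¹) ^ 2 * 1 := by ring
      _ ≤ (L + 2) ^ 2 * ((bracket n)⁻¹) ^ 2 * (blockRate s ^ (4 * k) * bracket n ^ (2 * s)) := by
          gcongr
      _ = _ := by ring

/-- The total weight `∑ ⟨n⟩ ^ (2 * s) * (b² + c²)` of the data. -/
def dataWeight (s : ℝ) (d : Fin 2 → Mode → ℝ) : ℝ :=
  ∑ j, ∑' κ : Mode, bracket κ.freq ^ (2 * dataExponent s j) * d j κ ^ 2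

/-- This is the variance proxy of a block at a point: all frequencies of the shell exceed `2^k`, so
the regularity `s` of the data yields the factor `2^{-2sk}`. -/
lemma sum_coeff_sq_le {s : ℝ} (hs₀ : 0 ≤ s) {d : Fin 2 → Mode → ℝ}
    (hd : ∀ j, WeightedSummable (dataExponent s j) (d j)) (k : ℕ) {L : ℝ}
    {p : ℝ × (Fin 3 → ℝ)} (hp : |p.1| ≤ L) :
    ∑ i ∈ shellModes k, (freeSymbol i.1 p.1 i.2.2.1 * trigPart i.2.1 i.2.2.1 p.2 *
      d i.1 (modeOf i.2.1 i.2.2.1)) ^ 2 ≤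
      (L + 2) ^ 2 * blockRate s ^ (4 * k) * dataWeight s d := by
  have hL : 0 ≤ L := (abs_nonneg _).trans hp
  have hr := (pow_pos (blockRate_pos s) (4 * k)).le
  have hterm : ∀ i ∈ shellModes k, (freeSymbol i.1 p.1 i.2.2.1 *
      trigPart i.2.1 i.2.2.1 p.2 * d i.1 (modeOf i.2.1 i.2.2.1)) ^ 2 ≤
      (L + 2) ^ 2 * blockRate s ^ (4 * k) *
        (bracket (modeOf i.2.1 i.2.2.1).freq ^ (2 * dataExponent s i.1) *
          d i.1 (modeOf i.2.1 i.2.2.1) ^ 2) := by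
    rintro ⟨j, b, n, hn⟩ hi
    simp only [shellModes, Finset.mem_product, Finset.mem_univ, true_and,
      Finset.mem_subtype] at hi
    have h1 := freeSymbol_sq_le hs₀ (mem_freqShell.1 hi).1 j hp
    have h2 : trigPart b n p.2 ^ 2 ≤ 1 := by
      rw [sq_le_one_iff_abs_le_one]
      exact abs_trigPart_le b n p.2
    simp only [freq_modeOf]
    rw [mul_pow, mul_pow]
    calc _ ≤ freeSymbol j p.1 n ^ 2 * 1 * d j (modeOf b n) ^ 2 := by gcongr
      _ ≤ ((L + 2) ^ 2 * blockRate s ^ (4 * k) * bracket n ^ (2 * dataExponent s j)) * 1 *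
          d j (modeOf b n) ^ 2 := by gcongr
      _ = _ := by ring
  refine (Finset.sum_le_sum hterm).trans ?_
  rw [← Finset.mul_sum]
  refine mul_le_mul_of_nonneg_left ?_ (by positivity)
  rw [shellModes, Finset.sum_product, dataWeight]
  refine Finset.sum_le_sum fun j _ => ?_
  have hw : ∀ κ : Mode, 0 ≤ bracket κ.freq ^ (2 * dataExponent s j) * d j κ ^ 2 := fun κ =>
    mul_nonneg (Real.rpow_nonneg (bracket_pos _).le _) (sq_nonneg _)
  have h3 := (hd j).comp_injective modeOf_injective
  exact (h3.sum_le_tsum _ fun q _ => hw _).trans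
    (tsum_comp_le_tsum_of_inj (hd j) hw modeOf_injective)

variable {Ω : Type u} [MeasurableSpace Ω] {P : Measure Ω} {X : Fin 2 × Mode → Ω → ℝ}

lemma hasSubgaussianMGF_mono {Y : Ω → ℝ} {c c' : ℝ≥0} (h : HasSubgaussianMGF Y c P)
    (hc : c ≤ c') : HasSubgaussianMGF Y c' P where
  integrable_exp_mul := h.integrable_exp_mul
  mgf_le t := (h.mgf_le t).trans (by gcongr)

lemma IsRandomisation.exists_hasSubgaussianMGF (hX : IsRandomisation P X) :
    ∃ c : ℝ≥0, 0 < c ∧ ∀ κ, HasSubgaussianMGF (X κ) c P := by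
  obtain ⟨θ, ⟨c, hc, hθ⟩, hlaw⟩ := hX.law
  -- `HasSubgaussianMGF` is normalised by `exp(c t² / 2)`, hence the factor `2`.
  refine ⟨(2 * c).toNNReal, Real.toNNReal_pos.2 (by positivity),
    fun κ => ⟨fun t => ?_, fun t => ?_⟩⟩
  · have h := (hθ t).1
    rw [← hlaw κ] at h
    exact h.comp_measurable (hX.measurable κ)
  · have h := (hθ t).2
    rw [← hlaw κ, integral_map (hX.measurable κ).aemeasurable (by fun_prop)] at h
    refine h.trans (le_of_eq ?_)
    congr 1
    rw [Real.coe_toNNReal _ (by positivity)]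
    ring

/-- A tail estimate for linear combinations of the random variables. -/
lemma IsRandomisation.measure_abs_sum_ge_le [IsProbabilityMeasure P] (hX : IsRandomisation P X)
    {c : ℝ≥0} (hc : ∀ κ, HasSubgaussianMGF (X κ) c P) {ι : Type*} {g : ι → Fin 2 × Mode}
    (hg : Function.Injective g) (F : Finset ι) (r : ι → ℝ) {σ : ℝ≥0} (hσ : ∑ i ∈ F, r i ^ 2 ≤ σ)
    {ε : ℝ} (hε : 0 ≤ ε) :
    P {ω | ε < |∑ i ∈ F, r i * X (g i) ω|} ≤
      ENNReal.ofReal (2 * Real.exp (-ε ^ 2 / (2 * (σ * c)))) := by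
  have hind : iIndepFun (fun i ω => r i * X (g i) ω) P :=
    (hX.indep.precomp hg).comp (fun i y => r i * y) fun i => measurable_const_mul _
  have hmul : ∀ i, HasSubgaussianMGF (fun ω => r i * X (g i) ω)
      (NNReal.mk (r i ^ 2) (sq_nonneg (r i)) * c) P := fun i => (hc (g i)).const_mul (r i)
  have hsub := HasSubgaussianMGF.sum_of_iIndepFun (s := F) hind fun i _ => hmul i
  have hsub' : HasSubgaussianMGF (fun ω => ∑ i ∈ F, r i * X (g i) ω) (σ * c) P := by
    refine hasSubgaussianMGF_mono hsub ?_
    rw [← Finset.sum_mul]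
    gcongr
    rw [← NNReal.coe_le_coe, NNReal.coe_sum]
    exact hσ
  have h1 := hsub'.measure_ge_le hε
  have h2 := hsub'.neg.measure_ge_le hε
  rw [NNReal.coe_mul] at h1 h2
  have hsubset : {ω | ε < |∑ i ∈ F, r i * X (g i) ω|} ⊆
      {ω | ε ≤ ∑ i ∈ F, r i * X (g i) ω} ∪ {ω | ε ≤ (-fun ω => ∑ i ∈ F, r i * X (g i) ω) ω} := by
    intro ω hω
    rcases lt_abs.1 (show ε < |∑ i ∈ F, r i * X (g i) ω| from hω) with h | h
    · exact Or.inl h.le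
    · exact Or.inr h.le
  rw [← ofReal_measureReal]
  refine ENNReal.ofReal_le_ofReal ((measureReal_mono hsubset).trans
    ((measureReal_union_le _ _).trans ?_))
  linarith

/-- The factor `2^{20k}` counts grid points. With `θ ^ m > 2 ^ 21` and `e^x ≥ x^m / m!` the
exponential is `O(2^{-21k})`, which leaves a geometric series of ratio `1/2`. -/
lemma summable_pow_mul_exp {a θ B : ℝ} (ha : 0 < a) (hθ : 1 < θ) (hB : 0 ≤ B) :
    Summable fun k : ℕ => B * (2 ^ 20) ^ k * (2 * Real.exp (-(a * θ ^ k))) := by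
  obtain ⟨m, hm⟩ := pow_unbounded_of_one_lt (2 ^ 21 : ℝ) hθ
  have hθ0 : 0 < θ := one_pos.trans hθ
  refine Summable.of_nonneg_of_le (fun k => by positivity) (fun k => ?_)
    (summable_geometric_two.mul_left (2 * B * (m.factorial / a ^ m)))
  have hx : 0 < a * θ ^ k := by positivity
  have h1 := Real.pow_div_factorial_le_exp (a * θ ^ k) hx.le m
  have hf : (0 : ℝ) < m.factorial := by exact_mod_cast m.factorial_pos
  have h2 : Real.exp (-(a * θ ^ k)) ≤ m.factorial / a ^ m * (1 / (2 ^ 21) ^ k) := by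
    rw [Real.exp_neg]
    have h3 : a ^ m * (2 ^ 21) ^ k / m.factorial ≤ Real.exp (a * θ ^ k) := by
      refine le_trans ?_ h1
      gcongr
      have hswap : (θ ^ k) ^ m = (θ ^ m) ^ k := by rw [← pow_mul, ← pow_mul, mul_comm]
      rw [mul_pow, hswap]
      gcongr
    have h4 : (0 : ℝ) < a ^ m * (2 ^ 21) ^ k / m.factorial := by positivity
    refine (inv_anti₀ h4 h3).trans (le_of_eq ?_)
    field_simp
  calc B * (2 ^ 20) ^ k * (2 * Real.exp (-(a * θ ^ k)))
      ≤ B * (2 ^ 20) ^ k * (2 * (m.factorial / a ^ m * (1 / (2 ^ 21) ^ k))) := by gcongr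
    _ = 2 * B * (m.factorial / a ^ m) * (1 / 2) ^ k := by
        have : ((2 : ℝ) ^ 21) ^ k = (2 ^ 20) ^ k * 2 ^ k := by rw [← mul_pow]; norm_num
        rw [this, div_pow, one_pow]
        field_simp

lemma card_gridIndex_le (L k : ℕ) :
    ((gridIndex L k).card : ℝ) ≤ (2 * L + 1) ^ 4 * (2 ^ 20) ^ k := by
  have h1 : (gridIndex L k).card = (2 * (L * 2 ^ (5 * k)) + 1) ^ 4 := by
    rw [gridIndex, Finset.card_product, Fintype.card_piFinset]
    simp only [Int.card_Icc, Finset.prod_const, Finset.card_univ, Fintype.card_fin]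
    have : ((L : ℤ) * 2 ^ (5 * k) + 1 - -(L * 2 ^ (5 * k))).toNat =
        2 * (L * 2 ^ (5 * k)) + 1 := by
      have h : (L : ℤ) * 2 ^ (5 * k) + 1 - -(L * 2 ^ (5 * k)) =
          ((2 * (L * 2 ^ (5 * k)) + 1 : ℕ) : ℤ) := by push_cast; ring
      rw [h, Int.toNat_natCast]
    rw [this]
    ring
  rw [h1]
  push_cast
  have h2 : (1 : ℝ) ≤ 2 ^ (5 * k) := one_le_pow₀ one_le_two
  calc (2 * ((L : ℝ) * 2 ^ (5 * k)) + 1) ^ 4 ≤ ((2 * (L : ℝ) + 1) * 2 ^ (5 * k)) ^ 4 := by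
        gcongr
        linarith
    _ = (2 * (L : ℝ) + 1) ^ 4 * (2 ^ 20) ^ k := by
        rw [mul_pow, ← pow_mul, ← pow_mul]
        congr 2
        ring

/-- A union bound over the grid, and then the Borel–Cantelli lemma in `k`. -/
lemma IsRandomisation.ae_eventually_block_le [IsProbabilityMeasure P] (hX : IsRandomisation P X)
    {s : ℝ} (hs₀ : 0 < s) {d : Fin 2 → Mode → ℝ}
    (hd : ∀ j, WeightedSummable (dataExponent s j) (d j)) (L : ℕ) :
    ∀ᵐ ω ∂P, ∀ᶠ k in atTop, ∀ j ∈ gridIndex L k,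
      |∑ i ∈ shellModes k, freeSymbol i.1 (gridPoint k j).1 i.2.2.1 *
        trigPart i.2.1 i.2.2.1 (gridPoint k j).2 * d i.1 (modeOf i.2.1 i.2.2.1) *
          X (i.1, modeOf i.2.1 i.2.2.1) ω| ≤ blockRate s ^ k := by
  obtain ⟨c, hc0, hc⟩ := hX.exists_hasSubgaussianMGF
  set ρ := blockRate s with hρ
  have hρ0 : 0 < ρ := blockRate_pos s
  have hρ1 : ρ < 1 := blockRate_lt_one hs₀
  have hA : 0 ≤ dataWeight s d := Finset.sum_nonneg fun j _ => tsum_nonneg fun κ =>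
    mul_nonneg (Real.rpow_nonneg (bracket_pos _).le _) (sq_nonneg _)
  -- The summand `1` keeps `A` positive when the data vanish, so that the rate `a` is well defined.
  let A : ℝ := ((L : ℝ) + 2) ^ 2 * (dataWeight s d + 1)
  have hApos : 0 < A := by positivity
  let a : ℝ := 1 / (2 * (A * c))
  have hc0' : (0 : ℝ) < c := by exact_mod_cast hc0
  have ha : 0 < a := by positivity
  let S : ℕ → (ℤ × (Fin 3 → ℤ)) → Ω → ℝ := fun k j ω =>
    ∑ i ∈ shellModes k, freeSymbol i.1 (gridPoint k j).1 i.2.2.1 *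
      trigPart i.2.1 i.2.2.1 (gridPoint k j).2 * d i.1 (modeOf i.2.1 i.2.2.1) *
        X (i.1, modeOf i.2.1 i.2.2.1) ω
  have hinj : Function.Injective fun i : Fin 2 × Bool × {n : Freq // n ≠ 0} =>
      (i.1, modeOf i.2.1 i.2.2.1) := by
    rintro ⟨j, q⟩ ⟨j', q'⟩ h
    have h1 := congrArg Prod.fst h
    have h2 := modeOf_injective (congrArg Prod.snd h)
    exact Prod.ext h1 h2
  have hone : ∀ k, ∀ j ∈ gridIndex L k, P {ω | ρ ^ k < |S k j ω|} ≤
      ENNReal.ofReal (2 * Real.exp (-(a * ((ρ ^ 2)⁻¹) ^ k))) := fun k j hj => by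
    have h1 := sum_coeff_sq_le hs₀.le hd k (abs_gridPoint_le hj)
    have hσ : 0 ≤ A * ρ ^ (4 * k) := by positivity
    have h2 := hX.measure_abs_sum_ge_le hc hinj (shellModes k)
      (fun i => freeSymbol i.1 (gridPoint k j).1 i.2.2.1 *
        trigPart i.2.1 i.2.2.1 (gridPoint k j).2 * d i.1 (modeOf i.2.1 i.2.2.1))
      (σ := (A * ρ ^ (4 * k)).toNNReal) (h1.trans ?_) (pow_pos hρ0 k).le
    -- The exponent is `ρ^{2k} / (2 A c ρ^{4k}) = a ρ^{-2k}`, which grows exponentially in `k`.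
    · refine h2.trans (le_of_eq ?_)
      congr 3
      rw [Real.coe_toNNReal _ hσ]
      simp only [a]
      rw [inv_pow, ← pow_mul, ← pow_mul, show 4 * k = 2 * k + 2 * k by ring, pow_add,
        mul_comm k 2]
      have := pow_pos hρ0 (2 * k)
      field_simp
    · rw [Real.coe_toNNReal _ hσ]
      simp only [A]
      have := pow_pos hρ0 (4 * k)
      nlinarith [mul_nonneg (sq_nonneg ((L : ℝ) + 2)) this.le]
  have hθ : 1 < (ρ ^ 2)⁻¹ := by
    rw [one_lt_inv₀ (by positivity)]
    exact pow_lt_one₀ hρ0.le hρ1 two_ne_zero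
  have hsum := summable_pow_mul_exp ha hθ (by positivity : (0 : ℝ) ≤ (2 * L + 1) ^ 4)
  have hBC : ∑' k, P (⋃ j ∈ gridIndex L k, {ω | ρ ^ k < |S k j ω|}) ≠ ⊤ := by
    refine ne_top_of_le_ne_top hsum.tsum_ofReal_ne_top (ENNReal.tsum_le_tsum fun k => ?_)
    refine (measure_biUnion_finset_le _ _).trans ((Finset.sum_le_card_nsmul _ _ _
      (hone k)).trans ?_)
    rw [nsmul_eq_mul, ← ENNReal.ofReal_natCast, ← ENNReal.ofReal_mul (Nat.cast_nonneg _)]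
    exact ENNReal.ofReal_le_ofReal
      (mul_le_mul_of_nonneg_right (card_gridIndex_le L k) (by positivity))
  filter_upwards [ae_eventually_notMem hBC] with ω hω
  filter_upwards [hω] with k hk j hj
  by_contra hcon
  exact hk (mem_biUnion hj (not_le.1 hcon))

lemma IsRandomisation.ae_mem_gridRegularData [IsProbabilityMeasure P] (hX : IsRandomisation P X)
    {s : ℝ} (hs₀ : 0 < s) {d₀ d₁ : Mode → ℝ} (h₀ : WeightedSummable s d₀)
    (h₁ : WeightedSummable (s - 1) d₁) :
    ∀ᵐ ω ∂P, randomData s d₀ d₁ X ω ∈ gridRegularData s := by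
  have hd : ∀ j, WeightedSummable (dataExponent s j) ((![d₀, d₁] : Fin 2 → Mode → ℝ) j) := by
    intro j
    fin_cases j
    · simpa [dataExponent] using h₀
    · simpa [dataExponent] using h₁
  filter_upwards [(randomData_spec hX h₀ h₁).2,
    ae_all_iff.2 fun L => hX.ae_eventually_block_le hs₀ hd L] with ω hω hL
  intro L
  filter_upwards [hL L] with k hk j hj
  refine le_trans (le_of_eq ?_) (hk j hj)
  rw [freeBlock_eq_sum_modes (d := fun j κ => X (j, κ) ω * (![d₀, d₁] : Fin 2 → Mode → ℝ) j κ)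
    (fun n => (hω n).1) (fun n => (hω n).2)]
  congr 1
  refine Finset.sum_congr rfl fun i _ => ?_
  ring

/-- `gridRegularData` is a measurable subset of full measure; measurability of `solvableData` itself
is not claimed. -/
theorem exists_measurableSet_solvableData {s : ℝ} (hs₀ : 0 < s) (hs : s ≤ 1)
    {μ : Measure (PhaseSpace s)} (hμ : μ ∈ randomisedMeasures.{u} s) :
    ∃ M ⊆ solvableData hs, MeasurableSet M ∧ μ M = 1 := by
  obtain ⟨v, d₀, d₁, h₀, h₁, Ω, _, P, X, hP, hX, rfl⟩ := hμ
  have hm := measurableSet_gridRegularData s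
  have haem := (randomData_spec hX h₀.1 h₁.1).1
  refine ⟨gridRegularData s, fun v hv => (representsFree_freeLimit hs₀ hv).mem_solvableData hs,
    hm, ?_⟩
  have : IsProbabilityMeasure (P.map (randomData s d₀ d₁ X)) := Measure.isProbabilityMeasure_map haem
  rw [← mem_ae_iff_prob_eq_one hm]
  exact (ae_map_iff haem hm).2 (hX.ae_mem_gridRegularData hs₀ h₀.1 h₁.1)

end Randomisation

end CubicWave

end

/-! ### Almost sure global well-posedness -/

theorem theorem2 (s : ℝ) (hs₀ : 0 < s) (hs₁ : s < 1) (μ : Measure (PhaseSpace s))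
    (hμ : μ ∈ randomisedMeasures.{u} s) :
    ∃ (S : Set (PhaseSpace s)) (Φ : ℝ → PhaseSpace s → PhaseSpace s),
      (∃ M ⊆ S, MeasurableSet M ∧ μ M = 1) ∧
      (∀ v ∈ S, IsGlobalSolution hs₁.le v (fun t => Φ t v) ∧
        ∀ z : ℝ → PhaseSpace s, IsGlobalSolution hs₁.le v z → z = fun t => Φ t v) ∧
      ∀ t : ℝ, Φ t '' S = S := by
  refine ⟨solvableData hs₁.le, waveFlow hs₁.le, exists_measurableSet_solvableData hs₀ hs₁.le hμ,
    fun v hv => ⟨isGlobalSolution_waveFlow hs₀.le hs₁.le hv, fun z hz =>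
      hz.unique hv (isGlobalSolution_waveFlow hs₀.le hs₁.le hv)⟩, image_waveFlow hs₀.le hs₁.le⟩
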